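/- Notation. Let $N\ge 1$, $P_N=\{1,\dots,N\}$, $\mathrm e(z)=e^{2\pi i z}$, and let $\mathcal C=\{z\in\mathbb C:\mathrm{Re}\,z>0\}\cup i\mathbb R_{>0}$. Let $\mathbb D_N$ be the set of triples $\delta=(w,a,\theta)\in\mathbb C\times\mathbb C^N\times\mathbb R^N$ such that $\theta_\ell\notin\mathbb Z$ whenever $a_\ell=0$. For $\Lambda\subseteq P_N$, $\sigma\in S_N$ and $\alpha\in\mathbb C^*$ define maps $\mathbb D_N\to\mathbb D_N$ as follows: $M_\alpha(w,a,\theta)=(\alpha w,\alpha a,\theta)$; $R_\sigma(w,a,\theta)=(w,(a_{\sigma^{-1}(\ell)})_\ell,(\theta_{\sigma^{-1}(\ell)})_\ell)$; and $T_\Lambda$ replaces $w$ by $w-\sum_{\ell\in\Lambda}a_\ell$ and changes the signs of $a_\ell$ and $\theta_\ell$ for $\ell\in\Lambda$. Put $\pi(w,a,\theta)=w-\sum_{\ell:\,a_\ell\in-\mathcal C}a_\ell$ and $\widetilde{\mathcal D}_N^{\mathbb C^*}=\{\delta\in\mathbb D_N:\pi(M_\beta\delta)\in\mathcal C\text{ for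 all }\beta\in\mathbb C^*\}$. Let $F_N(u,\delta)=e^{-uw}\prod_{\ell=1}^N\big(1-\mathrm e(\theta_\ell)e^{-ua_\ell}\big)^{-1}$. Let $\epsilon$ be any function that assigns to each $\delta\in\mathbb D_N$ a radius $\epsilon(\delta)>0$ such that no equation $\mathrm e(\theta_\ell)=e^{ua_\ell}$ has a solution $u$ with $0<|u|\le\epsilon(\delta)$. Put $$\mathcal L_{N,\epsilon}(s,\delta)=\frac{1}{\Gamma(s)(\mathrm e(s)-1)}\int_{C(\epsilon(\delta))}F_N(u,\delta)u^{s-1}\,du,$$ where $C(r)$ is the Hankel contour that runs from $+\infty$ to $r$ (with $\mathrm{Arg}\,u=0$), once counterclockwise around the circle $|u|=r$, and back from $r$ to $+\infty$ (with $\mathrm{Arg}\,u=2\pi$); removable singularities in $s$ are removed. For $\delta\in\widetilde{\mathcal D}_N^{\mathbb C^*}$ let $$\mathcal L_N(s,\delta)=\lim_{\omega\to0^-}\mathcal L_{N,\epsilon}(s,M_{e^{i\omega}}\delta)\qquad(s\in\mathbb C\smallsetminus P_N),$$ which exists, is holomorphic in $s\in\mathbb C\smallsetminus P_N$ and is meromorphic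 in $s\in\mathbb C$. For $\psi\in(-\pi,\pi]$ let $\mathcal P_\psi$ be the set of nonzero poles $u_0$ of $u\mapsto F_N(u,\delta)$ with $\arg u_0\in[0,\psi)$ if $\psi>0$, and with $\arg u_0\in[\psi,0)$ if $\psi<0$ ($\mathcal P_0=\emptyset$). Let $\rho_N^\psi(s,\delta)$ be the meromorphic continuation to $s\in\mathbb C$ (removable singularities being removed) of $$\rho_N^\psi(s,\delta)=\mathrm{sgn}(-\psi)\,2\pi i\lim_{R\to\infty}\ \sum_{u_0\in\mathcal P_\psi,\ |u_0|<R}\mathrm{Res}_{u=u_0}\big(F_N(u,\delta)u^{s-1}\big)\qquad(\mathrm{Re}(s)<1),$$ where $u^{s-1}$ is the principal branch and $R\to\infty$ through radii whose circles $|u|=R$ stay at a distance bounded below by some (arbitrary) $\eta>0$ from the nonzero poles of $F_N(\cdot,\delta)$. For $\delta\in\widetilde{\mathcal D}_N^{\mathbb C^*}$ this limit and this continuation exist, and the continuation is holomorphic on $\mathbb C\smallsetminus P_N$. Finally, for $g=T_\Lambda R_\sigma M_\alpha$ put $J_g(s,\theta)=(-1)^{|\Lambda|}\,\mathrm e\big(\sum_{\ell\in\sigma^{-1}[\Lambda]}\theta_\ell\big)\,\alpha^{-s}$,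 with the principal branch of the logarithm, as also in $\log(\alpha)$ below. Statement. Let $g=T_\Lambda R_\sigma M_\alpha$ and $\psi=\arg(\alpha)\in(-\pi,\pi]$, and let $\delta=(w,a,\theta)\in\widetilde{\mathcal D}_N^{\mathbb C^*}$ satisfy $g\delta=\delta$. Then $$\rho_N^\psi(s,\delta)=\Gamma(s)\big[J_g(s,\theta)^{-1}-1\big]\mathcal L_N(s,\delta)$$ for all $s\in\mathbb C\smallsetminus P_N$, the right-hand side being read as its limit at the poles $0,-1,-2,\dots$ of $\Gamma$. In particular, for $k\in\mathbb Z$: (i) If $k\le0$ and $J_g(k,\theta)=1$, then $\rho_N^\psi(k,\delta)=\frac{(-1)^k}{(-k)!}\log(\alpha)\,\mathcal L_N(k,\delta)$. (ii) If $k\le0$ and $J_g(k,\theta)\ne1$, then $\mathcal L_N(k,\delta)=0$ and $\rho_N^\psi(k,\delta)=\frac{(-1)^k}{(-k)!}\big[J_g(k,\theta)^{-1}-1\big]\mathcal L_N'(k,\delta)$, where $'$ denotes $d/ds$. (iii) If $k\in P_N$ and $J_g(k,\theta)=1$, then $\rho_N^\psi(\cdot,\delta)$ is holomorphic at $k$ and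 $\rho_N^\psi(k,\delta)=(k-1)!\,\log(\alpha)\,\mathrm{Res}_{s=k}\mathcal L_N(s,\delta)$. (iv) If $k\in P_N$ and $J_g(k,\theta)\ne1$, then $\mathrm{Res}_{s=k}\,\rho_N^\psi(s,\delta)=(k-1)!\big[J_g(k,\theta)^{-1}-1\big]\mathrm{Res}_{s=k}\mathcal L_N(s,\delta)$. (v) If $k\ge N+1$ and $J_g(k,\theta)=1$, then $\rho_N^\psi(k,\delta)=0$ and $\frac{d}{ds}\rho_N^\psi(s,\delta)\big|_{s=k}=(k-1)!\,\log(\alpha)\,\mathcal L_N(k,\delta)$. (vi) If $k\ge N+1$ and $J_g(k,\theta)\ne1$, then $\rho_N^\psi(k,\delta)=(k-1)!\big[J_g(k,\theta)^{-1}-1\big]\mathcal L_N(k,\delta)$. -/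

import Mathlib

open Filter Topology MeasureTheory

noncomputable section

namespace Barnes

/-- A triple `(w, a, θ) ∈ ℂ × ℂ^N × ℝ^N`. -/
@[ext]
structure Param (N : ℕ) where
  w : ℂ
  a : Fin N → ℂ
  θ : Fin N → ℝ

variable {N : ℕ}

/-- `e(z) = exp (2 π i z)`. -/
def e (z : ℂ) : ℂ := Complex.exp (2 * Real.pi * Complex.I * z)

/-- The convex cone `𝒞`: the open right half-plane together with the positive imaginary axis. -/
def cone : Set ℂ := {z | 0 < z.re ∨ (z.re = 0 ∧ 0 < z.im)}

/-- `P_N = {1, …, N}`, as a set of complex numbers. -/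
def P (N : ℕ) : Set ℂ := {s | ∃ k : ℕ, 1 ≤ k ∧ k ≤ N ∧ s = (k : ℂ)}

/-- `𝔻_N`: the triples such that `θ_ℓ ∉ ℤ` whenever `a_ℓ = 0`. -/
def goodDomain (N : ℕ) : Set (Param N) :=
  {δ | ∀ ℓ, δ.a ℓ = 0 → ∀ m : ℤ, δ.θ ℓ ≠ (m : ℝ)}

open Classical in
/-- `π(w, a, θ) = w - ∑ a_ℓ`, the sum over all `ℓ` with `a_ℓ ∈ -𝒞`. -/
def proj (δ : Param N) : ℂ := δ.w - ∑ ℓ with -δ.a ℓ ∈ cone, δ.a ℓ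

/-- `M_α (w, a, θ) = (α w, α a, θ)`. -/
def M (α : ℂ) (δ : Param N) : Param N := ⟨α * δ.w, fun ℓ => α * δ.a ℓ, δ.θ⟩

/-- `R_σ` permutes the coordinates of `a` and of `θ`: the `ℓ`-th one becomes the old
`σ⁻¹(ℓ)`-th one. -/
def R (σ : Equiv.Perm (Fin N)) (δ : Param N) : Param N :=
  ⟨δ.w, fun ℓ => δ.a (σ⁻¹ ℓ), fun ℓ => δ.θ (σ⁻¹ ℓ)⟩

/-- `T_Λ` subtracts `∑_{ℓ ∈ Λ} a_ℓ` from `w` and changes the signs of `a_ℓ` and `θ_ℓ`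
for `ℓ ∈ Λ`. -/
def T (Λ : Finset (Fin N)) (δ : Param N) : Param N :=
  ⟨δ.w - ∑ ℓ ∈ Λ, δ.a ℓ, fun ℓ => if ℓ ∈ Λ then -δ.a ℓ else δ.a ℓ,
    fun ℓ => if ℓ ∈ Λ then -δ.θ ℓ else δ.θ ℓ⟩

/-- The triples `δ ∈ 𝔻_N` such that `π (M_α δ) ∈ 𝒞` for all `α ∈ ℂ*`. -/
def DtildeCstar (N : ℕ) : Set (Param N) :=
  {δ | δ ∈ goodDomain N ∧ ∀ α : ℂ, α ≠ 0 → proj (M α δ) ∈ cone}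

/-- `J_g(s, θ) = (-1)^|Λ| e(∑_{ℓ ∈ σ⁻¹[Λ]} θ_ℓ) α^{-s}` for `g = T_Λ R_σ M_α`. -/
def J (Λ : Finset (Fin N)) (σ : Equiv.Perm (Fin N)) (α : ℂ) (θ : Fin N → ℝ) (s : ℂ) : ℂ :=
  (-1) ^ Λ.card * e (∑ ℓ ∈ Λ.image (σ⁻¹ : Equiv.Perm (Fin N)), (θ ℓ : ℂ)) * α ^ (-s)

/-- The test function `F_N(u, w, a, θ)`. -/
def F (δ : Param N) (u : ℂ) : ℂ :=
  Complex.exp (-u * δ.w) * ∏ ℓ, (1 - e (δ.θ ℓ) * Complex.exp (-u * δ.a ℓ))⁻¹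

/-- `ε` is an admissible choice of radii: for `δ = (w, a, θ) ∈ 𝔻_N` one has `ε(δ) > 0`, and
no equation `e(θ_ℓ) = exp (u a_ℓ)` has a solution `u` with `0 < |u| ≤ ε(δ)`. -/
def Admissible (ε : Param N → ℝ) : Prop :=
  ∀ δ ∈ goodDomain N, 0 < ε δ ∧
    ∀ ℓ, ∀ u : ℂ, 0 < ‖u‖ → ‖u‖ ≤ ε δ → e (δ.θ ℓ) ≠ Complex.exp (u * δ.a ℓ)

/-- The integral of `F_N(u, δ) u^{s-1}` over the Hankel contour: from `+∞` to `r` with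
`Arg u = 0`, then once counterclockwise along `|u| = r` with `Arg u` from `0` to `2π`, then from
`r` to `+∞` with `Arg u = 2π`. -/
def hankel (r : ℝ) (δ : Param N) (s : ℂ) : ℂ :=
  -(∫ x in Set.Ioi r, F δ (x : ℂ) * Complex.exp ((s - 1) * (Real.log x : ℂ)))
  + (∫ t in (0 : ℝ)..(2 * Real.pi),
      F δ (r * Complex.exp (Complex.I * t))
        * Complex.exp ((s - 1) * ((Real.log r : ℂ) + Complex.I * t))
        * (Complex.I * r * Complex.exp (Complex.I * t)))
  + ∫ x in Set.Ioi r, F δ (x : ℂ)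
      * Complex.exp ((s - 1) * ((Real.log x : ℂ) + Complex.I * (2 * Real.pi)))

/-- The quotient of the Hankel integral by `Γ(s) (e(s) - 1)`, meaningful for `s ∉ ℤ`. -/
def hankelQuot (r : ℝ) (δ : Param N) (s : ℂ) : ℂ :=
  1 / (Complex.Gamma s * (e s - 1)) * hankel r δ s

/-- `ℒ_{N,ε}(s, δ)`: the above quotient, its removable singularities at integers removed (where
the quotient is continuous the limit is its value). -/
def Leps (ε : Param N → ℝ) (s : ℂ) (δ : Param N) : ℂ :=
  limUnder (𝓝[≠] s) (hankelQuot (ε δ) δ)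

/-- `ℒ_N(s, δ)`: the limit of `ℒ_{N,ε}(s, M_{exp(iω)} δ)` as `ω → 0`, `ω < 0`. -/
def LN (ε : Param N → ℝ) (δ : Param N) (s : ℂ) : ℂ :=
  limUnder (𝓝[<] (0 : ℝ)) (fun ω : ℝ => Leps ε s (M (Complex.exp (Complex.I * ω)) δ))

/-- The residue of `f` at an isolated singularity `z`: the integrals over small circles. -/
def residue (f : ℂ → ℂ) (z : ℂ) : ℂ :=
  limUnder (𝓝[>] (0 : ℝ))
    (fun r : ℝ => (2 * Real.pi * Complex.I)⁻¹ * ∮ u in C(z, r), f u)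

/-- The nonzero poles of `u ↦ F_N(u, δ)` for `δ ∈ 𝔻_N`: the nonzero zeros of the factors of the
denominator (the numerator has no zeros). -/
def poles (δ : Param N) : Set ℂ :=
  {u | u ≠ 0 ∧ ∃ ℓ, 1 - e (δ.θ ℓ) * Complex.exp (-u * δ.a ℓ) = 0}

/-- `𝒫_ψ`: the nonzero poles with argument in `[0, ψ)` if `ψ > 0`, in `[ψ, 0)` if `ψ < 0`. -/
def sectorPoles (ψ : ℝ) (δ : Param N) : Set ℂ :=
  {u | u ∈ poles δ ∧
    ((0 < ψ ∧ 0 ≤ u.arg ∧ u.arg < ψ) ∨ (ψ < 0 ∧ ψ ≤ u.arg ∧ u.arg < 0))}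

/-- The partial sum over `|u₀| < r` in the definition of `ρ_N^ψ`. -/
def rhoPartial (ψ : ℝ) (δ : Param N) (s : ℂ) (r : ℝ) : ℂ :=
  (Real.sign (-ψ) : ℂ) * (2 * Real.pi * Complex.I)
    * ∑ᶠ u₀ ∈ {u | u ∈ sectorPoles ψ δ ∧ ‖u‖ < r}, residue (fun u => F δ u * u ^ (s - 1)) u₀

/-- The radii `r` such that the circle `|u| = r` stays at distance at least `η` from the nonzero
poles. They are unbounded if `η` is small, the poles lying on finitely many arithmetic
progressions. -/
def goodRadii (δ : Param N) (η : ℝ) : Set ℝ := {r | ∀ u ∈ poles δ, η ≤ |r - ‖u‖|}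

/-- `f` is the meromorphic continuation to `ℂ`, removable singularities being removed, of the
limit of the partial sums for `Re s < 1`; here `r → ∞` along radii whose circles stay uniformly
away from the poles. -/
structure IsRho (ψ : ℝ) (δ : Param N) (f : ℂ → ℂ) : Prop where
  meromorphic : MeromorphicNFOn f Set.univ
  series : ∀ s : ℂ, s.re < 1 → ∀ η : ℝ, 0 < η →
    Tendsto (rhoPartial ψ δ s) (atTop ⊓ 𝓟 (goodRadii δ η)) (𝓝 (f s))

/-- `ρ_N^ψ(·, δ)`. -/
def rho (ψ : ℝ) (δ : Param N) : ℂ → ℂ := Classical.epsilon (IsRho ψ δ)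

end Barnes

end

noncomputable section

namespace Barnes

variable {N : ℕ}

/-! ### Growth of the test function along rays -/

/-! Write the form `F(u) u^{s-1} du` in the coordinate `u = exp z`, and let S(y₁, y₂) be its
integral in along the ray of argument y₁, along an arc of small radius r, and out along the ray of
argument y₂. Three facts carry the theorem.

Symmetry. S is additive in the angles. If `δ` is fixed by g, then |α| = 1 (`norm_eq_one_of_fixed`)
and F(αu) is a constant multiple of F(u) (`F_comp_mul`), so turning both angles by ψ = arg α
multiplies S by J(s)⁻¹. Turning by 2π multiplies it by e(s). Cutting the sector from ω to ω + ψ + 2π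
in two ways gives (J(s)⁻¹ - 1) S(ω, ω + 2π) = (e(s) - 1) S(ω, ω + ψ), which is
`hankel_functional_equation`.

Identification. For small negative ω, S(ω, ω + 2π) is the rotated Hankel integral up to the factor
exp(-iωs), which tends to 1. So ℒ_N = S(ω, ω + 2π) / (Γ (e - 1)) (`hankel_eq`, `LN_spec`). By the
residue theorem on annular sectors (`rectIntegral_comp_exp`, `sum_residue_eq`), S(ω, ω + ψ) is the
limit of the signed residue sums, provided that the arc at infinity vanishes. Since S(ω, ω + ψ) is
entire in s, it is ρ (`rho_eq`), and ρ is entire.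

The arc at infinity. On the ray of argument y, F decays like exp(-R g(y)), where g is `growth`. The
hypothesis on all rotations of `δ` makes g nonnegative with zeros that are at worst linear
(`exists_linear_le_growth`). Hence the integral of exp(-R g) over the angles is O(1/R) and the arc
is O(R^{Re s - 1}), which tends to 0 for Re s < 1 (`tendsto_arcIntegral_goodRadii`).

The statements at integers follow by comparing the zeros and poles of Γ, e - 1 and J⁻¹ - 1 in the
functional equation. For k > N the Hankel integral vanishes because F has a pole of order at most N
at 0 (`hankel_eq_zero_of_lt`). -/

/-- The exponential decay rate of `F(·, δ)` along the ray of argument `y`. -/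
def growth (δ : Param N) (y : ℝ) : ℝ := (proj (M (Complex.exp (y * Complex.I)) δ)).re

/-- The arguments along which `F(·, δ)` decays exponentially and has no poles. -/
def Regular (δ : Param N) (y : ℝ) : Prop :=
  0 < growth δ y ∧ ∀ ℓ, δ.a ℓ ≠ 0 → (Complex.exp (y * Complex.I) * δ.a ℓ).re ≠ 0

/-- An `a ℓ` on the imaginary axis adds nothing to the real part, whichever side of the cone it lies
on. So the real part varies continuously although `proj` jumps. -/
lemma re_proj (δ : Param N) : (proj δ).re = δ.w.re + ∑ ℓ, max 0 (-(δ.a ℓ).re) := by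
  classical
  unfold proj
  rw [Complex.sub_re, Complex.re_sum, Finset.sum_filter, sub_eq_add_neg, ← Finset.sum_neg_distrib]
  congr 1
  refine Finset.sum_congr rfl fun ℓ _ => ?_
  split_ifs with h
  · simp only [cone, Set.mem_ofPred_eq, Complex.neg_re] at h
    rw [max_eq_right]
    rcases h with h | h <;> linarith [h]
  · simp only [cone, Set.mem_ofPred_eq, Complex.neg_re, not_or, not_lt] at h
    rw [max_eq_left h.1, neg_zero]

lemma growth_eq (δ : Param N) (y : ℝ) :
    growth δ y = (Complex.exp (y * Complex.I) * δ.w).re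
      + ∑ ℓ, max 0 (-(Complex.exp (y * Complex.I) * δ.a ℓ).re) := re_proj _

lemma continuous_growth (δ : Param N) : Continuous (growth δ) := by
  have h : growth δ = fun y : ℝ => (Complex.exp (y * Complex.I) * δ.w).re
      + ∑ ℓ, max 0 (-(Complex.exp (y * Complex.I) * δ.a ℓ).re) := funext (growth_eq δ)
  rw [h]
  fun_prop

lemma zero_notMem_cone : (0 : ℂ) ∉ cone := by simp [cone]

lemma re_nonneg_of_mem_cone {z : ℂ} (h : z ∈ cone) : 0 ≤ z.re := by
  rcases h with h | h
  · exact h.le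
  · exact h.1.ge

lemma growth_nonneg {δ : Param N} (hδ : δ ∈ DtildeCstar N) (y : ℝ) : 0 ≤ growth δ y :=
  re_nonneg_of_mem_cone (hδ.2 _ (Complex.exp_ne_zero _))

lemma re_exp_mul (τ : ℝ) (b : ℂ) :
    (Complex.exp (τ * Complex.I) * b).re = Real.cos τ * b.re - Real.sin τ * b.im := by
  rw [Complex.mul_re, Complex.exp_ofReal_mul_I_re, Complex.exp_ofReal_mul_I_im]

/-- The expression is cos τ · Re b - sin τ · Im b. Either it is positive at τ = 0, or it reduces to
-sin τ · Im b and Jordan's inequality sin τ ≥ 2τ/π applies. -/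
lemma linear_le_re_exp_mul {b : ℂ} (hb : 0 < b.re ∨ (b.re = 0 ∧ b.im < 0)) :
    ∃ c > 0, ∀ᶠ τ : ℝ in 𝓝[>] 0, c * τ ≤ (Complex.exp (τ * Complex.I) * b).re := by
  rcases hb with h | ⟨h, h'⟩
  · have hc : Continuous fun τ : ℝ => (Complex.exp (τ * Complex.I) * b).re - b.re * τ := by fun_prop
    have h0 := hc.tendsto 0
    simp only [Complex.ofReal_zero, zero_mul, Complex.exp_zero, one_mul, mul_zero, sub_zero] at h0
    refine ⟨b.re, h, ?_⟩
    filter_upwards [nhdsWithin_le_nhds (h0.eventually (lt_mem_nhds h))] with τ hτ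
    linarith
  · refine ⟨-b.im * (2 / Real.pi), mul_pos (by linarith) (by positivity), ?_⟩
    filter_upwards [self_mem_nhdsWithin,
      nhdsWithin_le_nhds (gt_mem_nhds (show (0 : ℝ) < Real.pi / 2 by positivity))] with τ h1 h2
    have := Real.mul_le_sin (le_of_lt h1) h2.le
    rw [re_exp_mul, h]
    nlinarith

/-- A nonzero sinusoid has a definite sign just to the right of 0 and vanishes there to order at
most one. -/
lemma exists_linear_le_re_exp_mul {b : ℂ} (hb : b ≠ 0) :
    (∃ c > 0, ∀ᶠ τ : ℝ in 𝓝[>] 0, c * τ ≤ (Complex.exp (τ * Complex.I) * b).re) ∨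
    (∃ c > 0, ∀ᶠ τ : ℝ in 𝓝[>] 0, c * τ ≤ -(Complex.exp (τ * Complex.I) * b).re) := by
  by_cases h : 0 < b.re ∨ (b.re = 0 ∧ b.im < 0)
  · exact Or.inl (linear_le_re_exp_mul h)
  · right
    have h' : 0 < (-b).re ∨ ((-b).re = 0 ∧ (-b).im < 0) := by
      simp only [Complex.neg_re, Complex.neg_im]
      by_contra hcon
      push Not at h hcon
      have hre : b.re = 0 := le_antisymm h.1 (by linarith [hcon.1])
      have h1 := h.2 hre
      have h2 := hcon.2 (by linarith)
      exact hb (Complex.ext hre (le_antisymm (by simp; linarith) (by simpa using h1)))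
    simpa using linear_le_re_exp_mul h'

/-- Rotation and, for `κ = -1`, reflection, so that one-sided limits become right limits at `0`. -/
lemma exists_twist {κ : ℝ} (hκ : κ = 1 ∨ κ = -1) (y₀ : ℝ) (b : ℂ) (hb : b ≠ 0) :
    ∃ b' : ℂ, b' ≠ 0 ∧ ∀ τ : ℝ, (Complex.exp ((y₀ + κ * τ : ℝ) * Complex.I) * b).re
      = (Complex.exp (τ * Complex.I) * b').re := by
  rcases hκ with rfl | rfl
  · refine ⟨Complex.exp (y₀ * Complex.I) * b, by simp [hb], fun τ => ?_⟩
    rw [← mul_assoc, ← Complex.exp_add]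
    congr 3
    push_cast
    ring
  · refine ⟨starRingEnd ℂ (Complex.exp (y₀ * Complex.I) * b), by simp [hb], fun τ => ?_⟩
    rw [re_exp_mul, re_exp_mul, Complex.conj_re, Complex.conj_im, re_exp_mul, Complex.mul_im,
      Complex.exp_ofReal_mul_I_re, Complex.exp_ofReal_mul_I_im, neg_one_mul, ← sub_eq_add_neg,
      Real.cos_sub, Real.sin_sub]
    ring

lemma mem_neg_cone_of_re_neg {z : ℂ} (h : z.re < 0) : -z ∈ cone := Or.inl (by simpa using h)

lemma notMem_neg_cone_of_re_pos {z : ℂ} (h : 0 < z.re) : -z ∉ cone := by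
  rintro (h' | h') <;> simp at h' <;> linarith [h']

/-- On a short interval to one side of `y₀` the signs of all Re(e^{iy} a_ℓ) are frozen, so `proj` of
the rotated triple is e^{iy} W with a fixed W. Since 0 is not in the cone, W ≠ 0, and the growth is
a nonzero sinusoid, hence at least linear once its sign is known. -/
lemma one_sided_growth {δ : Param N} (hδ : δ ∈ DtildeCstar N) {κ : ℝ} (hκ : κ = 1 ∨ κ = -1)
    (y₀ : ℝ) : ∃ c > 0, ∀ᶠ τ : ℝ in 𝓝[>] 0, c * τ ≤ growth δ (y₀ + κ * τ) ∧
      ∀ ℓ, δ.a ℓ ≠ 0 → (Complex.exp ((y₀ + κ * τ : ℝ) * Complex.I) * δ.a ℓ).re ≠ 0 := by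
  classical
  have hpos : ∀ᶠ τ : ℝ in 𝓝[>] 0, 0 < τ := self_mem_nhdsWithin
  have hsign : ∀ ℓ, δ.a ℓ ≠ 0 →
      (∀ᶠ τ : ℝ in 𝓝[>] 0, 0 < (Complex.exp ((y₀ + κ * τ : ℝ) * Complex.I) * δ.a ℓ).re) ∨
      (∀ᶠ τ : ℝ in 𝓝[>] 0, (Complex.exp ((y₀ + κ * τ : ℝ) * Complex.I) * δ.a ℓ).re < 0) := by
    intro ℓ hℓ
    obtain ⟨b', hb', hb⟩ := exists_twist hκ y₀ _ hℓ
    simp only [hb]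
    rcases exists_linear_le_re_exp_mul hb' with ⟨c, hc, h⟩ | ⟨c, hc, h⟩
    · left
      filter_upwards [h, hpos] with τ h1 h2
      exact (mul_pos hc h2).trans_le h1
    · right
      filter_upwards [h, hpos] with τ h1 h2
      linarith [mul_pos hc h2]
  set S : Finset (Fin N) := {ℓ | δ.a ℓ ≠ 0 ∧
    ∀ᶠ τ : ℝ in 𝓝[>] 0, (Complex.exp ((y₀ + κ * τ : ℝ) * Complex.I) * δ.a ℓ).re < 0} with hS
  have hall : ∀ᶠ τ : ℝ in 𝓝[>] 0, ∀ ℓ,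
      (ℓ ∈ S → (Complex.exp ((y₀ + κ * τ : ℝ) * Complex.I) * δ.a ℓ).re < 0) ∧
      (ℓ ∉ S → δ.a ℓ = 0 ∨ 0 < (Complex.exp ((y₀ + κ * τ : ℝ) * Complex.I) * δ.a ℓ).re) := by
    rw [eventually_all]
    intro ℓ
    by_cases h0 : δ.a ℓ = 0
    · exact Eventually.of_forall fun τ => ⟨fun h => absurd h0 (by simp [hS] at h; exact h.1),
        fun _ => Or.inl h0⟩
    by_cases hm : ℓ ∈ S
    · have := (Finset.mem_filter.1 hm).2.2
      filter_upwards [this] with τ hτ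
      exact ⟨fun _ => hτ, fun h => absurd hm h⟩
    · rcases hsign ℓ h0 with h | h
      · filter_upwards [h] with τ hτ
        exact ⟨fun h => absurd h hm, fun _ => Or.inr hτ⟩
      · exact absurd (Finset.mem_filter.2 ⟨Finset.mem_univ _, h0, h⟩) hm
  have hproj : ∀ᶠ τ : ℝ in 𝓝[>] 0, proj (M (Complex.exp ((y₀ + κ * τ : ℝ) * Complex.I)) δ)
      = Complex.exp ((y₀ + κ * τ : ℝ) * Complex.I) * (δ.w - ∑ ℓ ∈ S, δ.a ℓ) := by
    filter_upwards [hall] with τ hτ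
    unfold proj M
    rw [mul_sub, Finset.mul_sum]
    congr 1
    refine Finset.sum_congr (Finset.ext fun ℓ => ?_) fun _ _ => rfl
    simp only [Finset.mem_filter, Finset.mem_univ, true_and]
    constructor
    · intro h
      by_contra hm
      rcases (hτ ℓ).2 hm with h0 | h0
      · simp [h0, zero_notMem_cone] at h
      · exact notMem_neg_cone_of_re_pos h0 h
    · intro h
      exact mem_neg_cone_of_re_neg ((hτ ℓ).1 h)
  have hW : δ.w - ∑ ℓ ∈ S, δ.a ℓ ≠ 0 := by
    intro h
    obtain ⟨τ, hτ⟩ := hproj.exists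
    rw [h, mul_zero] at hτ
    exact zero_notMem_cone (hτ ▸ hδ.2 _ (Complex.exp_ne_zero _))
  obtain ⟨b', hb', hb⟩ := exists_twist hκ y₀ _ hW
  have hmain : ∃ c > 0, ∀ᶠ τ : ℝ in 𝓝[>] 0, c * τ ≤ growth δ (y₀ + κ * τ) := by
    -- The second alternative, a negative sinusoid, contradicts the nonnegativity of the growth.
    rcases exists_linear_le_re_exp_mul hb' with ⟨c, hc, h⟩ | ⟨c, hc, h⟩
    · refine ⟨c, hc, ?_⟩
      filter_upwards [h, hproj] with τ h1 h2
      rwa [growth, h2, hb]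
    · exfalso
      obtain ⟨τ, h1, h2, h3⟩ := (h.and (hproj.and hpos)).exists
      have := growth_nonneg hδ (y₀ + κ * τ)
      rw [growth, h2, hb] at this
      linarith [mul_pos hc h3]
  obtain ⟨c, hc, h⟩ := hmain
  refine ⟨c, hc, ?_⟩
  filter_upwards [h, hall] with τ h1 h2
  refine ⟨h1, fun ℓ hℓ => ?_⟩
  by_cases hm : ℓ ∈ S
  · exact ((h2 ℓ).1 hm).ne
  · exact (((h2 ℓ).2 hm).resolve_left hℓ).ne'

lemma exists_linear_le_growth {δ : Param N} (hδ : δ ∈ DtildeCstar N) (y₀ : ℝ) :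
    ∃ c > 0, ∀ᶠ y : ℝ in 𝓝 y₀, c * |y - y₀| ≤ growth δ y := by
  obtain ⟨c₁, hc₁, h₁⟩ := one_sided_growth hδ (Or.inl rfl) y₀
  obtain ⟨c₂, hc₂, h₂⟩ := one_sided_growth hδ (Or.inr rfl) y₀
  refine ⟨min c₁ c₂, lt_min hc₁ hc₂, ?_⟩
  rw [eventually_nhdsWithin_iff] at h₁ h₂
  have t₁ : Tendsto (fun y : ℝ => y - y₀) (𝓝 y₀) (𝓝 0) := by
    have : Continuous fun y : ℝ => y - y₀ := by fun_prop
    simpa using this.tendsto y₀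
  have t₂ : Tendsto (fun y : ℝ => y₀ - y) (𝓝 y₀) (𝓝 0) := by
    have : Continuous fun y : ℝ => y₀ - y := by fun_prop
    simpa using this.tendsto y₀
  filter_upwards [t₁.eventually h₁, t₂.eventually h₂] with y h1 h2
  rcases lt_trichotomy y y₀ with h | h | h
  · have := (h2 (show 0 < y₀ - y by linarith)).1
    rw [abs_of_neg (by linarith)]
    rw [show y₀ + -1 * (y₀ - y) = y by ring] at this
    exact le_trans (by rw [neg_sub]; gcongr; exact min_le_right _ _) this
  · rw [h, sub_self, abs_zero, mul_zero]
    exact growth_nonneg hδ _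
  · have := (h1 (show 0 < y - y₀ by linarith)).1
    rw [abs_of_pos (by linarith)]
    rw [show y₀ + 1 * (y - y₀) = y by ring] at this
    exact le_trans (by gcongr; exact min_le_left _ _) this

/-- The left side matters because ω tends to 0 from below. -/
lemma eventually_regular {δ : Param N} (hδ : δ ∈ DtildeCstar N) (y₀ : ℝ) :
    ∀ᶠ y : ℝ in 𝓝[<] y₀, Regular δ y := by
  obtain ⟨c, hc, h⟩ := one_sided_growth hδ (Or.inr rfl) y₀
  rw [eventually_nhdsWithin_iff] at h ⊢
  have t : Tendsto (fun y : ℝ => y₀ - y) (𝓝 y₀) (𝓝 0) := by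
    have : Continuous fun y : ℝ => y₀ - y := by fun_prop
    simpa using this.tendsto y₀
  filter_upwards [t.eventually h] with y hy hlt
  have hpos : 0 < y₀ - y := sub_pos.2 hlt
  have := hy hpos
  rw [show y₀ + -1 * (y₀ - y) = y by ring] at this
  exact ⟨(mul_pos hc hpos).trans_le this.1, this.2⟩

lemma exists_regular_Ioo {δ : Param N} (hδ : δ ∈ DtildeCstar N) (y₀ : ℝ) :
    ∃ η > 0, ∀ y ∈ Set.Ioo (y₀ - η) y₀, Regular δ y := by
  have h := eventually_regular hδ y₀
  rw [Filter.Eventually, mem_nhdsLT_iff_exists_Ioo_subset] at h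
  obtain ⟨l, hl, h⟩ := h
  exact ⟨y₀ - l, sub_pos.2 hl, fun y hy => h (by simpa using hy)⟩

lemma lintegral_exp_neg_mul_abs {b : ℝ} (hb : 0 < b) (y₀ : ℝ) :
    ∫⁻ y : ℝ, ENNReal.ofReal (Real.exp (-(b * |y - y₀|))) = ENNReal.ofReal (2 / b) := by
  have h : ∫ y : ℝ, Real.exp (-(b * |y|)) = 2 / b := by
    rw [integral_comp_abs (f := fun x => Real.exp (-(b * x)))]
    have := integral_exp_mul_Ioi (a := -b) (by linarith) 0
    simp only [neg_mul] at this
    rw [this]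
    simp
    ring
  have hi : Integrable fun y : ℝ => Real.exp (-(b * |y|)) :=
    Integrable.of_integral_ne_zero (by rw [h]; positivity)
  rw [lintegral_sub_right_eq_self (fun y => ENNReal.ofReal (Real.exp (-(b * |y|)))) y₀,
    ← ofReal_integral_eq_lintegral_ofReal hi (ae_of_all _ fun _ => (Real.exp_pos _).le), h]

/-- Near each point the growth dominates c|y - y₀|, and the integral of exp(-Rc|y - y₀|) is 2/(Rc).
Compactness leaves finitely many such points. Lower integrals are subadditive over unions without
any measurability, which suits the induction over arbitrary subsets. -/
lemma exists_lintegral_exp_growth_le {δ : Param N} (hδ : δ ∈ DtildeCstar N) {K : Set ℝ}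
    (hK : IsCompact K) : ∃ C : ℝ, 0 ≤ C ∧ ∀ R > 0,
      ∫⁻ y in K, ENNReal.ofReal (Real.exp (-(R * growth δ y))) ≤ ENNReal.ofReal (C / R) := by
  refine hK.induction_on (p := fun s => ∃ C : ℝ, 0 ≤ C ∧ ∀ R > 0,
      ∫⁻ y in s, ENNReal.ofReal (Real.exp (-(R * growth δ y))) ≤ ENNReal.ofReal (C / R))
    ⟨0, le_rfl, by simp⟩ ?_ ?_ ?_
  · rintro s t hst ⟨C, hC, h⟩
    exact ⟨C, hC, fun R hR => (lintegral_mono_set hst).trans (h R hR)⟩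
  · rintro s t ⟨C, hC, h⟩ ⟨C', hC', h'⟩
    refine ⟨C + C', by positivity, fun R hR => (lintegral_union_le _ _ _).trans ?_⟩
    rw [add_div, ENNReal.ofReal_add (by positivity) (by positivity)]
    exact add_le_add (h R hR) (h' R hR)
  · intro y₀ _
    obtain ⟨c, hc, h⟩ := exists_linear_le_growth hδ y₀
    refine ⟨_, mem_nhdsWithin_of_mem_nhds h, 2 / c, by positivity, fun R hR => ?_⟩
    have hmeas : MeasurableSet {y | c * |y - y₀| ≤ growth δ y} :=
      (isClosed_le (by fun_prop) (continuous_growth δ)).measurableSet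
    calc ∫⁻ y in {y | c * |y - y₀| ≤ growth δ y}, ENNReal.ofReal (Real.exp (-(R * growth δ y)))
        ≤ ∫⁻ y in {y | c * |y - y₀| ≤ growth δ y},
            ENNReal.ofReal (Real.exp (-((R * c) * |y - y₀|))) := by
          refine setLIntegral_mono' hmeas fun y hy => ?_
          refine ENNReal.ofReal_le_ofReal (Real.exp_le_exp.2 (neg_le_neg ?_))
          rw [mul_assoc]
          exact mul_le_mul_of_nonneg_left hy hR.le
      _ ≤ ∫⁻ y, ENNReal.ofReal (Real.exp (-((R * c) * |y - y₀|))) := setLIntegral_le_lintegral _ _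
      _ = ENNReal.ofReal (2 / c / R) := by
          rw [lintegral_exp_neg_mul_abs (by positivity)]
          congr 1
          field_simp

lemma exists_integral_exp_growth_le {δ : Param N} (hδ : δ ∈ DtildeCstar N) (y₁ y₂ : ℝ) :
    ∃ C : ℝ, 0 ≤ C ∧ ∀ R > 0,
      ∫ y in Set.uIoc y₁ y₂, Real.exp (-(R * growth δ y)) ≤ C / R := by
  obtain ⟨C, hC, h⟩ := exists_lintegral_exp_growth_le hδ (isCompact_uIcc (a := y₁) (b := y₂))
  refine ⟨C, hC, fun R hR => ?_⟩
  have hcont := continuous_growth δ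
  rw [integral_eq_lintegral_of_nonneg_ae (ae_of_all _ fun _ => (Real.exp_pos _).le)
    (by fun_prop)]
  refine ENNReal.toReal_le_of_le_ofReal (by positivity) ?_
  exact (lintegral_mono_set Set.uIoc_subset_uIcc).trans (h R hR)

/-! ### Poles of the test function -/

lemma e_ne_zero (z : ℂ) : e z ≠ 0 := Complex.exp_ne_zero _

lemma e_neg (z : ℂ) : e (-z) = (e z)⁻¹ := by
  rw [e, e, ← Complex.exp_neg, mul_neg]

lemma e_sum {ι : Type*} (s : Finset ι) (f : ι → ℂ) : e (∑ i ∈ s, f i) = ∏ i ∈ s, e (f i) := by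
  simp only [e, ← Complex.exp_sum, Finset.mul_sum]

lemma e_eq_one_iff {z : ℂ} : e z = 1 ↔ ∃ n : ℤ, z = n := by
  rw [e, Complex.exp_eq_one_iff]
  have h := Complex.two_pi_I_ne_zero
  refine exists_congr fun n => ⟨fun hn => ?_, fun hn => ?_⟩
  · rw [mul_comm (n : ℂ)] at hn
    exact mul_left_cancel₀ h hn
  · rw [hn]; ring

lemma norm_e_ofReal (x : ℝ) : ‖e x‖ = 1 := by
  rw [e, show 2 * (Real.pi : ℂ) * Complex.I * x = ((2 * Real.pi * x : ℝ) : ℂ) * Complex.I by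
    push_cast; ring, Complex.norm_exp_ofReal_mul_I]

lemma one_sub_e_ne_zero {δ : Param N} (hδ : δ ∈ goodDomain N) {ℓ : Fin N} (h : δ.a ℓ = 0) :
    1 - e (δ.θ ℓ) ≠ 0 := by
  intro h0
  obtain ⟨n, hn⟩ := e_eq_one_iff.1 (sub_eq_zero.1 h0).symm
  exact hδ ℓ h n (by exact_mod_cast hn)

lemma e_mul_exp (θ : ℝ) (v : ℂ) :
    e θ * Complex.exp (-v) = Complex.exp (2 * Real.pi * Complex.I * θ - v) := by
  rw [e, ← Complex.exp_add, sub_eq_add_neg]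

/-- As θ is real, |e(θ)| = 1. So the poles coming from the ℓ-th factor lie on the line Re(u a_ℓ) =
0. -/
lemma re_eq_zero_of_e_mul_exp {θ : ℝ} {v : ℂ} (h : 1 - e θ * Complex.exp (-v) = 0) :
    v.re = 0 := by
  have h1 : ‖e θ * Complex.exp (-v)‖ = 1 := by rw [← sub_eq_zero.1 h, norm_one]
  rw [norm_mul, norm_e_ofReal, one_mul, Complex.norm_exp, Real.exp_eq_one_iff] at h1
  simpa using h1

lemma factor_ne_zero {δ : Param N} {u : ℂ} (hu : u ≠ 0) (hp : u ∉ poles δ) (ℓ : Fin N) :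
    1 - e (δ.θ ℓ) * Complex.exp (-u * δ.a ℓ) ≠ 0 := fun h => hp ⟨hu, ℓ, h⟩

lemma differentiableAt_F {δ : Param N} {u : ℂ} (hu : u ≠ 0) (hp : u ∉ poles δ) :
    DifferentiableAt ℂ (F δ) u := by
  unfold F
  refine DifferentiableAt.mul (by fun_prop) ?_
  refine DifferentiableAt.fun_finsetProd fun ℓ _ => ?_
  exact DifferentiableAt.inv (by fun_prop) (factor_ne_zero hu hp ℓ)

lemma meromorphicAt_F (δ : Param N) (u : ℂ) : MeromorphicAt (F δ) u := by
  unfold F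
  refine MeromorphicAt.mul (AnalyticAt.meromorphicAt (by fun_prop)) ?_
  refine MeromorphicAt.fun_prod fun ℓ _ => MeromorphicAt.inv (AnalyticAt.meromorphicAt ?_)
  fun_prop

lemma notMem_poles_of_regular {δ : Param N} (hδ : δ ∈ goodDomain N) {y : ℝ} (hy : Regular δ y)
    (ρ : ℝ) : (ρ : ℂ) * Complex.exp (y * Complex.I) ∉ poles δ := by
  rintro ⟨h0, ℓ, h⟩
  have hρ : ρ ≠ 0 := by rintro rfl; simp at h0
  by_cases ha : δ.a ℓ = 0
  · exact one_sub_e_ne_zero hδ ha (by simpa [ha] using h)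
  · rw [neg_mul] at h
    have := re_eq_zero_of_e_mul_exp h
    rw [mul_assoc, Complex.re_ofReal_mul] at this
    exact hy.2 ℓ ha ((mul_eq_zero.1 this).resolve_left hρ)

lemma exp_eq_mul (z : ℂ) :
    Complex.exp z = (Real.exp z.re : ℂ) * Complex.exp (z.im * Complex.I) := by
  rw [Complex.ofReal_exp, ← Complex.exp_add, Complex.re_add_im]

lemma exp_notMem_poles {δ : Param N} (hδ : δ ∈ goodDomain N) {z : ℂ} (hy : Regular δ z.im) :
    Complex.exp z ∉ poles δ := by
  rw [exp_eq_mul]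
  exact notMem_poles_of_regular hδ hy _

/-- There are no poles `u` with `0 < |u| ≤ r`. -/
def PoleFree (δ : Param N) (r : ℝ) : Prop := 0 < r ∧ ∀ u ∈ poles δ, r < ‖u‖

lemma Admissible.poleFree {ε : Param N → ℝ} (hε : Admissible ε) {δ : Param N}
    (hδ : δ ∈ goodDomain N) : PoleFree δ (ε δ) := by
  refine ⟨(hε δ hδ).1, fun u ⟨h0, ℓ, h⟩ => ?_⟩
  by_contra hle
  refine (hε δ hδ).2 ℓ u (norm_pos_iff.2 h0) (not_lt.1 hle) ?_
  have := (sub_eq_zero.1 h).symm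
  rw [neg_mul, Complex.exp_neg] at this
  field_simp at this
  exact this

lemma pole_eq {δ : Param N} {u : ℂ} {ℓ : Fin N} (ha : δ.a ℓ ≠ 0)
    (h : 1 - e (δ.θ ℓ) * Complex.exp (-u * δ.a ℓ) = 0) :
    ∃ n : ℤ, u = 2 * Real.pi * Complex.I * (δ.θ ℓ - n) / δ.a ℓ := by
  rw [neg_mul, e_mul_exp] at h
  obtain ⟨n, hn⟩ := Complex.exp_eq_one_iff.1 (sub_eq_zero.1 h).symm
  refine ⟨n, ?_⟩
  rw [eq_div_iff ha]
  linear_combination -hn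

lemma finite_poles {δ : Param N} (hδ : δ ∈ goodDomain N) (r : ℝ) :
    {u | u ∈ poles δ ∧ ‖u‖ < r}.Finite := by
  have hfin : ∀ ℓ : Fin N, {n : ℤ | |(n : ℝ)| ≤ r * ‖δ.a ℓ‖ + |δ.θ ℓ|}.Finite := by
    intro ℓ
    -- A pole of index n satisfies |u||a_ℓ| = 2π|θ_ℓ - n|. Hence |θ_ℓ - n| ≤ r|a_ℓ| as soon as |u| <
    -- r, which bounds n.
    refine (Set.finite_Icc ⌊-(r * ‖δ.a ℓ‖ + |δ.θ ℓ|)⌋ ⌈r * ‖δ.a ℓ‖ + |δ.θ ℓ|⌉).subset fun n hn => ?_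
    have := abs_le.1 (show |(n : ℝ)| ≤ _ from hn)
    exact ⟨Int.floor_le_iff.2 (by linarith [this.1]), Int.le_ceil_iff.2 (by linarith [this.2])⟩
  refine (Set.finite_iUnion fun ℓ : Fin N => (hfin ℓ).image
    fun n : ℤ => 2 * Real.pi * Complex.I * (δ.θ ℓ - n) / δ.a ℓ).subset ?_
  rintro u ⟨⟨h0, ℓ, h⟩, hr⟩
  have ha : δ.a ℓ ≠ 0 := by
    intro ha
    exact one_sub_e_ne_zero hδ ha (by simpa [ha] using h)
  obtain ⟨n, hn⟩ := pole_eq ha h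
  refine Set.mem_iUnion.2 ⟨ℓ, n, ?_, hn.symm⟩
  have hna : 0 < ‖δ.a ℓ‖ := norm_pos_iff.2 ha
  have h1 : ‖u‖ * ‖δ.a ℓ‖ = 2 * Real.pi * |δ.θ ℓ - n| := by
    rw [← norm_mul, hn, div_mul_cancel₀ _ ha]
    simp only [norm_mul, Complex.norm_ofNat, Complex.norm_real, Complex.norm_I, mul_one,
      Real.norm_eq_abs, abs_of_pos Real.pi_pos]
    norm_cast
  have h2 : |δ.θ ℓ - n| ≤ r * ‖δ.a ℓ‖ := by
    have h3 : ‖u‖ * ‖δ.a ℓ‖ ≤ r * ‖δ.a ℓ‖ := by gcongr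
    nlinarith [Real.pi_gt_three, abs_nonneg (δ.θ ℓ - n)]
  have h3 : |(n : ℝ)| ≤ |δ.θ ℓ - n| + |δ.θ ℓ| := by
    rw [abs_sub_comm]
    simpa using abs_add_le ((n : ℝ) - δ.θ ℓ) (δ.θ ℓ)
  show |(n : ℝ)| ≤ _
  linarith

/-! ### Symmetries of the test function -/

lemma F_M (α : ℂ) (δ : Param N) (u : ℂ) : F (M α δ) u = F δ (α * u) := by
  simp only [F, M, ← mul_assoc, neg_mul, mul_comm u α]

lemma F_R (σ : Equiv.Perm (Fin N)) (δ : Param N) (u : ℂ) : F (R σ δ) u = F δ u := by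
  simp only [F, R]
  congr 1
  exact Equiv.prod_comp σ⁻¹ fun ℓ => (1 - e (δ.θ ℓ) * Complex.exp (-u * δ.a ℓ))⁻¹

lemma inv_one_sub_inv {X : ℂ} (hX : X ≠ 0) : (1 - X⁻¹)⁻¹ = -X * (1 - X)⁻¹ := by
  rw [show 1 - X⁻¹ = -((1 - X) * X⁻¹) by field_simp; ring, inv_neg, mul_inv, inv_inv]
  ring

/-- Each flipped factor is 1/(1 - X⁻¹) = -X/(1 - X) with X = e(θ_ℓ) exp(-u a_ℓ). The exponentials
cancel the shift of `w`, leaving the signs and the e(θ_ℓ). -/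
lemma F_T (Λ : Finset (Fin N)) (δ : Param N) (u : ℂ) :
    F (T Λ δ) u = (-1) ^ Λ.card * e (∑ ℓ ∈ Λ, (δ.θ ℓ : ℂ)) * F δ u := by
  have h : ∀ ℓ, (1 - e ((T Λ δ).θ ℓ) * Complex.exp (-u * (T Λ δ).a ℓ))⁻¹
      = (if ℓ ∈ Λ then -1 * e (δ.θ ℓ) * Complex.exp (-u * δ.a ℓ) else 1)
        * (1 - e (δ.θ ℓ) * Complex.exp (-u * δ.a ℓ))⁻¹ := by
    intro ℓ
    simp only [T]
    split_ifs with hℓ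
    · have := inv_one_sub_inv (X := e (δ.θ ℓ) * Complex.exp (-u * δ.a ℓ))
        (mul_ne_zero (e_ne_zero _) (Complex.exp_ne_zero _))
      rw [mul_inv, ← e_neg, ← Complex.exp_neg] at this
      rw [show -u * -δ.a ℓ = -(-u * δ.a ℓ) by ring]
      push_cast
      rw [this]
      ring
    · rw [one_mul]
  simp only [F, h, Finset.prod_mul_distrib]
  rw [Finset.prod_ite, Finset.prod_const_one, mul_one, Finset.filter_mem_eq_inter,
    Finset.univ_inter, Finset.prod_mul_distrib, Finset.prod_mul_distrib, Finset.prod_const,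
    ← e_sum, ← Complex.exp_sum, ← Finset.mul_sum]
  simp only [T]
  rw [show -u * (δ.w - ∑ ℓ ∈ Λ, δ.a ℓ) = -u * δ.w - -u * ∑ ℓ ∈ Λ, δ.a ℓ by ring, Complex.exp_sub]
  field_simp

lemma F_comp_mul {Λ : Finset (Fin N)} {σ : Equiv.Perm (Fin N)} {α : ℂ} {δ : Param N}
    (hfix : T Λ (R σ (M α δ)) = δ) (u : ℂ) :
    F δ u = (-1) ^ Λ.card * e (∑ ℓ ∈ Λ.image (σ⁻¹ : Equiv.Perm (Fin N)), (δ.θ ℓ : ℂ))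
      * F δ (α * u) := by
  conv_lhs => rw [← hfix]
  rw [F_T, F_R, F_M, Finset.sum_image (σ⁻¹ : Equiv.Perm (Fin N)).injective.injOn]
  rfl

/-- The sum of the |a_ℓ| is preserved by permutations and sign changes and is scaled by |α|. -/
lemma norm_eq_one_of_fixed {Λ : Finset (Fin N)} {σ : Equiv.Perm (Fin N)} {α : ℂ} {δ : Param N}
    (hδ : δ ∈ DtildeCstar N) (hfix : T Λ (R σ (M α δ)) = δ) : ‖α‖ = 1 := by
  -- If all `a ℓ` vanished, `w` and `-w` would both lie in the cone.
  have ha : ∃ ℓ, δ.a ℓ ≠ 0 := by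
    by_contra hcon
    push Not at hcon
    have h1 := hδ.2 1 one_ne_zero
    have h2 := hδ.2 (-1) (by norm_num)
    simp only [proj, M, hcon, mul_zero, Finset.sum_const_zero, sub_zero, one_mul, cone,
      Set.mem_ofPred_eq, neg_mul, Complex.neg_re, Complex.neg_im] at h1 h2
    rcases h1 with h1 | h1 <;> rcases h2 with h2 | h2 <;> linarith [h1, h2]
  have hsum : ∑ ℓ, ‖δ.a ℓ‖ = ‖α‖ * ∑ ℓ, ‖δ.a ℓ‖ := by
    rw [← Equiv.sum_comp σ⁻¹ fun ℓ => ‖δ.a ℓ‖, Finset.mul_sum, Equiv.sum_comp σ⁻¹ fun ℓ => ‖δ.a ℓ‖]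
    refine Finset.sum_congr rfl fun ℓ _ => ?_
    conv_lhs => rw [← hfix]
    simp only [T, R, M]
    split_ifs <;> simp
  have hpos : 0 < ∑ ℓ, ‖δ.a ℓ‖ := by
    obtain ⟨ℓ, hℓ⟩ := ha
    exact Finset.sum_pos' (fun _ _ => norm_nonneg _) ⟨ℓ, Finset.mem_univ _, norm_pos_iff.2 hℓ⟩
  exact mul_right_cancel₀ hpos.ne' (by rw [one_mul]; exact hsum.symm)

/-! ### Bounds on the test function -/

/-- By the reverse triangle inequality: of the two terms 1 and exp ζ, the smaller is in norm at most
e^{-t} times the larger. -/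
lemma exp_max_le_norm_one_sub_exp {t : ℝ} {ζ : ℂ} (h : t ≤ |ζ.re|) :
    (1 - Real.exp (-t)) * Real.exp (max 0 ζ.re) ≤ ‖1 - Complex.exp ζ‖ := by
  rcases le_total 0 ζ.re with h0 | h0
  · rw [abs_of_nonneg h0] at h
    rw [max_eq_right h0]
    have h1 := norm_sub_norm_le (Complex.exp ζ) 1
    rw [norm_sub_rev, Complex.norm_exp, norm_one] at h1
    have h2 : 1 ≤ Real.exp (-t) * Real.exp ζ.re := by
      rw [← Real.exp_add]
      exact Real.one_le_exp (by linarith)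
    linarith
  · rw [abs_of_nonpos h0] at h
    rw [max_eq_left h0, Real.exp_zero, mul_one]
    have h1 := norm_sub_norm_le 1 (Complex.exp ζ)
    rw [Complex.norm_exp, norm_one] at h1
    have h2 : Real.exp ζ.re ≤ Real.exp (-t) := Real.exp_le_exp.2 (by linarith)
    linarith

/-- For |Re ζ| ≥ 1 the previous bound applies. Otherwise periodicity moves ζ into a compact
rectangle with a disc around 0 removed, on which 1 - exp has no zero. -/
lemma exists_exp_max_le_norm_one_sub_exp {κ : ℝ} (hκ : 0 < κ) :
    ∃ c > 0, ∀ ζ : ℂ, (∀ n : ℤ, κ ≤ ‖ζ - n * (2 * Real.pi * Complex.I)‖) →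
      c * Real.exp (max 0 ζ.re) ≤ ‖1 - Complex.exp ζ‖ := by
  set K : Set ℂ := (Set.Icc (-1) 1 ×ℂ Set.Icc (-Real.pi) Real.pi) ∩ {z | κ ≤ ‖z‖} with hK
  have hcomp : IsCompact K :=
    (isCompact_Icc.reProdIm isCompact_Icc).inter_right (isClosed_le continuous_const (by fun_prop))
  have hne : ∀ z ∈ K, 0 < ‖1 - Complex.exp z‖ := by
    rintro z ⟨hz, hz'⟩
    rw [norm_pos_iff, sub_ne_zero]
    intro h
    obtain ⟨n, hn⟩ := Complex.exp_eq_one_iff.1 h.symm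
    have him : z.im = n * (2 * Real.pi) := by rw [hn]; simp
    have hlt : |(n : ℝ)| * (2 * Real.pi) ≤ Real.pi := by
      rw [← abs_of_pos (show (0 : ℝ) < 2 * Real.pi by positivity), ← abs_mul, ← him, abs_le]
      exact hz.2
    have hn0 : n = 0 := by
      have : |(n : ℝ)| < 1 := by nlinarith [Real.pi_pos]
      exact_mod_cast Int.abs_lt_one_iff.1 (by exact_mod_cast this)
    rw [hn0] at hn
    have hz0 : z = 0 := by simpa using hn
    have : κ ≤ ‖z‖ := hz'
    rw [hz0, norm_zero] at this
    linarith
  obtain ⟨c₀, hc₀, hmin⟩ : ∃ c₀ > 0, ∀ z ∈ K, c₀ ≤ ‖1 - Complex.exp z‖ := by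
    rcases K.eq_empty_or_nonempty with h | h
    · exact ⟨1, one_pos, by simp [h]⟩
    · obtain ⟨z, hz, hzmin⟩ := hcomp.exists_isMinOn h
        (f := fun z => ‖1 - Complex.exp z‖) (by fun_prop)
      exact ⟨_, hne z hz, fun z' hz' => hzmin hz'⟩
  have he1 : 0 < 1 - Real.exp (-1) := by
    rw [sub_pos, Real.exp_lt_one_iff]; norm_num
  -- The factor e^{-1} absorbs exp(max 0 (Re ζ)) ≤ e in the compact range.
  refine ⟨min (1 - Real.exp (-1)) (c₀ * Real.exp (-1)), lt_min he1 (by positivity), fun ζ hζ => ?_⟩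
  by_cases h : 1 ≤ |ζ.re|
  · exact (mul_le_mul_of_nonneg_right (min_le_left _ _) (Real.exp_pos _).le).trans
      (exp_max_le_norm_one_sub_exp h)
  · push Not at h
    refine (mul_le_mul_of_nonneg_right (min_le_right _ _) (Real.exp_pos _).le).trans ?_
    rw [mul_assoc, ← Real.exp_add]
    refine (mul_le_of_le_one_right hc₀.le (Real.exp_le_one_iff.2 ?_)).trans ?_
    · have := max_le zero_le_one ((le_abs_self ζ.re).trans h.le)
      linarith
    set n : ℤ := toIcoDiv Real.two_pi_pos (-Real.pi) ζ.im with hn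
    have hmem := sub_toIcoDiv_zsmul_mem_Ico Real.two_pi_pos (-Real.pi) ζ.im
    rw [← hn, zsmul_eq_mul] at hmem
    have hper : Complex.exp ζ = Complex.exp (ζ - n * (2 * Real.pi * Complex.I)) :=
      (Complex.exp_periodic.sub_int_mul_eq n).symm
    rw [hper]
    refine hmin _ ⟨⟨?_, ?_⟩, hζ n⟩
    · have : (ζ - n * (2 * Real.pi * Complex.I)).re = ζ.re := by simp
      rw [Set.mem_preimage, this]
      exact abs_le.1 h.le
    · have : (ζ - n * (2 * Real.pi * Complex.I)).im = ζ.im - n * (2 * Real.pi) := by simp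
      rw [Set.mem_preimage, this]
      exact ⟨hmem.1, by linarith [hmem.2]⟩

/-- The bound on a factor that is wanted along rays and arcs. -/
lemma norm_inv_factor_le {c : ℝ} (hc : 0 < c) {θ : ℝ} {v : ℂ}
    (h : c * Real.exp (max 0 (2 * Real.pi * Complex.I * θ - v).re)
      ≤ ‖1 - Complex.exp (2 * Real.pi * Complex.I * θ - v)‖) :
    ‖(1 - e θ * Complex.exp (-v))⁻¹‖ ≤ c⁻¹ * Real.exp (-max 0 (-v.re)) := by
  have hre : (2 * Real.pi * Complex.I * θ - v).re = -v.re := by simp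
  rw [hre] at h
  rw [e_mul_exp, norm_inv, Real.exp_neg, ← mul_inv]
  exact inv_anti₀ (by positivity) h

/-- The exponents of the factor bounds together with that of exp(-u w) add up to exactly -ρ times
the growth. -/
lemma norm_F_le {δ : Param N} {ρ y : ℝ} (hρ : 0 ≤ ρ) {C : Fin N → ℝ}
    (h : ∀ ℓ, ‖(1 - e (δ.θ ℓ) * Complex.exp (-(ρ * Complex.exp (y * Complex.I) * δ.a ℓ)))⁻¹‖
      ≤ C ℓ * Real.exp (-max 0 (-(ρ * Complex.exp (y * Complex.I) * δ.a ℓ).re))) :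
    ‖F δ (ρ * Complex.exp (y * Complex.I))‖ ≤ (∏ ℓ, C ℓ) * Real.exp (-(ρ * growth δ y)) := by
  have hre : ∀ b : ℂ, (ρ * Complex.exp (y * Complex.I) * b).re
      = ρ * (Complex.exp (y * Complex.I) * b).re := fun b => by
    rw [mul_assoc, Complex.re_ofReal_mul]
  unfold F
  simp only [neg_mul]
  rw [norm_mul, norm_prod, Complex.norm_exp, Complex.neg_re, hre]
  refine (mul_le_mul_of_nonneg_left (Finset.prod_le_prod (fun _ _ => norm_nonneg _)
    fun ℓ _ => h ℓ) (Real.exp_pos _).le).trans (le_of_eq ?_)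
  rw [Finset.prod_mul_distrib, ← Real.exp_sum, mul_left_comm, ← Real.exp_add, growth_eq,
    Finset.sum_neg_distrib, mul_add, neg_add, Finset.mul_sum]
  simp only [hre, mul_max_of_nonneg _ _ hρ, mul_zero, mul_neg]

lemma norm_inv_factor_le_of_eq_zero {δ : Param N} {ℓ : Fin N} (ha : δ.a ℓ = 0) (u : ℂ) :
    ‖(1 - e (δ.θ ℓ) * Complex.exp (-(u * δ.a ℓ)))⁻¹‖
      ≤ ‖(1 - e (δ.θ ℓ))⁻¹‖ * Real.exp (-max 0 (-(u * δ.a ℓ).re)) := by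
  simp [ha]

/-- On a compact interval of regular arguments the growth and the |Re(e^{iy} a_ℓ)| with a_ℓ ≠ 0 have
positive minima. So every such factor stays away from its zeros once ρ ≥ r. -/
lemma exists_norm_F_le_of_regular {δ : Param N} {y₁ y₂ : ℝ}
    (hreg : ∀ y ∈ Set.Icc y₁ y₂, Regular δ y) {r : ℝ} (hr : 0 < r) :
    ∃ C : ℝ, 0 ≤ C ∧ ∃ c > 0, ∀ y ∈ Set.Icc y₁ y₂, ∀ ρ ≥ r,
      ‖F δ (ρ * Complex.exp (y * Complex.I))‖ ≤ C * Real.exp (-(c * ρ)) := by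
  have hfac : ∀ ℓ, ∃ C : ℝ, 0 ≤ C ∧ ∀ y ∈ Set.Icc y₁ y₂, ∀ ρ ≥ r,
      ‖(1 - e (δ.θ ℓ) * Complex.exp (-(ρ * Complex.exp (y * Complex.I) * δ.a ℓ)))⁻¹‖
      ≤ C * Real.exp (-max 0 (-(ρ * Complex.exp (y * Complex.I) * δ.a ℓ).re)) := by
    intro ℓ
    by_cases ha : δ.a ℓ = 0
    · exact ⟨_, norm_nonneg _, fun y _ ρ _ => norm_inv_factor_le_of_eq_zero ha _⟩
    obtain ⟨m, hm, hmin⟩ : ∃ m > 0, ∀ y ∈ Set.Icc y₁ y₂,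
        m ≤ |(Complex.exp (y * Complex.I) * δ.a ℓ).re| := by
      rcases (Set.Icc y₁ y₂).eq_empty_or_nonempty with h | h
      · exact ⟨1, one_pos, by simp [h]⟩
      · obtain ⟨z, hz, hzmin⟩ := isCompact_Icc.exists_isMinOn h
          (f := fun y : ℝ => |(Complex.exp (y * Complex.I) * δ.a ℓ).re|) (by fun_prop)
        exact ⟨_, abs_pos.2 ((hreg z hz).2 ℓ ha), fun z' hz' => hzmin hz'⟩
    have ht : 0 < 1 - Real.exp (-(r * m)) := by
      rw [sub_pos, Real.exp_lt_one_iff, neg_lt_zero]; positivity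
    refine ⟨(1 - Real.exp (-(r * m)))⁻¹, by positivity, fun y hy ρ hρ => ?_⟩
    refine norm_inv_factor_le ht (exp_max_le_norm_one_sub_exp ?_)
    have hre : (2 * Real.pi * Complex.I * δ.θ ℓ
        - ρ * Complex.exp (y * Complex.I) * δ.a ℓ).re
        = -(ρ * (Complex.exp (y * Complex.I) * δ.a ℓ).re) := by
      rw [mul_assoc (ρ : ℂ), Complex.sub_re, Complex.re_ofReal_mul]
      simp
    rw [hre, abs_neg, abs_mul, abs_of_pos (hr.trans_le hρ)]
    exact mul_le_mul hρ (hmin y hy) hm.le (hr.trans_le hρ).le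
  choose C hC0 hC using hfac
  obtain ⟨c, hc, hmin⟩ : ∃ c > 0, ∀ y ∈ Set.Icc y₁ y₂, c ≤ growth δ y := by
    rcases (Set.Icc y₁ y₂).eq_empty_or_nonempty with h | h
    · exact ⟨1, one_pos, by simp [h]⟩
    · obtain ⟨z, hz, hzmin⟩ := isCompact_Icc.exists_isMinOn h (continuous_growth δ).continuousOn
      exact ⟨_, (hreg z hz).1, fun z' hz' => hzmin hz'⟩
  have hP : 0 ≤ ∏ ℓ, C ℓ := Finset.prod_nonneg fun ℓ _ => hC0 ℓ
  refine ⟨∏ ℓ, C ℓ, hP, c, hc, fun y hy ρ hρ => ?_⟩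
  have hρ0 : 0 ≤ ρ := hr.le.trans hρ
  refine (norm_F_le hρ0 fun ℓ => hC ℓ y hy ρ hρ).trans ?_
  refine mul_le_mul_of_nonneg_left (Real.exp_le_exp.2 (neg_le_neg ?_)) hP
  rw [mul_comm c]
  exact mul_le_mul_of_nonneg_left (hmin y hy) hρ0

/-- The distance of the exponent to 2πi n is |p - u||a_ℓ|, where p is the n-th point of the
progression of poles. On a good circle this is bounded below, uniformly in the argument. -/
lemma exists_norm_F_le_of_goodRadii (δ : Param N) {η r : ℝ} (hη : 0 < η) (hr : 0 < r) :
    ∃ C : ℝ, 0 ≤ C ∧ ∀ ρ ∈ goodRadii δ η, r ≤ ρ → ∀ y : ℝ,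
      ‖F δ (ρ * Complex.exp (y * Complex.I))‖ ≤ C * Real.exp (-(ρ * growth δ y)) := by
  have hfac : ∀ ℓ, ∃ C : ℝ, 0 ≤ C ∧ ∀ ρ ∈ goodRadii δ η, r ≤ ρ → ∀ y : ℝ,
      ‖(1 - e (δ.θ ℓ) * Complex.exp (-(ρ * Complex.exp (y * Complex.I) * δ.a ℓ)))⁻¹‖
      ≤ C * Real.exp (-max 0 (-(ρ * Complex.exp (y * Complex.I) * δ.a ℓ).re)) := by
    intro ℓ
    by_cases ha : δ.a ℓ = 0
    · exact ⟨_, norm_nonneg _, fun ρ _ _ y => norm_inv_factor_le_of_eq_zero ha _⟩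
    have hna : 0 < ‖δ.a ℓ‖ := norm_pos_iff.2 ha
    obtain ⟨c, hc, h⟩ := exists_exp_max_le_norm_one_sub_exp
      (κ := min η r * ‖δ.a ℓ‖) (mul_pos (lt_min hη hr) hna)
    refine ⟨c⁻¹, by positivity, fun ρ hρ hrρ y => norm_inv_factor_le hc (h _ fun n => ?_)⟩
    set u : ℂ := ρ * Complex.exp (y * Complex.I) with hu
    have hnu : ‖u‖ = ρ := by
      rw [hu, norm_mul, Complex.norm_exp_ofReal_mul_I, mul_one, Complex.norm_real,
        Real.norm_of_nonneg (hr.le.trans hrρ)]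
    set p : ℂ := 2 * Real.pi * Complex.I * (δ.θ ℓ - n) / δ.a ℓ with hp
    have hpa : p * δ.a ℓ = 2 * Real.pi * Complex.I * (δ.θ ℓ - n) := div_mul_cancel₀ _ ha
    have heq : 2 * Real.pi * Complex.I * δ.θ ℓ - u * δ.a ℓ - n * (2 * Real.pi * Complex.I)
        = (p - u) * δ.a ℓ := by
      rw [sub_mul, hpa]; ring
    rw [heq, norm_mul]
    refine mul_le_mul_of_nonneg_right ?_ hna.le
    -- The progression may pass through 0, which good radii do not control. There the lower bound r
    -- on ρ takes over.
    by_cases hp0 : p = 0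
    · rw [hp0, zero_sub, norm_neg, hnu]
      exact (min_le_right _ _).trans hrρ
    · have hmem : p ∈ poles δ := by
        refine ⟨hp0, ℓ, ?_⟩
        rw [neg_mul, e_mul_exp, hpa, show 2 * Real.pi * Complex.I * (δ.θ ℓ : ℂ)
          - 2 * Real.pi * Complex.I * (δ.θ ℓ - n) = n * (2 * Real.pi * Complex.I) by ring,
          Complex.exp_int_mul_two_pi_mul_I, sub_self]
      refine (min_le_left _ _).trans ((hρ p hmem).trans ?_)
      rw [← hnu, abs_sub_comm]
      exact abs_norm_sub_norm_le p u
  choose C hC0 hC using hfac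
  exact ⟨∏ ℓ, C ℓ, Finset.prod_nonneg fun ℓ _ => hC0 ℓ, fun ρ hρ hrρ y =>
    norm_F_le (hr.le.trans hrρ) fun ℓ => hC ℓ ρ hρ hrρ y⟩

/-- A factor is singular at 0 only if e(θ_ℓ) = 1. Then a_ℓ ≠ 0 by the definition of the domain, and
the singularity is a simple pole. -/
lemma exists_tendsto_pow_mul_F {δ : Param N} (hδ : δ ∈ goodDomain N) :
    ∃ l : ℂ, Tendsto (fun u => u ^ N * F δ u) (𝓝[≠] 0) (𝓝 l) := by
  have hfac : ∀ ℓ, ∃ l : ℂ, Tendsto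
      (fun u : ℂ => u * (1 - e (δ.θ ℓ) * Complex.exp (-u * δ.a ℓ))⁻¹) (𝓝[≠] 0) (𝓝 l) := by
    intro ℓ
    by_cases h1 : e (δ.θ ℓ) = 1
    · have ha : δ.a ℓ ≠ 0 := fun ha => one_sub_e_ne_zero hδ ha (sub_eq_zero.2 h1.symm)
      refine ⟨(δ.a ℓ)⁻¹, ?_⟩
      have hd : HasDerivAt (fun u : ℂ => 1 - e (δ.θ ℓ) * Complex.exp (-u * δ.a ℓ)) (δ.a ℓ) 0 := by
        have h := (((hasDerivAt_neg (0 : ℂ)).mul_const (δ.a ℓ)).cexp.const_mul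
          (e (δ.θ ℓ))).const_sub 1
        convert! h using 1
        simp [h1]
      have := (hasDerivAt_iff_tendsto_slope.1 hd).inv₀ ha
      refine this.congr fun u => ?_
      simp [slope_def_field, h1]
      ring
    · have hc : ContinuousAt (fun u : ℂ => u * (1 - e (δ.θ ℓ) * Complex.exp (-u * δ.a ℓ))⁻¹) 0 := by
        refine continuousAt_id.mul (ContinuousAt.inv₀ (by fun_prop) ?_)
        simpa [sub_eq_zero] using fun h => h1 h.symm
      exact ⟨_, hc.tendsto.mono_left nhdsWithin_le_nhds⟩
  choose l hl using hfac
  have hexp : Tendsto (fun u : ℂ => Complex.exp (-u * δ.w)) (𝓝[≠] 0)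
      (𝓝 (Complex.exp (-0 * δ.w))) :=
    Tendsto.mono_left (ContinuousAt.tendsto (by fun_prop)) nhdsWithin_le_nhds
  refine ⟨_, (hexp.mul (tendsto_finsetProd Finset.univ fun ℓ _ => hl ℓ)).congr fun u => ?_⟩
  rw [Finset.prod_mul_distrib, Finset.prod_const, Finset.card_univ, Fintype.card_fin, F]
  ring

/-! ### Good radii -/

/-- Induction on the number of separated sets: halve the window left free by the earlier ones. If a
point of the new set lies in the first half, its separation keeps the second half free. -/
lemma exists_gap {ι : Type*} (s : Finset ι) (A : ι → Set ℝ) (d : ι → ℝ) (hd : ∀ i, 0 < d i)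
    (hA : ∀ i, ∀ x ∈ A i, ∀ y ∈ A i, x ≠ y → d i ≤ |x - y|) :
    ∃ η > 0, ∀ X : ℝ, ∃ x ≥ X, ∀ i ∈ s, ∀ t ∈ A i, t ∉ Set.Ioo x (x + η) := by
  classical
  induction s using Finset.induction_on with
  | empty => exact ⟨1, one_pos, fun X => ⟨X, le_rfl, by simp⟩⟩
  | insert i s hi ih =>
    obtain ⟨η, hη, h⟩ := ih
    set m := min η (d i) with hm
    have hm0 : 0 < m := lt_min hη (hd i)
    have hmη : m ≤ η := min_le_left _ _
    have hmd : m ≤ d i := min_le_right _ _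
    refine ⟨m / 2, by positivity, fun X => ?_⟩
    obtain ⟨x, hx, hxs⟩ := h X
    by_cases hclean : ∀ t ∈ A i, t ∉ Set.Ioo x (x + m / 2)
    · refine ⟨x, hx, fun j hj t ht htm => ?_⟩
      rcases Finset.mem_insert.1 hj with rfl | hj
      · exact hclean t ht htm
      · exact hxs j hj t ht ⟨htm.1, by linarith [htm.2]⟩
    · push Not at hclean
      obtain ⟨t₀, ht₀, h₀⟩ := hclean
      -- Two points of `A i`, one in each half, would be closer than m ≤ d i.
      refine ⟨x + m / 2, by linarith, fun j hj t ht htm => ?_⟩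
      rcases Finset.mem_insert.1 hj with rfl | hj
      · have hne : t₀ ≠ t := by
          rintro rfl
          linarith [h₀.2, htm.1]
        have := hA j t₀ ht₀ t ht hne
        rw [abs_sub_comm, abs_of_pos (by linarith [h₀.2, htm.1])] at this
        linarith [h₀.1, htm.2]
      · exact hxs j hj t ht ⟨by linarith [htm.1], by linarith [htm.2]⟩

/-- The moduli of the poles lie on finitely many real arithmetic progressions, two per index because
|θ_ℓ - n| is ±(θ_ℓ - n). Nontriviality of the filter is what makes the limit in the definition of ρ
unique. -/
lemma exists_goodRadii_unbounded {δ : Param N} (hδ : δ ∈ goodDomain N) :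
    ∃ η > 0, (atTop ⊓ 𝓟 (goodRadii δ η)).NeBot := by
  set d : Fin N × Bool → ℝ := fun i => if δ.a i.1 = 0 then 1 else 2 * Real.pi / ‖δ.a i.1‖ with hd
  set A : Fin N × Bool → Set ℝ := fun i =>
    {t | δ.a i.1 ≠ 0 ∧ ∃ n : ℤ, t = (if i.2 then 1 else -1) * (d i * (δ.θ i.1 - n))} with hA
  have hd0 : ∀ i, 0 < d i := by
    intro i
    simp only [hd]
    split_ifs with h
    · exact one_pos
    · have := norm_pos_iff.2 h
      positivity
  have hsep : ∀ i, ∀ x ∈ A i, ∀ y ∈ A i, x ≠ y → d i ≤ |x - y| := by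
    rintro i x ⟨-, n, hn⟩ y ⟨-, m, hm⟩ hne
    have hnm : (1 : ℝ) ≤ |(m : ℝ) - n| := by
      have : m - n ≠ 0 := by
        intro h
        exact hne (by rw [hn, hm, sub_eq_zero.1 h])
      exact_mod_cast Int.one_le_abs this
    rw [hn, hm, ← mul_sub, ← mul_sub, sub_sub_sub_cancel_left, abs_mul, abs_mul,
      abs_of_pos (hd0 i)]
    have : |(if i.2 then 1 else -1 : ℝ)| = 1 := by split_ifs <;> simp
    rw [this, one_mul]
    exact le_mul_of_one_le_right (hd0 i).le hnm
  obtain ⟨η, hη, h⟩ := exists_gap Finset.univ A d hd0 hsep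
  refine ⟨η / 2, by positivity, ?_⟩
  rw [← frequently_mem_iff_neBot, frequently_atTop]
  intro X
  obtain ⟨x, hx, hxs⟩ := h X
  -- The midpoint of a free window of length η has distance at least η/2 from every modulus.
  refine ⟨x + η / 2, by linarith, fun u ⟨h0, ℓ, hu⟩ => ?_⟩
  have ha : δ.a ℓ ≠ 0 := fun ha => one_sub_e_ne_zero hδ ha (by simpa [ha] using hu)
  obtain ⟨n, hn⟩ := pole_eq ha hu
  have hnorm : ‖u‖ = d (ℓ, true) * |δ.θ ℓ - n| := by
    rw [hn]
    simp only [norm_mul, norm_div, Complex.norm_ofNat, Complex.norm_real, Complex.norm_I, mul_one,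
      Real.norm_eq_abs, abs_of_pos Real.pi_pos, hd, if_neg ha]
    rw [show (δ.θ ℓ : ℂ) - n = ((δ.θ ℓ - n : ℝ) : ℂ) by push_cast; rfl, Complex.norm_real,
      Real.norm_eq_abs]
    ring
  have hmem : ∃ b, ‖u‖ ∈ A (ℓ, b) := by
    rcases le_total 0 (δ.θ ℓ - n) with h | h
    · exact ⟨true, ha, n, by rw [hnorm, abs_of_nonneg h]; simp⟩
    · exact ⟨false, ha, n, by rw [hnorm, abs_of_nonpos h]; simp [hd, ha]; ring⟩
  obtain ⟨b, hb⟩ := hmem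
  have := hxs _ (Finset.mem_univ _) _ hb
  rw [Set.mem_Ioo, not_and_or, not_lt, not_lt] at this
  rcases this with h | h
  · exact le_trans (by linarith) (le_abs_self _)
  · exact le_trans (by linarith) (neg_le_abs _)

/-! ### Contour integrals in the logarithmic coordinate -/

/-- The integral of `f` over the boundary of the rectangle `[x₁, x₂] × [y₁, y₂]`. -/
def rectIntegral (f : ℂ → ℂ) (x₁ x₂ y₁ y₂ : ℝ) : ℂ :=
  (∫ x : ℝ in x₁..x₂, f (x + y₁ * Complex.I)) - (∫ x : ℝ in x₁..x₂, f (x + y₂ * Complex.I))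
    + Complex.I * (∫ y : ℝ in y₁..y₂, f (x₂ + y * Complex.I))
    - Complex.I * (∫ y : ℝ in y₁..y₂, f (x₁ + y * Complex.I))

/-- The form `F(u) u^{s-1} du` in the coordinate `u = exp z`. -/
def logIntegrand (δ : Param N) (s z : ℂ) : ℂ := F δ (Complex.exp z) * Complex.exp (s * z)

/-- The integral of `F(u) u^{s-1} du` over the ray from `r e^{iy}` to infinity. -/
def rayIntegral (δ : Param N) (s : ℂ) (r y : ℝ) : ℂ :=
  Complex.exp (s * (y * Complex.I)) * ∫ ρ in Set.Ioi r,
    F δ (ρ * Complex.exp (y * Complex.I)) * Complex.exp ((s - 1) * (Real.log ρ : ℂ))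

/-- The integral of `F(u) u^{s-1} du` over an arc of radius `r`. -/
def arcIntegral (δ : Param N) (s : ℂ) (r y₁ y₂ : ℝ) : ℂ :=
  Complex.I * ∫ y in y₁..y₂, logIntegrand δ s (Real.log r + y * Complex.I)

/-- The integral of `F(u) u^{s-1} du` over the contour that comes in along the ray of argument
`y₁`, follows the circle of radius `r` and goes out along the ray of argument `y₂`. -/
def sectorIntegral (δ : Param N) (s : ℂ) (r y₁ y₂ : ℝ) : ℂ :=
  -rayIntegral δ s r y₁ + arcIntegral δ s r y₁ y₂ + rayIntegral δ s r y₂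

lemma differentiableAt_logIntegrand {δ : Param N} (s : ℂ) {z : ℂ}
    (hz : Complex.exp z ∉ poles δ) : DifferentiableAt ℂ (logIntegrand δ s) z := by
  unfold logIntegrand
  refine DifferentiableAt.mul ?_ (by fun_prop)
  exact (differentiableAt_F (Complex.exp_ne_zero z) hz).comp z
    Complex.differentiable_exp.differentiableAt

lemma rectIntegral_eq_zero {f : ℂ → ℂ} {x₁ x₂ y₁ y₂ : ℝ} (hx : x₁ ≤ x₂) (hy : y₁ ≤ y₂)
    (hf : ∀ z : ℂ, x₁ ≤ z.re → z.re ≤ x₂ → y₁ ≤ z.im → z.im ≤ y₂ → DifferentiableAt ℂ f z) :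
    rectIntegral f x₁ x₂ y₁ y₂ = 0 := by
  refine Complex.integral_boundary_rect_eq_zero_of_differentiableOn f ⟨x₁, y₁⟩ ⟨x₂, y₂⟩ ?_
  intro z hz
  rw [Set.uIcc_of_le hx, Set.uIcc_of_le hy] at hz
  exact (hf z hz.1.1 hz.1.2 hz.2.1 hz.2.2).differentiableWithinAt

lemma norm_exp_add (x y : ℝ) : ‖Complex.exp (x + y * Complex.I)‖ = Real.exp x := by
  rw [Complex.norm_exp]; simp

lemma exp_log_add {r : ℝ} (hr : 0 < r) (y : ℝ) :
    Complex.exp (Real.log r + y * Complex.I) = r * Complex.exp (y * Complex.I) := by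
  rw [Complex.exp_add, ← Complex.ofReal_exp, Real.exp_log hr]

/-- The circle of radius `r` avoids the poles. -/
def CircleFree (δ : Param N) (r : ℝ) : Prop := 0 < r ∧ ∀ u ∈ poles δ, ‖u‖ ≠ r

lemma PoleFree.circleFree {δ : Param N} {r : ℝ} (h : PoleFree δ r) : CircleFree δ r :=
  ⟨h.1, fun u hu => (h.2 u hu).ne'⟩

lemma CircleFree.continuous_logIntegrand {δ : Param N} {r : ℝ} (h : CircleFree δ r) (s : ℂ) :
    Continuous fun y : ℝ => logIntegrand δ s (Real.log r + y * Complex.I) := by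
  rw [continuous_iff_continuousAt]
  intro y
  have hz : Complex.exp (Real.log r + y * Complex.I) ∉ poles δ := by
    intro hp
    refine h.2 _ hp ?_
    rw [norm_exp_add, Real.exp_log h.1]
  exact ContinuousAt.comp (f := fun y : ℝ => (Real.log r : ℂ) + y * Complex.I)
    (differentiableAt_logIntegrand s hz).continuousAt (by fun_prop)

lemma arcIntegral_add {δ : Param N} {r : ℝ} (h : CircleFree δ r) (s : ℂ) (y₁ y₂ y₃ : ℝ) :
    arcIntegral δ s r y₁ y₂ + arcIntegral δ s r y₂ y₃ = arcIntegral δ s r y₁ y₃ := by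
  have hc := h.continuous_logIntegrand s
  rw [arcIntegral, arcIntegral, arcIntegral, ← mul_add,
    intervalIntegral.integral_add_adjacent_intervals (hc.intervalIntegrable _ _)
      (hc.intervalIntegrable _ _)]

/-- The outgoing and the incoming integrals along the middle ray cancel, and the arcs join.
Convergence on the rays plays no role. -/
lemma sectorIntegral_add {δ : Param N} {r : ℝ} (h : CircleFree δ r) (s : ℂ) (y₁ y₂ y₃ : ℝ) :
    sectorIntegral δ s r y₁ y₂ + sectorIntegral δ s r y₂ y₃ = sectorIntegral δ s r y₁ y₃ := by
  simp only [sectorIntegral, ← arcIntegral_add h s y₁ y₂ y₃]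
  ring

lemma sectorIntegral_self (δ : Param N) (s : ℂ) (r y : ℝ) : sectorIntegral δ s r y y = 0 := by
  simp [sectorIntegral, arcIntegral]

lemma rayIntegral_shift {δ : Param N} {ψ : ℝ} {k : ℂ}
    (hF : ∀ u, F δ (Complex.exp (ψ * Complex.I) * u) = k * F δ u) (s : ℂ) (r y : ℝ) :
    rayIntegral δ s r (y + ψ) = k * Complex.exp (s * (ψ * Complex.I)) * rayIntegral δ s r y := by
  have h1 : ∀ ρ : ℝ, F δ (ρ * Complex.exp ((y + ψ : ℝ) * Complex.I))
      * Complex.exp ((s - 1) * (Real.log ρ : ℂ))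
      = k * (F δ (ρ * Complex.exp (y * Complex.I)) * Complex.exp ((s - 1) * (Real.log ρ : ℂ))) := by
    intro ρ
    rw [← mul_assoc, ← hF]
    push_cast
    rw [add_mul, Complex.exp_add]
    ring_nf
  simp only [rayIntegral, h1, integral_const_mul]
  push_cast
  rw [add_mul, mul_add, Complex.exp_add]
  ring

/-- The translation z ↦ z + iψ multiplies the integrand by a constant, which can be pulled out of
the ray integrals even if they diverge. -/
lemma sectorIntegral_shift {δ : Param N} {ψ : ℝ} {k : ℂ}
    (hF : ∀ u, F δ (Complex.exp (ψ * Complex.I) * u) = k * F δ u) (s : ℂ) (r y₁ y₂ : ℝ) :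
    sectorIntegral δ s r (y₁ + ψ) (y₂ + ψ)
      = k * Complex.exp (s * (ψ * Complex.I)) * sectorIntegral δ s r y₁ y₂ := by
  have harc : arcIntegral δ s r (y₁ + ψ) (y₂ + ψ)
      = k * Complex.exp (s * (ψ * Complex.I)) * arcIntegral δ s r y₁ y₂ := by
    have h1 : ∀ y : ℝ, logIntegrand δ s (Real.log r + (y + ψ : ℝ) * Complex.I)
        = k * Complex.exp (s * (ψ * Complex.I)) * logIntegrand δ s (Real.log r + y * Complex.I) := by
      intro y
      simp only [logIntegrand]
      rw [show (Real.log r : ℂ) + (y + ψ : ℝ) * Complex.I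
        = ψ * Complex.I + (Real.log r + y * Complex.I) by push_cast; ring, Complex.exp_add, hF,
        mul_add s, Complex.exp_add (s * _)]
      ring
    simp only [arcIntegral]
    rw [← intervalIntegral.integral_comp_add_right
      (fun y : ℝ => logIntegrand δ s (Real.log r + y * Complex.I)) ψ]
    simp only [h1, intervalIntegral.integral_const_mul]
    ring
  simp only [sectorIntegral, rayIntegral_shift hF, harc]
  ring

/-- F is single-valued; only the power of u notices a full turn. -/
lemma sectorIntegral_shift_two_pi (δ : Param N) (s : ℂ) (r y₁ y₂ : ℝ) :
    sectorIntegral δ s r (y₁ + 2 * Real.pi) (y₂ + 2 * Real.pi)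
      = e s * sectorIntegral δ s r y₁ y₂ := by
  rw [sectorIntegral_shift (k := 1), one_mul, e]
  · congr 2
    push_cast
    ring
  · intro u
    push_cast
    rw [Complex.exp_two_pi_mul_I, one_mul, one_mul]

/-- Substituting e^{-iω} u for u turns the contour so that it starts on the ray of argument ω; the
exponential factor comes from u^{s-1} du. -/
lemma hankel_eq {r : ℝ} (hr : 0 < r) (δ : Param N) (ω : ℝ) (s : ℂ) :
    hankel r (M (Complex.exp (Complex.I * ω)) δ) s
      = Complex.exp (-(s * (ω * Complex.I)))
        * sectorIntegral δ s r ω (ω + 2 * Real.pi) := by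
  have hinv : Complex.exp (-(s * (ω * Complex.I))) * Complex.exp (s * (ω * Complex.I)) = 1 := by
    rw [← Complex.exp_add, neg_add_cancel, Complex.exp_zero]
  have h1 : (∫ x in Set.Ioi r, F (M (Complex.exp (Complex.I * ω)) δ) (x : ℂ)
      * Complex.exp ((s - 1) * (Real.log x : ℂ)))
      = Complex.exp (-(s * (ω * Complex.I))) * rayIntegral δ s r ω := by
    rw [rayIntegral, ← mul_assoc, hinv, one_mul]
    refine integral_congr_ae (ae_of_all _ fun x => ?_)
    simp only [F_M, mul_comm]
  have h2 : (∫ x in Set.Ioi r, F (M (Complex.exp (Complex.I * ω)) δ) (x : ℂ)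
      * Complex.exp ((s - 1) * ((Real.log x : ℂ) + Complex.I * (2 * Real.pi))))
      = Complex.exp (-(s * (ω * Complex.I))) * rayIntegral δ s r (ω + 2 * Real.pi) := by
    have he : Complex.exp (s * ((ω + 2 * Real.pi : ℝ) * Complex.I))
        = Complex.exp (s * (ω * Complex.I)) * Complex.exp ((s - 1) * (Complex.I * (2 * Real.pi))) := by
      rw [← Complex.exp_add]
      -- The exponents with s - 1 and with s differ by a full period of `exp`.
      rw [show s * ((ω + 2 * Real.pi : ℝ) * Complex.I) = s * (ω * Complex.I)
        + (s - 1) * (Complex.I * (2 * Real.pi)) + 2 * Real.pi * Complex.I by push_cast; ring]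
      exact Complex.exp_periodic _
    have hp : Complex.exp ((ω + 2 * Real.pi : ℝ) * Complex.I) = Complex.exp (ω * Complex.I) := by
      rw [show ((ω + 2 * Real.pi : ℝ) : ℂ) * Complex.I
        = ω * Complex.I + 2 * Real.pi * Complex.I by push_cast; ring]
      exact Complex.exp_periodic _
    rw [rayIntegral, he, mul_assoc (Complex.exp (s * (ω * Complex.I))),
      ← mul_assoc (Complex.exp (-(s * (ω * Complex.I)))), hinv, one_mul, hp, ← integral_const_mul]
    refine integral_congr_ae (ae_of_all _ fun x => ?_)
    simp only [F_M, mul_add, Complex.exp_add]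
    rw [mul_comm (x : ℂ), mul_comm Complex.I]
    ring
  have h3 : (∫ t in (0 : ℝ)..(2 * Real.pi),
      F (M (Complex.exp (Complex.I * ω)) δ) (r * Complex.exp (Complex.I * t))
        * Complex.exp ((s - 1) * ((Real.log r : ℂ) + Complex.I * t))
        * (Complex.I * r * Complex.exp (Complex.I * t)))
      = Complex.exp (-(s * (ω * Complex.I))) * arcIntegral δ s r ω (ω + 2 * Real.pi) := by
    rw [arcIntegral]
    have hsub := intervalIntegral.integral_comp_add_left (a := 0) (b := 2 * Real.pi)
      (fun y : ℝ => logIntegrand δ s (Real.log r + y * Complex.I)) ω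
    rw [add_zero] at hsub
    rw [← hsub, ← intervalIntegral.integral_const_mul, ← intervalIntegral.integral_const_mul]
    refine intervalIntegral.integral_congr fun t _ => ?_
    simp only [F_M, logIntegrand]
    have hr' : (r : ℂ) * Complex.exp (Complex.I * t)
        = Complex.exp (Real.log r + Complex.I * t) := by
      rw [mul_comm Complex.I, exp_log_add hr]
    rw [show Complex.I * (r : ℂ) * Complex.exp (Complex.I * t)
      = Complex.I * (r * Complex.exp (Complex.I * t)) by ring, hr', ← Complex.exp_add]
    rw [show Complex.I * (ω : ℂ) + ((Real.log r : ℂ) + Complex.I * t)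
      = Real.log r + (ω + t : ℝ) * Complex.I by push_cast; ring]
    have : Complex.exp ((s - 1) * (Real.log r + Complex.I * t))
        * (Complex.I * Complex.exp (Real.log r + Complex.I * t))
        = Complex.exp (-(s * (ω * Complex.I)))
          * (Complex.I * Complex.exp (s * (Real.log r + (ω + t : ℝ) * Complex.I))) := by
      rw [mul_left_comm, ← Complex.exp_add, mul_left_comm, ← Complex.exp_add]
      congr 2
      push_cast
      ring
    rw [mul_assoc, this]
    ring
  rw [hankel, h1, h2, h3, sectorIntegral]
  ring

/-! ### Convergence along regular rays -/

lemma exists_norm_F_ray_le {δ : Param N} {y : ℝ} (hy : Regular δ y) {r : ℝ} (hr : 0 < r) :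
    ∃ C : ℝ, 0 ≤ C ∧ ∃ c > 0, ∀ ρ ≥ r,
      ‖F δ (ρ * Complex.exp (y * Complex.I))‖ ≤ C * Real.exp (-(c * ρ)) := by
  obtain ⟨C, hC, c, hc, h⟩ := exists_norm_F_le_of_regular (y₁ := y) (y₂ := y)
    (fun z hz => by rwa [le_antisymm hz.2 hz.1]) hr
  exact ⟨C, hC, c, hc, h y ⟨le_rfl, le_rfl⟩⟩

lemma continuousAt_F_ray {δ : Param N} (hδ : δ ∈ goodDomain N) {y : ℝ} (hy : Regular δ y)
    {ρ : ℝ} (hρ : 0 < ρ) :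
    ContinuousAt (fun ρ : ℝ => F δ (ρ * Complex.exp (y * Complex.I))) ρ := by
  have h0 : (ρ : ℂ) * Complex.exp (y * Complex.I) ≠ 0 := by
    simp [hρ.ne']
  exact ContinuousAt.comp (f := fun ρ : ℝ => (ρ : ℂ) * Complex.exp (y * Complex.I))
    (differentiableAt_F h0 (notMem_poles_of_regular hδ hy ρ)).continuousAt (by fun_prop)

/-- The cut-off of `F` along a ray satisfies the hypotheses on Mellin transforms for all `s`. -/
lemma cutoff_ray {δ : Param N} (hδ : δ ∈ goodDomain N) {y : ℝ} (hy : Regular δ y)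
    {r : ℝ} (hr : 0 < r) :
    ∃ c > 0, LocallyIntegrableOn
      ((Set.Ioi r).indicator fun ρ : ℝ => F δ (ρ * Complex.exp (y * Complex.I))) (Set.Ioi 0) ∧
      ((Set.Ioi r).indicator fun ρ : ℝ => F δ (ρ * Complex.exp (y * Complex.I)))
        =O[atTop] (fun t => Real.exp (-c * t)) ∧
      ∀ b : ℝ, ((Set.Ioi r).indicator fun ρ : ℝ => F δ (ρ * Complex.exp (y * Complex.I)))
        =O[𝓝[>] 0] (fun t : ℝ => t ^ (-b)) := by
  obtain ⟨C, hC, c, hc, h⟩ := exists_norm_F_ray_le hy hr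
  refine ⟨c, hc, ?_, ?_, fun b => ?_⟩
  · have hint : IntegrableOn (fun ρ : ℝ => F δ (ρ * Complex.exp (y * Complex.I))) (Set.Ioi r) := by
      refine Integrable.mono' (g := fun ρ => C * Real.exp (-(c * ρ))) ?_ ?_ ?_
      · have := integrableOn_exp_mul_Ioi (a := -c) (by linarith) r
        simp only [neg_mul] at this
        exact this.const_mul C
      · refine ContinuousOn.aestronglyMeasurable (fun ρ hρ => ?_) measurableSet_Ioi
        exact (continuousAt_F_ray hδ hy (hr.trans hρ)).continuousWithinAt
      · exact (ae_restrict_iff' measurableSet_Ioi).2 (ae_of_all _ fun ρ hρ => h ρ (le_of_lt hρ))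
    exact ((integrable_indicator_iff measurableSet_Ioi).2 hint).locallyIntegrable.locallyIntegrableOn _
  · refine Asymptotics.IsBigO.of_bound C ?_
    filter_upwards [eventually_gt_atTop r] with ρ hρ
    rw [Set.indicator_of_mem (Set.mem_Ioi.2 hρ), Real.norm_of_nonneg (Real.exp_pos _).le, neg_mul]
    exact h ρ hρ.le
  · refine Asymptotics.IsBigO.of_bound 0 ?_
    filter_upwards [nhdsWithin_le_nhds (gt_mem_nhds hr)] with ρ hρ
    rw [Set.indicator_of_notMem (by simpa using le_of_lt hρ), norm_zero, zero_mul]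

lemma mellin_kernel_eq {ρ : ℝ} (hρ : 0 < ρ) (s : ℂ) :
    (ρ : ℂ) ^ (s - 1) = Complex.exp ((s - 1) * (Real.log ρ : ℂ)) := by
  rw [Complex.cpow_def_of_ne_zero (by exact_mod_cast hρ.ne'), Complex.ofReal_log hρ.le, mul_comm]

lemma integrableOn_ray {δ : Param N} (hδ : δ ∈ goodDomain N) {y : ℝ} (hy : Regular δ y)
    {r : ℝ} (hr : 0 < r) (s : ℂ) :
    IntegrableOn (fun ρ : ℝ => F δ (ρ * Complex.exp (y * Complex.I))
      * Complex.exp ((s - 1) * (Real.log ρ : ℂ))) (Set.Ioi r) := by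
  obtain ⟨c, hc, h1, h2, h3⟩ := cutoff_ray hδ hy hr
  have h := mellinConvergent_of_isBigO_rpow_exp hc h1 h2 (h3 (s.re - 1)) (s := s) (by linarith)
  have h' := h.mono_set (Set.Ioi_subset_Ioi hr.le)
  refine h'.congr_fun (fun ρ hρ => ?_) measurableSet_Ioi
  simp only [smul_eq_mul]
  rw [Set.indicator_of_mem hρ, mellin_kernel_eq (hr.trans hρ), mul_comm]

/-- Up to an entire factor this is the Mellin transform of a function that vanishes near 0 and
decays exponentially, hence it is entire. -/
lemma differentiable_rayIntegral {δ : Param N} (hδ : δ ∈ goodDomain N) {y : ℝ} (hy : Regular δ y)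
    {r : ℝ} (hr : 0 < r) : Differentiable ℂ fun s => rayIntegral δ s r y := by
  obtain ⟨c, hc, h1, h2, h3⟩ := cutoff_ray hδ hy hr
  have heq : ∀ s, (∫ ρ in Set.Ioi r, F δ (ρ * Complex.exp (y * Complex.I))
      * Complex.exp ((s - 1) * (Real.log ρ : ℂ)))
      = mellin ((Set.Ioi r).indicator fun ρ : ℝ => F δ (ρ * Complex.exp (y * Complex.I))) s := by
    intro s
    rw [mellin, ← integral_indicator measurableSet_Ioi, ← integral_indicator measurableSet_Ioi]
    congr 1
    ext ρ
    by_cases hρ : r < ρ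
    · rw [Set.indicator_of_mem (show ρ ∈ Set.Ioi r from hρ),
        Set.indicator_of_mem (show ρ ∈ Set.Ioi 0 from hr.trans hρ),
        Set.indicator_of_mem (show ρ ∈ Set.Ioi r from hρ), smul_eq_mul,
        mellin_kernel_eq (hr.trans hρ), mul_comm]
    · rw [Set.indicator_of_notMem (show ρ ∉ Set.Ioi r from hρ)]
      by_cases h0 : ρ ∈ Set.Ioi (0 : ℝ)
      · rw [Set.indicator_of_mem h0, Set.indicator_of_notMem (show ρ ∉ Set.Ioi r from hρ),
          smul_zero]
      · rw [Set.indicator_of_notMem h0]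
  intro s
  simp only [rayIntegral, heq]
  refine DifferentiableAt.mul (by fun_prop) ?_
  exact mellin_differentiableAt_of_isBigO_rpow_exp hc h1 h2 (h3 (s.re - 1)) (by linarith)

lemma CircleFree.differentiable_arcIntegral {δ : Param N} {r : ℝ} (h : CircleFree δ r)
    (y₁ y₂ : ℝ) : Differentiable ℂ fun s => arcIntegral δ s r y₁ y₂ := by
  intro s₀
  refine DifferentiableAt.const_mul ?_ _
  set c : ℝ → ℂ := fun y => Real.log r + y * Complex.I with hc
  have hcc : Continuous c := by fun_prop
  have hF : Continuous fun y => F δ (Complex.exp (c y)) := by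
    have := h.continuous_logIntegrand 0
    simpa only [logIntegrand, zero_mul, Complex.exp_zero, mul_one] using this
  obtain ⟨B, hB⟩ := ((isCompact_closedBall s₀ 1).prod
    (isCompact_uIcc (a := y₁) (b := y₂))).exists_bound_of_continuousOn
    (f := fun p : ℂ × ℝ => F δ (Complex.exp (c p.2)) * (Complex.exp (p.1 * c p.2) * c p.2))
    (Continuous.continuousOn ((hF.comp continuous_snd).mul (by fun_prop)))
  have := intervalIntegral.hasDerivAt_integral_of_dominated_loc_of_deriv_le
    (F := fun s y => logIntegrand δ s (c y)) (a := y₁) (b := y₂) (μ := volume) (x₀ := s₀)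
    (F' := fun s y => F δ (Complex.exp (c y)) * (Complex.exp (s * c y) * c y))
    (bound := fun _ => B) (Metric.closedBall_mem_nhds s₀ one_pos)
    (Eventually.of_forall fun s => (h.continuous_logIntegrand s).aestronglyMeasurable)
    ((h.continuous_logIntegrand s₀).intervalIntegrable _ _)
    (by fun_prop)
    (ae_of_all _ fun y hy s hs => hB (s, y) ⟨hs, Set.uIoc_subset_uIcc hy⟩)
    intervalIntegrable_const
    (ae_of_all _ fun y _ s _ => by
      have h1 : HasDerivAt (fun s : ℂ => Complex.exp (s * c y)) (Complex.exp (s * c y) * c y) s := by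
        simpa using ((hasDerivAt_id s).mul_const (c y)).cexp
      exact h1.const_mul _)
  exact this.2.differentiableAt

lemma differentiable_sectorIntegral {δ : Param N} (hδ : δ ∈ goodDomain N) {r : ℝ}
    (hr : CircleFree δ r) {y₁ y₂ : ℝ} (h₁ : Regular δ y₁) (h₂ : Regular δ y₂) :
    Differentiable ℂ fun s => sectorIntegral δ s r y₁ y₂ :=
  ((differentiable_rayIntegral hδ h₁ hr.1).neg.add (hr.differentiable_arcIntegral y₁ y₂)).add
    (differentiable_rayIntegral hδ h₂ hr.1)

lemma integral_logIntegrand {δ : Param N} (hδ : δ ∈ goodDomain N) {y : ℝ} (hy : Regular δ y)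
    {r R : ℝ} (hr : 0 < r) (hrR : r ≤ R) (s : ℂ) :
    ∫ x in Real.log r..Real.log R, logIntegrand δ s (x + y * Complex.I)
      = Complex.exp (s * (y * Complex.I)) * ∫ ρ in r..R,
        F δ (ρ * Complex.exp (y * Complex.I)) * Complex.exp ((s - 1) * (Real.log ρ : ℂ)) := by
  have hR : 0 < R := hr.trans_le hrR
  have hsub := intervalIntegral.integral_deriv_smul_comp' (a := Real.log r) (b := Real.log R)
    (f := Real.exp) (f' := Real.exp)
    (g := fun ρ : ℝ => F δ (ρ * Complex.exp (y * Complex.I))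
      * Complex.exp ((s - 1) * (Real.log ρ : ℂ)))
    (fun x _ => Real.hasDerivAt_exp x) Real.continuous_exp.continuousOn
    (by
      rintro _ ⟨x, _, rfl⟩
      refine ContinuousAt.continuousWithinAt ?_
      have hx := Real.exp_pos x
      refine (continuousAt_F_ray hδ hy hx).mul ?_
      have := Real.continuousAt_log hx.ne'
      fun_prop)
  rw [Real.exp_log hr, Real.exp_log hR] at hsub
  rw [← hsub, ← intervalIntegral.integral_const_mul]
  refine intervalIntegral.integral_congr fun x _ => ?_
  simp only [logIntegrand, Function.comp, Real.log_exp, Complex.real_smul, Complex.ofReal_exp]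
  rw [Complex.exp_add, mul_add, Complex.exp_add, sub_mul, one_mul, Complex.exp_sub]
  field_simp

lemma rayIntegral_sub {δ : Param N} (hδ : δ ∈ goodDomain N) {y : ℝ} (hy : Regular δ y)
    {r R : ℝ} (hr : 0 < r) (hrR : r ≤ R) (s : ℂ) :
    rayIntegral δ s r y - rayIntegral δ s R y
      = ∫ x in Real.log r..Real.log R, logIntegrand δ s (x + y * Complex.I) := by
  rw [integral_logIntegrand hδ hy hr hrR, rayIntegral, rayIntegral, ← mul_sub,
    intervalIntegral.integral_Ioi_sub_Ioi (integrableOn_ray hδ hy hr s) hrR]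

lemma tendsto_rayIntegral {δ : Param N} (hδ : δ ∈ goodDomain N) {y : ℝ} (hy : Regular δ y)
    (s : ℂ) : Tendsto (fun R => rayIntegral δ s R y) atTop (𝓝 0) := by
  have h := intervalIntegral_tendsto_integral_Ioi 1 (integrableOn_ray hδ hy one_pos s) tendsto_id
  have h' := (h.const_mul (Complex.exp (s * (y * Complex.I)))).const_sub (rayIntegral δ s 1 y)
  rw [← rayIntegral, sub_self] at h'
  refine h'.congr' ?_
  filter_upwards [eventually_ge_atTop 1] with R hR
  rw [id, ← integral_logIntegrand hδ hy one_pos hR, ← rayIntegral_sub hδ hy one_pos hR]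
  ring

/-- Under `exp`, the horizontal sides are the parts of the two rays between radii r and R, and the
vertical sides are the two arcs. -/
lemma rectIntegral_logIntegrand {δ : Param N} (hδ : δ ∈ goodDomain N) {y₁ y₂ : ℝ}
    (h₁ : Regular δ y₁) (h₂ : Regular δ y₂) {r R : ℝ} (hr : 0 < r) (hrR : r ≤ R) (s : ℂ) :
    rectIntegral (logIntegrand δ s) (Real.log r) (Real.log R) y₁ y₂
      = sectorIntegral δ s R y₁ y₂ - sectorIntegral δ s r y₁ y₂ := by
  rw [rectIntegral, ← rayIntegral_sub hδ h₁ hr hrR, ← rayIntegral_sub hδ h₂ hr hrR,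
    ← arcIntegral, ← arcIntegral, sectorIntegral, sectorIntegral]
  ring

lemma tendsto_sectorIntegral {δ : Param N} (hδ : δ ∈ goodDomain N) {y₁ y₂ : ℝ}
    (h₁ : Regular δ y₁) (h₂ : Regular δ y₂) (s : ℂ) {l : Filter ℝ} (hl : l ≤ atTop)
    (harc : Tendsto (fun R => arcIntegral δ s R y₁ y₂) l (𝓝 0)) :
    Tendsto (fun R => sectorIntegral δ s R y₁ y₂) l (𝓝 0) := by
  have := (((tendsto_rayIntegral hδ h₁ s).mono_left hl).neg.add harc).add
    ((tendsto_rayIntegral hδ h₂ s).mono_left hl)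
  simpa [sectorIntegral] using this

lemma sectorIntegral_congr_radius {δ : Param N} (hδ : δ ∈ goodDomain N) {y₁ y₂ : ℝ}
    (hy : y₁ ≤ y₂) (h₁ : Regular δ y₁) (h₂ : Regular δ y₂) {r R : ℝ} (hr : PoleFree δ r)
    (hR : PoleFree δ R) (s : ℂ) :
    sectorIntegral δ s r y₁ y₂ = sectorIntegral δ s R y₁ y₂ := by
  wlog hrR : r ≤ R generalizing r R
  · exact (this hR hr (le_of_not_ge hrR)).symm
  have h := rectIntegral_logIntegrand hδ h₁ h₂ hr.1 hrR s
  rw [rectIntegral_eq_zero (Real.log_le_log hr.1 hrR) hy] at h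
  · exact (sub_eq_zero.1 h.symm).symm
  · intro z _ hz _ _
    refine differentiableAt_logIntegrand s fun hp => ?_
    have := hR.2 _ hp
    rw [Complex.norm_exp] at this
    exact absurd ((Real.le_log_iff_exp_le hR.1).1 hz) (not_le.2 this)

/-! ### The arc at infinity -/

lemma norm_exp_mul_le {s : ℂ} {R y Y : ℝ} (hR : 0 < R) (hy : |y| ≤ Y) :
    ‖Complex.exp (s * (Real.log R + y * Complex.I))‖ ≤ R ^ s.re * Real.exp (|s.im| * Y) := by
  rw [Complex.norm_exp, Real.rpow_def_of_pos hR, ← Real.exp_add, Real.exp_le_exp]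
  have h : (s * (Real.log R + y * Complex.I)).re = Real.log R * s.re - s.im * y := by
    simp
    ring
  rw [h, sub_eq_add_neg]
  gcongr
  calc -(s.im * y) ≤ |s.im * y| := neg_le_abs _
    _ = |s.im| * |y| := abs_mul _ _
    _ ≤ |s.im| * Y := by gcongr

lemma abs_le_of_mem_uIoc {a b y : ℝ} (h : y ∈ Set.uIoc a b) : |y| ≤ max |a| |b| := by
  rw [Set.mem_uIoc] at h
  rcases h with h | h
  · exact abs_le_max_abs_abs h.1.le h.2
  · rw [max_comm]
    exact abs_le_max_abs_abs h.1.le h.2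

lemma tendsto_arcIntegral_of_regular {δ : Param N} {y₁ y₂ : ℝ} (hy : y₁ ≤ y₂)
    (hreg : ∀ y ∈ Set.Icc y₁ y₂, Regular δ y) (s : ℂ) :
    Tendsto (fun R => arcIntegral δ s R y₁ y₂) atTop (𝓝 0) := by
  obtain ⟨C, hC, c, hc, h⟩ := exists_norm_F_le_of_regular hreg one_pos
  have hlim := ((tendsto_rpow_mul_exp_neg_mul_atTop_nhds_zero s.re c hc).const_mul
    (C * Real.exp (|s.im| * max |y₁| |y₂|) * |y₂ - y₁|))
  rw [mul_zero] at hlim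
  refine squeeze_zero_norm' ?_ hlim
  filter_upwards [eventually_ge_atTop 1] with R hR
  have hR0 : 0 < R := one_pos.trans_le hR
  rw [arcIntegral, norm_mul, Complex.norm_I, one_mul]
  refine (intervalIntegral.norm_integral_le_of_norm_le_const
    (C := C * Real.exp (-(c * R)) * (R ^ s.re * Real.exp (|s.im| * max |y₁| |y₂|)))
    fun y hy' => ?_).trans (le_of_eq (by rw [neg_mul]; ring))
  rw [logIntegrand, norm_mul, exp_log_add hR0]
  refine mul_le_mul (h y ?_ R hR) (norm_exp_mul_le hR0 (abs_le_of_mem_uIoc hy')) (norm_nonneg _)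
    (by positivity)
  rw [Set.uIoc_of_le hy] at hy'
  exact Set.Ioc_subset_Icc_self hy'

/-- No pole lies in the sector, so by Cauchy's theorem the integral does not change as the radius
grows. At infinity the uniform exponential decay makes it vanish, for every s. -/
lemma sectorIntegral_eq_zero {δ : Param N} (hδ : δ ∈ goodDomain N) {y₁ y₂ : ℝ} (hy : y₁ ≤ y₂)
    (hreg : ∀ y ∈ Set.Icc y₁ y₂, Regular δ y) {r : ℝ} (hr : 0 < r) (s : ℂ) :
    sectorIntegral δ s r y₁ y₂ = 0 := by
  have h₁ := hreg y₁ ⟨le_rfl, hy⟩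
  have h₂ := hreg y₂ ⟨hy, le_rfl⟩
  have hlim := tendsto_sectorIntegral hδ h₁ h₂ s le_rfl (tendsto_arcIntegral_of_regular hy hreg s)
  refine tendsto_nhds_unique (tendsto_const_nhds.congr' ?_) hlim
  filter_upwards [eventually_ge_atTop r] with R hR
  have h := rectIntegral_logIntegrand hδ h₁ h₂ hr hR s
  rw [rectIntegral_eq_zero (Real.log_le_log hr hR) hy] at h
  · exact (sub_eq_zero.1 h.symm).symm
  · exact fun z _ _ hz hz' =>
      differentiableAt_logIntegrand s (exp_notMem_poles hδ (hreg _ ⟨hz, hz'⟩))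

/-- The arc may cross arguments where F does not decay at all. There the O(1/R) bound on the
integrated decay competes with R^{Re s}, which is where Re s < 1 enters. -/
lemma tendsto_arcIntegral_goodRadii {δ : Param N} (hδ : δ ∈ DtildeCstar N) (y₁ y₂ : ℝ) {η : ℝ}
    (hη : 0 < η) {s : ℂ} (hs : s.re < 1) :
    Tendsto (fun R => arcIntegral δ s R y₁ y₂) (atTop ⊓ 𝓟 (goodRadii δ η)) (𝓝 0) := by
  obtain ⟨C, hC, h⟩ := exists_norm_F_le_of_goodRadii δ hη one_pos
  obtain ⟨C', hC', h'⟩ := exists_integral_exp_growth_le hδ y₁ y₂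
  set D := C * Real.exp (|s.im| * max |y₁| |y₂|) with hD
  have hlim : Tendsto (fun R : ℝ => D * C' * R ^ (-(1 - s.re))) atTop (𝓝 0) := by
    simpa using (tendsto_rpow_neg_atTop (sub_pos.2 hs)).const_mul (D * C')
  refine squeeze_zero_norm' ?_ (hlim.mono_left inf_le_left)
  rw [eventually_inf_principal]
  filter_upwards [eventually_ge_atTop 1] with R hR hgood
  have hR0 : 0 < R := one_pos.trans_le hR
  rw [arcIntegral, norm_mul, Complex.norm_I, one_mul]
  have hcont := continuous_growth δ
  calc ‖∫ y in y₁..y₂, logIntegrand δ s (Real.log R + y * Complex.I)‖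
      ≤ ∫ y in Set.uIoc y₁ y₂, ‖logIntegrand δ s (Real.log R + y * Complex.I)‖ :=
        intervalIntegral.norm_integral_le_integral_norm_uIoc
    _ ≤ ∫ y in Set.uIoc y₁ y₂, D * R ^ s.re * Real.exp (-(R * growth δ y)) := by
        refine integral_mono_of_nonneg (ae_of_all _ fun _ => norm_nonneg _) ?_ ?_
        · exact (Continuous.integrableOn_uIcc (by fun_prop)).mono_set Set.uIoc_subset_uIcc
        · refine (ae_restrict_iff' measurableSet_uIoc).2 (ae_of_all _ fun y hy => ?_)
          simp only [logIntegrand]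
          rw [norm_mul, exp_log_add hR0]
          refine (mul_le_mul (h R hgood hR y) (norm_exp_mul_le hR0 (abs_le_of_mem_uIoc hy))
            (norm_nonneg _) (by positivity)).trans (le_of_eq (by rw [hD]; ring))
    _ ≤ D * R ^ s.re * (C' / R) := by
        rw [integral_const_mul]
        exact mul_le_mul_of_nonneg_left (h' R hR0) (by positivity)
    _ = D * C' * R ^ (-(1 - s.re)) := by
        rw [neg_sub, Real.rpow_sub_one hR0.ne']
        ring

/-! ### Residues -/

/-- Near `u₀`, `h` is the sum of `c / (u - u₀)`, of the derivative of a function that is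
holomorphic off `u₀`, and of a holomorphic function. -/
def HasResidue (h : ℂ → ℂ) (u₀ c : ℂ) : Prop :=
  ∃ Q φ : ℂ → ℂ, (∀ u, u ≠ u₀ → DifferentiableAt ℂ Q u) ∧ AnalyticAt ℂ φ u₀ ∧
    ∀ᶠ u in 𝓝[≠] u₀, h u = c * (u - u₀)⁻¹ + deriv Q u + φ u

/-- Induction on the order: write g(u) = g(u₀) + (u - u₀) g₁(u) and split off the leading power. -/
lemma hasResidue_pow_mul (n : ℕ) {g : ℂ → ℂ} {u₀ : ℂ} (hg : AnalyticAt ℂ g u₀) :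
    ∃ c, HasResidue (fun u => ((u - u₀) ^ n)⁻¹ * g u) u₀ c := by
  induction n generalizing g with
  | zero => exact ⟨0, 0, g, by simp, hg, by simp [Pi.zero_def]⟩
  | succ n ih =>
    have hg1 : AnalyticAt ℂ (dslope g u₀) u₀ := by
      obtain ⟨p, hp⟩ := hg
      exact ⟨_, hp.has_fpower_series_dslope_fslope⟩
    obtain ⟨c, Q, φ, hQ, hφ, h⟩ := ih hg1
    have hsplit : ∀ u, u ≠ u₀ → ((u - u₀) ^ (n + 1))⁻¹ * g u
        = ((u - u₀) ^ n)⁻¹ * dslope g u₀ u + g u₀ * ((u - u₀) ^ (n + 1))⁻¹ := by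
      intro u hu
      have h1 := sub_smul_dslope g u₀ u
      rw [smul_eq_mul] at h1
      have h2 : u - u₀ ≠ 0 := sub_ne_zero.2 hu
      rw [show g u = (u - u₀) * dslope g u₀ u + g u₀ by rw [h1]; ring]
      field_simp
      ring
    -- The leading power is (u - u₀)⁻¹ in the first case, which adds to the residue. In the second
    -- it is of order at least two and has a primitive.
    rcases n with _ | n
    · refine ⟨c + g u₀, Q, φ, hQ, hφ, ?_⟩
      filter_upwards [h, self_mem_nhdsWithin] with u hu hne
      rw [hsplit u hne, hu]
      simp
      ring
    · have hd : ∀ u, u ≠ u₀ → HasDerivAt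
          (fun u => -(g u₀ / (n + 1)) * ((u - u₀) ^ (n + 1))⁻¹)
          (g u₀ * ((u - u₀) ^ (n + 2))⁻¹) u := by
        intro u hu
        have h2 : u - u₀ ≠ 0 := sub_ne_zero.2 hu
        have h3 := ((((hasDerivAt_id u).sub_const u₀).pow (n + 1)).inv
          (pow_ne_zero _ h2)).const_mul (-(g u₀ / (n + 1)))
        refine (h3.congr_deriv ?_)
        have h4 : (n : ℂ) + 1 ≠ 0 := by exact_mod_cast n.succ_ne_zero
        simp
        field_simp
        ring
      refine ⟨c, fun u => Q u + -(g u₀ / (n + 1)) * ((u - u₀) ^ (n + 1))⁻¹, φ,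
        fun u hu => (hQ u hu).add (hd u hu).differentiableAt, hφ, ?_⟩
      filter_upwards [h, self_mem_nhdsWithin] with u hu hne
      rw [hsplit u hne, hu, ((hQ u hne).hasDerivAt.fun_add (hd u hne)).deriv]
      ring

lemma exists_hasResidue {h : ℂ → ℂ} {u₀ : ℂ} (hh : MeromorphicAt h u₀) :
    ∃ c, HasResidue h u₀ c := by
  obtain ⟨n, hn⟩ := hh
  obtain ⟨c, Q, φ, hQ, hφ, hc⟩ := hasResidue_pow_mul n hn
  refine ⟨c, Q, φ, hQ, hφ, ?_⟩
  filter_upwards [hc, self_mem_nhdsWithin] with u hu hne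
  rw [← hu, smul_eq_mul, inv_mul_cancel_left₀ (pow_ne_zero _ (sub_ne_zero.2 hne))]

lemma analyticAt_deriv_of_ne {Q : ℂ → ℂ} {u₀ u : ℂ}
    (hQ : ∀ u, u ≠ u₀ → DifferentiableAt ℂ Q u) (hu : u ≠ u₀) : AnalyticAt ℂ (deriv Q) u :=
  (Complex.analyticAt_iff_eventually_differentiableAt.2
    ((isOpen_ne.eventually_mem hu).mono hQ)).deriv

/-- On each small circle the derivative and the holomorphic part integrate to 0, so the expression
in the limit is constant for small radii. -/
lemma HasResidue.residue_eq {h : ℂ → ℂ} {u₀ c : ℂ} (hr : HasResidue h u₀ c) :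
    residue h u₀ = c := by
  obtain ⟨Q, φ, hQ, hφ, heq⟩ := hr
  refine Tendsto.limUnder_eq (tendsto_const_nhds.congr' ?_)
  rw [eventually_nhdsWithin_iff] at heq
  obtain ⟨R, hR, hball⟩ := Metric.eventually_nhds_iff_ball.1
    (heq.and hφ.eventually_analyticAt)
  filter_upwards [self_mem_nhdsWithin, nhdsWithin_le_nhds (gt_mem_nhds hR)] with r hr hrR
  have hr0 : 0 < r := hr
  have hsub : Metric.closedBall u₀ r ⊆ Metric.ball u₀ R := Metric.closedBall_subset_ball hrR
  have hne : ∀ u ∈ Metric.sphere u₀ r, u ≠ u₀ := fun u hu => Metric.ne_of_mem_sphere hu hr0.ne'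
  have hc1 : ContinuousOn (fun u => c * (u - u₀)⁻¹) (Metric.sphere u₀ r) := fun u hu =>
    ContinuousAt.continuousWithinAt
      (continuousAt_const.mul (ContinuousAt.inv₀ (by fun_prop) (sub_ne_zero.2 (hne u hu))))
  have hc2 : ContinuousOn (deriv Q) (Metric.sphere u₀ r) := fun u hu =>
    (analyticAt_deriv_of_ne hQ (hne u hu)).continuousAt.continuousWithinAt
  have hc3 : DifferentiableOn ℂ φ (Metric.closedBall u₀ r) := fun u hu =>
    (hball u (hsub hu)).2.differentiableAt.differentiableWithinAt
  have hI : (∮ u in C(u₀, r), h u) = 2 * Real.pi * Complex.I * c := by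
    calc (∮ u in C(u₀, r), h u)
        = ∮ u in C(u₀, r), (c * (u - u₀)⁻¹ + deriv Q u + φ u) :=
          circleIntegral.integral_congr hr0.le fun u hu =>
            (hball u (hsub (Metric.sphere_subset_closedBall hu))).1 (hne u hu)
      _ = (∮ u in C(u₀, r), c * (u - u₀)⁻¹) + (∮ u in C(u₀, r), deriv Q u)
          + ∮ u in C(u₀, r), φ u := by
          have i1 := hc1.circleIntegrable hr0.le
          have i2 := hc2.circleIntegrable hr0.le
          have i3 := (hc3.continuousOn.mono Metric.sphere_subset_closedBall).circleIntegrable hr0.le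
          exact (circleIntegral.integral_add (i1.add i2) i3).trans
            (congrArg (· + _) (circleIntegral.integral_add i1 i2))
      _ = 2 * Real.pi * Complex.I * c := by
          have e2 : (∮ u in C(u₀, r), deriv Q u) = 0 :=
            circleIntegral.integral_eq_zero_of_hasDerivWithinAt hr0.le fun u hu =>
              (hQ u (hne u hu)).hasDerivAt.hasDerivWithinAt
          have e3 : (∮ u in C(u₀, r), φ u) = 0 :=
            Complex.circleIntegral_eq_zero_of_differentiable_on_off_countable hr0.le
              Set.countable_empty hc3.continuousOn fun u hu =>
              (hball u (hsub (Metric.ball_subset_closedBall hu.1))).2.differentiableAt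
          rw [e2, e3, circleIntegral.integral_const_mul,
            circleIntegral.integral_sub_center_inv u₀ hr0.ne']
          ring
  rw [hI, inv_mul_cancel_left₀ Complex.two_pi_I_ne_zero]

lemma HasResidue.add_analytic {h k : ℂ → ℂ} {u₀ c : ℂ} (hr : HasResidue h u₀ c)
    (hk : ∃ φ : ℂ → ℂ, AnalyticAt ℂ φ u₀ ∧ ∀ᶠ u in 𝓝[≠] u₀, k u = h u + φ u) :
    HasResidue k u₀ c := by
  obtain ⟨Q, φ, hQ, hφ, heq⟩ := hr
  obtain ⟨φ', hφ', heq'⟩ := hk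
  refine ⟨Q, fun u => φ u + φ' u, hQ, hφ.add hφ', ?_⟩
  filter_upwards [heq, heq'] with u h1 h2
  rw [h2, h1]
  ring

/-! ### Rectangles around singularities -/

/-- The closed rectangle. -/
def closedRect (x₁ x₂ y₁ y₂ : ℝ) : Set ℂ := Set.Icc x₁ x₂ ×ℂ Set.Icc y₁ y₂

/-- The open rectangle. -/
def openRect (x₁ x₂ y₁ y₂ : ℝ) : Set ℂ := Set.Ioo x₁ x₂ ×ℂ Set.Ioo y₁ y₂

lemma bottom_mem {x₁ x₂ y₁ y₂ x : ℝ} (hy : y₁ ≤ y₂) (hx : x ∈ Set.Icc x₁ x₂) :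
    (x : ℂ) + y₁ * Complex.I ∈ closedRect x₁ x₂ y₁ y₂ \ openRect x₁ x₂ y₁ y₂ := by
  simp [closedRect, openRect, Complex.mem_reProdIm, hx.1, hx.2, hy]

lemma top_mem {x₁ x₂ y₁ y₂ x : ℝ} (hy : y₁ ≤ y₂) (hx : x ∈ Set.Icc x₁ x₂) :
    (x : ℂ) + y₂ * Complex.I ∈ closedRect x₁ x₂ y₁ y₂ \ openRect x₁ x₂ y₁ y₂ := by
  simp [closedRect, openRect, Complex.mem_reProdIm, hx.1, hx.2, hy]

lemma left_mem {x₁ x₂ y₁ y₂ y : ℝ} (hx : x₁ ≤ x₂) (hy : y ∈ Set.Icc y₁ y₂) :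
    (x₁ : ℂ) + y * Complex.I ∈ closedRect x₁ x₂ y₁ y₂ \ openRect x₁ x₂ y₁ y₂ := by
  simp [closedRect, openRect, Complex.mem_reProdIm, hy.1, hy.2, hx]

lemma right_mem {x₁ x₂ y₁ y₂ y : ℝ} (hx : x₁ ≤ x₂) (hy : y ∈ Set.Icc y₁ y₂) :
    (x₂ : ℂ) + y * Complex.I ∈ closedRect x₁ x₂ y₁ y₂ \ openRect x₁ x₂ y₁ y₂ := by
  simp [closedRect, openRect, Complex.mem_reProdIm, hy.1, hy.2, hx]

lemma intervalIntegrable_horizontal {f : ℂ → ℂ} {a b y : ℝ} (hab : a ≤ b)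
    (hf : ∀ x ∈ Set.Icc a b, ContinuousAt f (x + y * Complex.I)) :
    IntervalIntegrable (fun x : ℝ => f (x + y * Complex.I)) volume a b := by
  refine ContinuousOn.intervalIntegrable fun x hx => ?_
  rw [Set.uIcc_of_le hab] at hx
  exact (ContinuousAt.comp (f := fun x : ℝ => (x : ℂ) + y * Complex.I) (hf x hx)
    (by fun_prop)).continuousWithinAt

lemma intervalIntegrable_vertical {f : ℂ → ℂ} {a b x : ℝ} (hab : a ≤ b)
    (hf : ∀ y ∈ Set.Icc a b, ContinuousAt f (x + y * Complex.I)) :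
    IntervalIntegrable (fun y : ℝ => f (x + y * Complex.I)) volume a b := by
  refine ContinuousOn.intervalIntegrable fun y hy => ?_
  rw [Set.uIcc_of_le hab] at hy
  exact (ContinuousAt.comp (f := fun y : ℝ => (x : ℂ) + y * Complex.I) (hf y hy)
    (by fun_prop)).continuousWithinAt

lemma integral_horizontal {f G : ℂ → ℂ} {a b y : ℝ} (hab : a ≤ b)
    (hf : ∀ x ∈ Set.Icc a b, ContinuousAt f (x + y * Complex.I))
    (hG : ∀ x ∈ Set.Icc a b, HasDerivAt G (f (x + y * Complex.I)) (x + y * Complex.I)) :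
    ∫ x in a..b, f (x + y * Complex.I) = G (b + y * Complex.I) - G (a + y * Complex.I) := by
  refine intervalIntegral.integral_eq_sub_of_hasDerivAt
    (f := fun x : ℝ => G (x + y * Complex.I)) (fun x hx => ?_)
    (intervalIntegrable_horizontal hab hf)
  rw [Set.uIcc_of_le hab] at hx
  have h1 : HasDerivAt (fun x : ℝ => (x : ℂ) + y * Complex.I) 1 x :=
    (Complex.ofRealCLM.hasDerivAt (x := x)).add_const _
  exact ((hG x hx).comp x h1).congr_deriv (mul_one _)

lemma integral_vertical {f G : ℂ → ℂ} {a b x : ℝ} (hab : a ≤ b)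
    (hf : ∀ y ∈ Set.Icc a b, ContinuousAt f (x + y * Complex.I))
    (hG : ∀ y ∈ Set.Icc a b, HasDerivAt G (f (x + y * Complex.I)) (x + y * Complex.I)) :
    Complex.I * ∫ y in a..b, f (x + y * Complex.I)
      = G (x + b * Complex.I) - G (x + a * Complex.I) := by
  rw [← intervalIntegral.integral_const_mul]
  refine intervalIntegral.integral_eq_sub_of_hasDerivAt
    (f := fun y : ℝ => G (x + y * Complex.I)) (fun y hy => ?_)
    ((intervalIntegrable_vertical hab hf).const_mul _)
  rw [Set.uIcc_of_le hab] at hy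
  have h1 : HasDerivAt (fun y : ℝ => (x : ℂ) + y * Complex.I) Complex.I y := by
    simpa using ((Complex.ofRealCLM.hasDerivAt (x := y)).mul_const Complex.I).const_add (x : ℂ)
  exact ((hG y hy).comp y h1).congr_deriv (mul_comm _ _)

section Rect

variable {x₁ x₂ y₁ y₂ : ℝ}

lemma rectIntegral_add (hx : x₁ ≤ x₂) (hy : y₁ ≤ y₂) {f g : ℂ → ℂ}
    (hf : ∀ z ∈ closedRect x₁ x₂ y₁ y₂ \ openRect x₁ x₂ y₁ y₂, ContinuousAt f z)
    (hg : ∀ z ∈ closedRect x₁ x₂ y₁ y₂ \ openRect x₁ x₂ y₁ y₂, ContinuousAt g z) :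
    rectIntegral (fun z => f z + g z) x₁ x₂ y₁ y₂
      = rectIntegral f x₁ x₂ y₁ y₂ + rectIntegral g x₁ x₂ y₁ y₂ := by
  simp only [rectIntegral]
  rw [intervalIntegral.integral_add
      (intervalIntegrable_horizontal hx fun x h => hf _ (bottom_mem hy h))
      (intervalIntegrable_horizontal hx fun x h => hg _ (bottom_mem hy h)),
    intervalIntegral.integral_add
      (intervalIntegrable_horizontal hx fun x h => hf _ (top_mem hy h))
      (intervalIntegrable_horizontal hx fun x h => hg _ (top_mem hy h)),
    intervalIntegral.integral_add
      (intervalIntegrable_vertical hy fun y h => hf _ (left_mem hx h))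
      (intervalIntegrable_vertical hy fun y h => hg _ (left_mem hx h)),
    intervalIntegral.integral_add
      (intervalIntegrable_vertical hy fun y h => hf _ (right_mem hx h))
      (intervalIntegrable_vertical hy fun y h => hg _ (right_mem hx h))]
  ring

lemma rectIntegral_const_mul (c : ℂ) (f : ℂ → ℂ) :
    rectIntegral (fun z => c * f z) x₁ x₂ y₁ y₂ = c * rectIntegral f x₁ x₂ y₁ y₂ := by
  simp only [rectIntegral, intervalIntegral.integral_const_mul]
  ring

lemma rectIntegral_congr (hx : x₁ ≤ x₂) (hy : y₁ ≤ y₂) {f g : ℂ → ℂ}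
    (h : ∀ z ∈ closedRect x₁ x₂ y₁ y₂ \ openRect x₁ x₂ y₁ y₂, f z = g z) :
    rectIntegral f x₁ x₂ y₁ y₂ = rectIntegral g x₁ x₂ y₁ y₂ := by
  simp only [rectIntegral]
  congr 1
  · congr 1
    · congr 1
      · exact intervalIntegral.integral_congr fun x hx' =>
          h _ (bottom_mem hy (by rwa [Set.uIcc_of_le hx] at hx'))
      · exact intervalIntegral.integral_congr fun x hx' =>
          h _ (top_mem hy (by rwa [Set.uIcc_of_le hx] at hx'))
    · congr 1
      exact intervalIntegral.integral_congr fun y hy' =>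
        h _ (right_mem hx (by rwa [Set.uIcc_of_le hy] at hy'))
  · congr 1
    exact intervalIntegral.integral_congr fun y hy' =>
      h _ (left_mem hx (by rwa [Set.uIcc_of_le hy] at hy'))

lemma rectIntegral_eq_zero_of_hasDerivAt (hx : x₁ ≤ x₂) (hy : y₁ ≤ y₂) {f G : ℂ → ℂ}
    (hf : ∀ z ∈ closedRect x₁ x₂ y₁ y₂ \ openRect x₁ x₂ y₁ y₂, ContinuousAt f z)
    (hG : ∀ z ∈ closedRect x₁ x₂ y₁ y₂ \ openRect x₁ x₂ y₁ y₂, HasDerivAt G (f z) z) :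
    rectIntegral f x₁ x₂ y₁ y₂ = 0 := by
  rw [rectIntegral,
    integral_horizontal hx (fun x h => hf _ (bottom_mem hy h)) fun x h => hG _ (bottom_mem hy h),
    integral_horizontal hx (fun x h => hf _ (top_mem hy h)) fun x h => hG _ (top_mem hy h),
    integral_vertical hy (fun x h => hf _ (right_mem hx h)) fun x h => hG _ (right_mem hx h),
    integral_vertical hy (fun x h => hf _ (left_mem hx h)) fun x h => hG _ (left_mem hx h)]
  ring

lemma log_I_mul {w : ℂ} (hre : 0 < w.re) (him : w.im < 0) :
    Complex.log (Complex.I * w) = Real.pi / 2 * Complex.I + Complex.log w := by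
  have hw : w ≠ 0 := by rintro rfl; simp at hre
  rw [← Complex.log_I]
  refine (Complex.log_mul_eq_add_log_iff Complex.I_ne_zero hw).2 ?_
  have h1 : w.arg < 0 := Complex.arg_neg_iff.2 him
  have h2 := Complex.neg_pi_lt_arg w
  rw [Complex.arg_I]
  constructor <;> linarith [Real.pi_pos]

/-- On each side log(k(z - z₀)) is a primitive, with k one of i, -i, 1, -1 turning that side into
the right half-plane. -/
lemma rectIntegral_sub_inv {z₀ : ℂ} (hz : z₀ ∈ openRect x₁ x₂ y₁ y₂) :
    rectIntegral (fun z => (z - z₀)⁻¹) x₁ x₂ y₁ y₂ = 2 * Real.pi * Complex.I := by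
  obtain ⟨⟨hx1, hx2⟩, ⟨hy1, hy2⟩⟩ := hz
  have hx : x₁ ≤ x₂ := (hx1.trans hx2).le
  have hy : y₁ ≤ y₂ := (hy1.trans hy2).le
  have hcont : ∀ z ∈ closedRect x₁ x₂ y₁ y₂ \ openRect x₁ x₂ y₁ y₂,
      ContinuousAt (fun z => (z - z₀)⁻¹) z := by
    rintro z ⟨-, hz⟩
    refine ContinuousAt.inv₀ (by fun_prop) (sub_ne_zero.2 ?_)
    rintro rfl
    exact hz ⟨⟨hx1, hx2⟩, ⟨hy1, hy2⟩⟩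
  have hderiv : ∀ {k z : ℂ}, k ≠ 0 → 0 < (k * (z - z₀)).re →
      HasDerivAt (fun z => Complex.log (k * (z - z₀))) ((z - z₀)⁻¹) z := by
    intro k z hk hpos
    have h1 : HasDerivAt (fun z => k * (z - z₀)) k z := by
      simpa using ((hasDerivAt_id z).sub_const z₀).const_mul k
    refine (h1.clog (Or.inl hpos)).congr_deriv ?_
    field_simp
  have hI := Complex.I_ne_zero
  rw [rectIntegral,
    integral_horizontal hx (fun x h => hcont _ (bottom_mem hy h)) fun x _ =>
      hderiv (k := Complex.I) hI (by simpa using hy1),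
    integral_horizontal hx (fun x h => hcont _ (top_mem hy h)) fun x _ =>
      hderiv (k := -Complex.I) (neg_ne_zero.2 hI) (by simpa using hy2),
    integral_vertical hy (fun x h => hcont _ (right_mem hx h)) fun y _ =>
      hderiv (k := 1) one_ne_zero (by simpa using hx2),
    integral_vertical hy (fun x h => hcont _ (left_mem hx h)) fun y _ =>
      hderiv (k := -1) (by norm_num) (by simpa using hx1)]
  -- At each corner the two primitives differ by a quarter turn πi/2; the four corners add up to
  -- 2πi.
  have c1 := log_I_mul (w := 1 * (x₂ + y₁ * Complex.I - z₀)) (by simpa using hx2)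
    (by simpa using hy1)
  have c2 := log_I_mul (w := -Complex.I * (x₂ + y₂ * Complex.I - z₀)) (by simpa using hy2)
    (by simpa using hx2)
  have c3 := log_I_mul (w := -1 * (x₁ + y₂ * Complex.I - z₀)) (by simpa using hx1)
    (by simpa using hy2)
  have c4 := log_I_mul (w := Complex.I * (x₁ + y₁ * Complex.I - z₀)) (by simpa using hy1)
    (by simpa using hx1)
  rw [one_mul] at c1
  rw [← mul_assoc, mul_neg, Complex.I_mul_I, neg_neg, one_mul] at c2
  rw [show Complex.I * (-1 * (x₁ + y₂ * Complex.I - z₀))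
    = -Complex.I * (x₁ + y₂ * Complex.I - z₀) by ring] at c3
  rw [← mul_assoc, Complex.I_mul_I] at c4
  simp only [one_mul]
  rw [c1, c2, c3, c4]
  ring

lemma eq_of_exp_eq_of_mem_rect (h2π : y₂ - y₁ < 2 * Real.pi) {z z₀ : ℂ}
    (hz : z ∈ closedRect x₁ x₂ y₁ y₂) (hz₀ : z₀ ∈ closedRect x₁ x₂ y₁ y₂)
    (h : Complex.exp z = Complex.exp z₀) : z = z₀ := by
  obtain ⟨n, hn⟩ := Complex.exp_eq_exp_iff_exists_int.1 h
  have him : z.im = z₀.im + n * (2 * Real.pi) := by rw [hn]; simp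
  have hn0 : n = 0 := by
    have h1 := hz.2
    have h2 := hz₀.2
    rw [Set.mem_preimage, Set.mem_Icc] at h1 h2
    have h3 : |(n : ℝ) * (2 * Real.pi)| < 2 * Real.pi := by
      rw [abs_lt]; constructor <;> linarith
    rw [abs_mul, abs_of_pos Real.two_pi_pos] at h3
    have h4 : |(n : ℝ)| < 1 := by nlinarith [Real.pi_pos]
    exact Int.abs_lt_one_iff.1 (by exact_mod_cast h4)
  simpa [hn0] using hn

lemma openRect_subset_closedRect : openRect x₁ x₂ y₁ y₂ ⊆ closedRect x₁ x₂ y₁ y₂ :=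
  fun _ hz => ⟨Set.Ioo_subset_Icc_self hz.1, Set.Ioo_subset_Icc_self hz.2⟩

/-- Factor exp z - exp z₀ = (z - z₀) d(z). As the rectangle has height below 2π, d has no zero on
it, and the integrand is 1/(z - z₀) + d'/d with a holomorphic second term. -/
lemma rectIntegral_exp_sub_inv (h2π : y₂ - y₁ < 2 * Real.pi) {z₀ : ℂ}
    (hz : z₀ ∈ openRect x₁ x₂ y₁ y₂) :
    rectIntegral (fun z => (Complex.exp z - Complex.exp z₀)⁻¹ * Complex.exp z) x₁ x₂ y₁ y₂
      = 2 * Real.pi * Complex.I := by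
  have hx : x₁ ≤ x₂ := (hz.1.1.trans hz.1.2).le
  have hy : y₁ ≤ y₂ := (hz.2.1.trans hz.2.2).le
  set d := dslope Complex.exp z₀ with hd
  have hdd : Differentiable ℂ d := by
    rw [← differentiableOn_univ, hd, Complex.differentiableOn_dslope univ_mem]
    exact Complex.differentiable_exp.differentiableOn
  have hmul : ∀ z, Complex.exp z - Complex.exp z₀ = (z - z₀) * d z := fun z => by
    rw [← smul_eq_mul, hd, sub_smul_dslope]
  have hd0 : ∀ z ∈ closedRect x₁ x₂ y₁ y₂, d z ≠ 0 := by
    intro z hzr h0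
    by_cases hzz : z = z₀
    · rw [hzz, hd, dslope_same, Complex.deriv_exp] at h0
      exact Complex.exp_ne_zero _ h0
    · refine hzz (eq_of_exp_eq_of_mem_rect h2π hzr (openRect_subset_closedRect hz) ?_)
      rw [← sub_eq_zero, hmul, h0, mul_zero]
  have hderiv : ∀ z, Complex.exp z = d z + (z - z₀) * deriv d z := by
    intro z
    have h1 : HasDerivAt (fun z => Complex.exp z - Complex.exp z₀) (Complex.exp z) z :=
      (Complex.hasDerivAt_exp z).sub_const _
    have h2 : HasDerivAt (fun z => (z - z₀) * d z) (1 * d z + (z - z₀) * deriv d z) z :=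
      ((hasDerivAt_id z).sub_const z₀).mul (hdd z).hasDerivAt
    rw [funext hmul] at h1
    rw [h1.unique h2, one_mul]
  have hddd : Differentiable ℂ (deriv d) := by
    have := (hdd.differentiableOn (s := Set.univ)).deriv isOpen_univ
    exact differentiableOn_univ.1 this
  have hq : ∀ z ∈ closedRect x₁ x₂ y₁ y₂, DifferentiableAt ℂ (fun z => deriv d z / d z) z :=
    fun z hz' => (hddd z).div (hdd z) (hd0 z hz')
  rw [rectIntegral_congr hx hy (g := fun z => (z - z₀)⁻¹ + deriv d z / d z),
    rectIntegral_add hx hy, rectIntegral_sub_inv hz, rectIntegral_eq_zero hx hy, add_zero]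
  · exact fun z h1 h2 h3 h4 => hq z ⟨⟨h1, h2⟩, ⟨h3, h4⟩⟩
  · rintro z ⟨-, hz'⟩
    refine ContinuousAt.inv₀ (by fun_prop) (sub_ne_zero.2 ?_)
    rintro rfl
    exact hz' hz
  · exact fun z hz' => (hq z hz'.1).continuousAt
  · rintro z ⟨hz1, hz2⟩
    have h0 : z - z₀ ≠ 0 := sub_ne_zero.2 (by rintro rfl; exact hz2 hz)
    have h1 := hd0 z hz1
    rw [hmul, hderiv z]
    field_simp

/-- The residue theorem for an annular sector, in logarithmic coordinates. -/
theorem rectIntegral_comp_exp (hx : x₁ ≤ x₂) (hy : y₁ ≤ y₂) (h2π : y₂ - y₁ < 2 * Real.pi)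
    (S : Finset ℂ) (res : ℂ → ℂ) (h : ℂ → ℂ)
    (hS : ∀ u ∈ S, ∃ z ∈ openRect x₁ x₂ y₁ y₂, Complex.exp z = u)
    (hres : ∀ u ∈ S, HasResidue h u (res u))
    (hdiff : ∀ z ∈ closedRect x₁ x₂ y₁ y₂, Complex.exp z ∉ S →
      DifferentiableAt ℂ h (Complex.exp z)) :
    rectIntegral (fun z => h (Complex.exp z) * Complex.exp z) x₁ x₂ y₁ y₂
      = 2 * Real.pi * Complex.I * ∑ u ∈ S, res u := by
  classical
  induction S using Finset.induction_on generalizing h with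
  | empty =>
    rw [Finset.sum_empty, mul_zero]
    refine rectIntegral_eq_zero hx hy fun z h1 h2 h3 h4 => ?_
    exact ((hdiff z ⟨⟨h1, h2⟩, ⟨h3, h4⟩⟩ (by simp)).comp z
      Complex.differentiable_exp.differentiableAt).mul Complex.differentiable_exp.differentiableAt
  | insert u₀ S hu₀ ih =>
    obtain ⟨z₀, hz₀, hexp⟩ := hS u₀ (Finset.mem_insert_self _ _)
    obtain ⟨Q, φ, hQ, hφ, heq⟩ := hres u₀ (Finset.mem_insert_self _ _)
    set c := res u₀ with hc
    -- Remove the singular part at u₀ and fill in the value that makes the remainder holomorphic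
    -- there, so that the induction hypothesis applies with one singularity fewer.
    set h' : ℂ → ℂ := Function.update (fun u => h u - (c * (u - u₀)⁻¹ + deriv Q u)) u₀ (φ u₀)
      with hh'
    have hφ' : h' =ᶠ[𝓝 u₀] φ := by
      rw [eventually_nhdsWithin_iff] at heq
      filter_upwards [heq] with u hu
      by_cases huu : u = u₀
      · rw [huu, hh', Function.update_self]
      · rw [hh', Function.update_of_ne huu, hu huu]
        ring
    have hne_eq : ∀ u, u ≠ u₀ → h' =ᶠ[𝓝 u] fun u => h u - (c * (u - u₀)⁻¹ + deriv Q u) := by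
      intro u hu
      filter_upwards [isOpen_ne.eventually_mem hu] with v hv
      rw [hh', Function.update_of_ne hv]
    have hpol : ∀ u, u ≠ u₀ → AnalyticAt ℂ (fun u => c * (u - u₀)⁻¹ + deriv Q u) u := by
      intro u hu
      have h1 : AnalyticAt ℂ (fun u => c * (u - u₀)⁻¹) u :=
        analyticAt_const.mul (AnalyticAt.inv (by fun_prop) (sub_ne_zero.2 hu))
      exact h1.add (analyticAt_deriv_of_ne hQ hu)
    have hrec := ih h' (fun u hu => hS u (Finset.mem_insert_of_mem hu)) ?_ ?_
    · have hbd : ∀ z ∈ closedRect x₁ x₂ y₁ y₂ \ openRect x₁ x₂ y₁ y₂,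
          Complex.exp z ∉ insert u₀ S := by
        rintro z ⟨hz1, hz2⟩ hmem
        obtain ⟨z', hz', hz'e⟩ := hS _ hmem
        exact hz2 (eq_of_exp_eq_of_mem_rect h2π hz1 (openRect_subset_closedRect hz') hz'e.symm ▸ hz')
      have hbd₀ : ∀ z ∈ closedRect x₁ x₂ y₁ y₂ \ openRect x₁ x₂ y₁ y₂, Complex.exp z ≠ u₀ :=
        fun z hz he => hbd z hz (he ▸ Finset.mem_insert_self _ _)
      have c1 : ∀ z ∈ closedRect x₁ x₂ y₁ y₂ \ openRect x₁ x₂ y₁ y₂,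
          ContinuousAt (fun z => h' (Complex.exp z) * Complex.exp z) z := by
        intro z hz
        refine ContinuousAt.mul ?_ (by fun_prop)
        refine ContinuousAt.comp (g := h') (f := Complex.exp) (x := z) ?_
          Complex.continuous_exp.continuousAt
        rw [continuousAt_congr (hne_eq _ (hbd₀ z hz))]
        exact (hdiff z hz.1 (hbd z hz)).continuousAt.sub (hpol _ (hbd₀ z hz)).continuousAt
      have c2 : ∀ z ∈ closedRect x₁ x₂ y₁ y₂ \ openRect x₁ x₂ y₁ y₂,
          ContinuousAt (fun z => c * ((Complex.exp z - u₀)⁻¹ * Complex.exp z)) z := by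
        intro z hz
        refine continuousAt_const.mul (ContinuousAt.mul ?_ (by fun_prop))
        exact ContinuousAt.inv₀ (by fun_prop) (sub_ne_zero.2 (hbd₀ z hz))
      have c3 : ∀ z ∈ closedRect x₁ x₂ y₁ y₂ \ openRect x₁ x₂ y₁ y₂,
          ContinuousAt (fun z => deriv Q (Complex.exp z) * Complex.exp z) z := by
        intro z hz
        refine ContinuousAt.mul ?_ (by fun_prop)
        exact ContinuousAt.comp (f := Complex.exp)
          (analyticAt_deriv_of_ne hQ (hbd₀ z hz)).continuousAt Complex.continuous_exp.continuousAt
      have c4 : ∀ z ∈ closedRect x₁ x₂ y₁ y₂ \ openRect x₁ x₂ y₁ y₂,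
          ContinuousAt (fun z => c * ((Complex.exp z - u₀)⁻¹ * Complex.exp z)
            + deriv Q (Complex.exp z) * Complex.exp z) z :=
        fun z hz => (c2 z hz).add (c3 z hz)
      have hQ0 : rectIntegral (fun z => deriv Q (Complex.exp z) * Complex.exp z) x₁ x₂ y₁ y₂ = 0 :=
        rectIntegral_eq_zero_of_hasDerivAt hx hy (G := fun z => Q (Complex.exp z)) c3
          fun z hz => (hQ _ (hbd₀ z hz)).hasDerivAt.comp z (Complex.hasDerivAt_exp z)
      have hz0 := rectIntegral_exp_sub_inv h2π hz₀
      rw [hexp] at hz0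
      rw [rectIntegral_congr hx hy (g := fun z => h' (Complex.exp z) * Complex.exp z
          + (c * ((Complex.exp z - u₀)⁻¹ * Complex.exp z)
            + deriv Q (Complex.exp z) * Complex.exp z)),
        rectIntegral_add hx hy c1 c4,
        rectIntegral_add hx hy c2 c3, hQ0, rectIntegral_const_mul, hz0, hrec,
        Finset.sum_insert hu₀]
      · ring
      · intro z hz
        rw [hh', Function.update_of_ne (hbd₀ z hz)]
        ring
    · intro u hu
      have hne : u ≠ u₀ := by rintro rfl; exact hu₀ hu
      refine (hres u (Finset.mem_insert_of_mem hu)).add_analytic ⟨_, (hpol u hne).neg, ?_⟩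
      filter_upwards [nhdsWithin_le_nhds (hne_eq u hne)] with v hv
      rw [hv]
      rfl
    · intro z hz hzS
      by_cases huu : Complex.exp z = u₀
      · rw [huu]
        exact (hφ.differentiableAt).congr_of_eventuallyEq hφ'
      · refine DifferentiableAt.congr_of_eventuallyEq ?_ (hne_eq _ huu)
        refine (hdiff z hz ?_).sub (hpol _ huu).differentiableAt
        simp [huu, hzS]

end Rect

/-! ### The residue sum as a contour integral -/

lemma not_regular_arg {δ : Param N} (hδ : δ ∈ goodDomain N) {u : ℂ} (hu : u ∈ poles δ) :
    ¬ Regular δ u.arg := fun h => by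
  have := notMem_poles_of_regular hδ h ‖u‖
  rw [Complex.norm_mul_exp_arg_mul_I] at this
  exact this hu

lemma logIntegrand_eq {δ : Param N} {s z : ℂ} (h1 : -Real.pi < z.im) (h2 : z.im ≤ Real.pi) :
    logIntegrand δ s z
      = (fun u => F δ u * u ^ (s - 1)) (Complex.exp z) * Complex.exp z := by
  simp only [logIntegrand]
  rw [Complex.cpow_def_of_ne_zero (Complex.exp_ne_zero z), Complex.log_exp h1 h2, mul_assoc,
    ← Complex.exp_add]
  congr 2
  ring

lemma exp_mem_slitPlane {z : ℂ} (h1 : -Real.pi < z.im) (h2 : z.im < Real.pi) :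
    Complex.exp z ∈ Complex.slitPlane := by
  rw [Complex.mem_slitPlane_iff_arg, Complex.arg_exp, (toIocMod_eq_self _).2]
  · exact ⟨h2.ne, Complex.exp_ne_zero z⟩
  · exact ⟨h1, by linarith⟩

/-- Regular edges, a good outer radius and a pole-free inner disc keep poles off the boundary of the
annular sector. The bounds on the angles keep it off the cut of the principal power. -/
lemma sum_residue_eq {δ : Param N} (hδ : δ ∈ goodDomain N) {y₁ y₂ : ℝ} (hy : y₁ ≤ y₂)
    (hy₁ : -Real.pi < y₁) (hy₂ : y₂ < Real.pi) (h₁ : Regular δ y₁) (h₂ : Regular δ y₂)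
    {r R η : ℝ} (hr : PoleFree δ r) (hrR : r ≤ R) (hη : 0 < η) (hR : R ∈ goodRadii δ η) (s : ℂ) :
    2 * Real.pi * Complex.I * ∑ᶠ u₀ ∈ {u | (u ∈ poles δ ∧ y₁ < u.arg ∧ u.arg < y₂) ∧ ‖u‖ < R},
        residue (fun u => F δ u * u ^ (s - 1)) u₀
      = sectorIntegral δ s R y₁ y₂ - sectorIntegral δ s r y₁ y₂ := by
  have hR0 : 0 < R := hr.1.trans_le hrR
  have hfin : {u | (u ∈ poles δ ∧ y₁ < u.arg ∧ u.arg < y₂) ∧ ‖u‖ < R}.Finite :=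
    (finite_poles hδ R).subset fun u hu => ⟨hu.1.1, hu.2⟩
  have hslit : ∀ u ∈ {u | (u ∈ poles δ ∧ y₁ < u.arg ∧ u.arg < y₂) ∧ ‖u‖ < R},
      u ∈ Complex.slitPlane := fun u hu =>
    Complex.mem_slitPlane_iff_arg.2 ⟨(hu.1.2.2.trans hy₂).ne, hu.1.1.1⟩
  have hxx := Real.log_le_log hr.1 hrR
  have hcongr := rectIntegral_congr hxx hy
    (g := fun z => (fun u => F δ u * u ^ (s - 1)) (Complex.exp z) * Complex.exp z) fun z hz =>
      logIntegrand_eq (s := s) (δ := δ) (hy₁.trans_le hz.1.2.1) (hz.1.2.2.trans hy₂.le)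
  rw [finsum_mem_eq_finite_toFinset_sum _ hfin, ← rectIntegral_logIntegrand hδ h₁ h₂ hr.1 hrR s,
    hcongr]
  symm
  apply rectIntegral_comp_exp hxx hy (by linarith [Real.pi_pos]) hfin.toFinset
    (residue fun u => F δ u * u ^ (s - 1)) (fun u => F δ u * u ^ (s - 1))
  · intro u hu
    rw [Set.Finite.mem_toFinset] at hu
    refine ⟨Complex.log u, ⟨⟨?_, ?_⟩, ?_, ?_⟩, Complex.exp_log hu.1.1.1⟩
    · rw [Complex.log_re]
      exact Real.log_lt_log hr.1 (hr.2 u hu.1.1)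
    · rw [Complex.log_re]
      exact Real.log_lt_log (norm_pos_iff.2 hu.1.1.1) hu.2
    · rw [Complex.log_im]
      exact hu.1.2.1
    · rw [Complex.log_im]
      exact hu.1.2.2
  · intro u hu
    rw [Set.Finite.mem_toFinset] at hu
    obtain ⟨c, hc⟩ := exists_hasResidue (h := fun u => F δ u * u ^ (s - 1)) (u₀ := u) <| by
      refine (meromorphicAt_F δ u).mul (AnalyticAt.meromorphicAt ?_)
      exact analyticAt_id.cpow analyticAt_const (hslit u hu)
    rwa [hc.residue_eq]
  · intro z hz hzS
    have hz1 : -Real.pi < z.im := hy₁.trans_le hz.2.1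
    have hz2 : z.im < Real.pi := hz.2.2.trans_lt hy₂
    have hnp : Complex.exp z ∉ poles δ := by
      intro hp
      have harg : (Complex.exp z).arg = z.im := by
        rw [Complex.arg_exp, (toIocMod_eq_self _).2]
        exact ⟨hz1, by linarith⟩
      refine hzS ((Set.Finite.mem_toFinset _).2 ⟨⟨hp, ?_, ?_⟩, ?_⟩)
      · rw [harg]
        refine lt_of_le_of_ne hz.2.1 fun heq => exp_notMem_poles hδ (heq ▸ h₁) hp
      · rw [harg]
        refine lt_of_le_of_ne hz.2.2 fun heq => exp_notMem_poles hδ (heq ▸ h₂) hp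
      · refine lt_of_le_of_ne ?_ fun heq => ?_
        · rw [Complex.norm_exp]
          exact (Real.le_log_iff_exp_le hR0).1 hz.1.2
        · have := hR _ hp
          rw [heq, sub_self, abs_zero] at this
          linarith
    refine (differentiableAt_F (Complex.exp_ne_zero z) hnp).mul ?_
    exact differentiableAt_id.cpow (differentiableAt_const _) (exp_mem_slitPlane hz1 hz2)

/-- `η` is so small that there are no poles with arguments just below `0` and `ψ`. -/
structure SmallAngle (δ : Param N) (ψ η : ℝ) : Prop where
  pos : 0 < η
  lt_pi : η < Real.pi
  lt_pi_add : η < Real.pi + ψ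
  lt_abs : ψ ≠ 0 → η < |ψ|
  regular_zero : ∀ y ∈ Set.Ioo (-η) 0, Regular δ y
  regular : ∀ y ∈ Set.Ioo (ψ - η) ψ, Regular δ y

lemma exists_smallAngle {δ : Param N} (hδ : δ ∈ DtildeCstar N) {ψ : ℝ} (hψ : -Real.pi < ψ) :
    ∃ η, SmallAngle δ ψ η := by
  obtain ⟨η₁, h₁, H₁⟩ := exists_regular_Ioo hδ 0
  obtain ⟨η₂, h₂, H₂⟩ := exists_regular_Ioo hδ ψ
  obtain ⟨c, hc, hcψ⟩ : ∃ c > 0, ψ ≠ 0 → c < |ψ| := by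
    by_cases h : ψ = 0
    · exact ⟨1, one_pos, fun h' => absurd h h'⟩
    · exact ⟨|ψ| / 2, by positivity, fun _ => half_lt_self (abs_pos.2 h)⟩
  set η := min (min η₁ η₂) (min (min (Real.pi / 2) ((Real.pi + ψ) / 2)) c) with hη
  have e1 : η ≤ η₁ := (min_le_left _ _).trans (min_le_left _ _)
  have e2 : η ≤ η₂ := (min_le_left _ _).trans (min_le_right _ _)
  have e3 : η ≤ Real.pi / 2 := (min_le_right _ _).trans ((min_le_left _ _).trans (min_le_left _ _))
  have e4 : η ≤ (Real.pi + ψ) / 2 :=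
    (min_le_right _ _).trans ((min_le_left _ _).trans (min_le_right _ _))
  have e5 : η ≤ c := (min_le_right _ _).trans (min_le_right _ _)
  have hπ := Real.pi_pos
  refine ⟨η, ?_, by linarith, by linarith, fun h => e5.trans_lt (hcψ h),
    fun y hy => H₁ y ⟨by linarith [hy.1], hy.2⟩, fun y hy => H₂ y ⟨by linarith [hy.1], hy.2⟩⟩
  refine lt_min (lt_min h₁ h₂) (lt_min (lt_min (by linarith) ?_) hc)
  linarith

/-- No pole has its argument in (-η, 0) or (ψ - η, ψ). So the half-open sector can be turned by ω
into an open one without gaining or losing poles. -/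
lemma sectorPoles_of_pos {δ : Param N} (hδ : δ ∈ goodDomain N) {ψ η ω : ℝ}
    (h : SmallAngle δ ψ η) (hω : ω ∈ Set.Ioo (-η) 0) (hψ : 0 < ψ) (u : ℂ) :
    u ∈ sectorPoles ψ δ ↔ u ∈ poles δ ∧ ω < u.arg ∧ u.arg < ω + ψ := by
  refine and_congr_right fun hu => ?_
  have hr := not_regular_arg hδ hu
  have h0 : ¬ (-η < u.arg ∧ u.arg < 0) := fun h' => hr (h.regular_zero _ h')
  have h1 : ¬ (ψ - η < u.arg ∧ u.arg < ψ) := fun h' => hr (h.regular _ h')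
  push Not at h0 h1
  have hω1 := hω.1
  have hω2 := hω.2
  constructor
  · rintro (⟨-, h2, h3⟩ | ⟨h2, -⟩)
    · refine ⟨by linarith, ?_⟩
      by_contra hcon
      exact absurd h3 (not_lt.2 (h1 (by linarith)))
    · linarith
  · rintro ⟨h2, h3⟩
    exact Or.inl ⟨hψ, h0 (by linarith), by linarith⟩

lemma sectorPoles_of_neg {δ : Param N} (hδ : δ ∈ goodDomain N) {ψ η ω : ℝ}
    (h : SmallAngle δ ψ η) (hω : ω ∈ Set.Ioo (-η) 0) (hψ : ψ < 0) (u : ℂ) :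
    u ∈ sectorPoles ψ δ ↔ u ∈ poles δ ∧ ω + ψ < u.arg ∧ u.arg < ω := by
  refine and_congr_right fun hu => ?_
  have hr := not_regular_arg hδ hu
  have h0 : ¬ (-η < u.arg ∧ u.arg < 0) := fun h' => hr (h.regular_zero _ h')
  have h1 : ¬ (ψ - η < u.arg ∧ u.arg < ψ) := fun h' => hr (h.regular _ h')
  push Not at h0 h1
  have hω1 := hω.1
  have hω2 := hω.2
  constructor
  · rintro (⟨h2, -⟩ | ⟨-, h2, h3⟩)
    · linarith
    · refine ⟨by linarith, ?_⟩
      by_contra hcon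
      exact absurd h3 (not_lt.2 (h0 (by linarith)))
  · rintro ⟨h2, h3⟩
    exact Or.inr ⟨hψ, h1 (by linarith), by linarith⟩

lemma SmallAngle.regular_add {δ : Param N} {ψ η ω : ℝ} (h : SmallAngle δ ψ η)
    (hω : ω ∈ Set.Ioo (-η) 0) : Regular δ (ω + ψ) :=
  h.regular _ ⟨by linarith [hω.1], by linarith [hω.2]⟩

/-- The residue theorem writes the partial sum as S_r - S_R, and S_R tends to 0. For ψ < 0 the
sector is traversed backwards, which accounts for the sign in ρ. As ω < 0, the angle ω + ψ stays
below π even for ψ = π. -/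
lemma tendsto_rhoPartial {δ : Param N} (hδ : δ ∈ DtildeCstar N) {ψ η ω r : ℝ}
    (hψ : ψ ≤ Real.pi) (h : SmallAngle δ ψ η) (hω : ω ∈ Set.Ioo (-η) 0) (hr : PoleFree δ r)
    {s : ℂ} (hs : s.re < 1) {κ : ℝ} (hκ : 0 < κ) :
    Tendsto (rhoPartial ψ δ s) (atTop ⊓ 𝓟 (goodRadii δ κ))
      (𝓝 (sectorIntegral δ s r ω (ω + ψ))) := by
  have hreg₁ := h.regular_zero ω hω
  have hreg₂ := h.regular_add hω
  have hω1 := hω.1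
  have hω2 := hω.2
  have hev : ∀ᶠ R in atTop ⊓ 𝓟 (goodRadii δ κ), r ≤ R ∧ R ∈ goodRadii δ κ := by
    rw [eventually_inf_principal]
    filter_upwards [eventually_ge_atTop r] with R hR hg using ⟨hR, hg⟩
  rcases lt_trichotomy 0 ψ with hp | hp | hp
  · have hlim := (tendsto_sectorIntegral hδ.1 hreg₁ hreg₂ s inf_le_left
      (tendsto_arcIntegral_goodRadii hδ ω (ω + ψ) hκ hs)).const_sub
      (sectorIntegral δ s r ω (ω + ψ))
    rw [sub_zero] at hlim
    refine hlim.congr' ?_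
    filter_upwards [hev] with R hR
    have hsum := sum_residue_eq hδ.1 (y₁ := ω) (y₂ := ω + ψ) (by linarith)
      (by linarith [h.lt_pi]) (by linarith) hreg₁ hreg₂ hr hR.1 hκ hR.2 s
    rw [rhoPartial, Real.sign_of_neg (neg_lt_zero.2 hp)]
    simp only [sectorPoles_of_pos hδ.1 h hω hp]
    push_cast
    linear_combination hsum
  · subst hp
    rw [add_zero, sectorIntegral_self]
    refine tendsto_const_nhds.congr fun R => ?_
    simp [rhoPartial]
  · have hflip : sectorIntegral δ s r ω (ω + ψ) = 0 - sectorIntegral δ s r (ω + ψ) ω := by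
      rw [← sectorIntegral_self δ s r ω, ← sectorIntegral_add hr.circleFree s ω (ω + ψ) ω]
      ring
    rw [hflip]
    refine ((tendsto_sectorIntegral hδ.1 hreg₂ hreg₁ s inf_le_left
      (tendsto_arcIntegral_goodRadii hδ (ω + ψ) ω hκ hs)).sub_const _).congr' ?_
    filter_upwards [hev] with R hR
    have hsum := sum_residue_eq hδ.1 (y₁ := ω + ψ) (y₂ := ω) (by linarith)
      (by linarith [h.lt_pi_add]) (by linarith [Real.pi_pos]) hreg₂ hreg₁ hr hR.1 hκ hR.2 s
    rw [rhoPartial, Real.sign_of_pos (neg_pos.2 hp)]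
    simp only [sectorPoles_of_neg hδ.1 h hω hp]
    push_cast
    linear_combination -hsum

lemma isRho_sectorIntegral {δ : Param N} (hδ : δ ∈ DtildeCstar N) {ψ η ω r : ℝ}
    (hψ : ψ ≤ Real.pi) (h : SmallAngle δ ψ η) (hω : ω ∈ Set.Ioo (-η) 0) (hr : PoleFree δ r) :
    IsRho ψ δ fun s => sectorIntegral δ s r ω (ω + ψ) where
  meromorphic := fun s _ => AnalyticAt.meromorphicNFAt
    ((differentiable_sectorIntegral hδ.1 hr.circleFree (h.regular_zero ω hω)
      (h.regular_add hω)).analyticAt s)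
  series := fun _ hs _ hκ => tendsto_rhoPartial hδ hψ h hω hr hs hκ

/-- Limits along unbounded good radii are unique, so two continuations agree for Re s < 1 and then,
as meromorphic functions, everywhere. The normal form makes this equality hold at every point. -/
lemma IsRho.unique {δ : Param N} (hδ : δ ∈ goodDomain N) {ψ : ℝ} {f g : ℂ → ℂ}
    (hf : IsRho ψ δ f) (hg : IsRho ψ δ g) : f = g := by
  obtain ⟨η, hη, hne⟩ := exists_goodRadii_unbounded hδ
  have heq : ∀ s : ℂ, s.re < 1 → f s = g s := fun s hs =>
    tendsto_nhds_unique (hf.series s hs η hη) (hg.series s hs η hη)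
  have hm : MeromorphicOn (fun s => f s - g s) Set.univ := fun s hs =>
    (hf.meromorphic hs).meromorphicAt.sub (hg.meromorphic hs).meromorphicAt
  have hopen : IsOpen {s : ℂ | s.re < 1} := isOpen_lt Complex.continuous_re continuous_const
  have htop : meromorphicOrderAt (fun s => f s - g s) 0 = ⊤ := by
    rw [meromorphicOrderAt_eq_top_iff]
    refine nhdsWithin_le_nhds ?_
    filter_upwards [hopen.eventually_mem (show (0 : ℂ).re < 1 by simp)] with s hs
    exact sub_eq_zero.2 (heq s hs)
  have hall : ∀ s, meromorphicOrderAt (fun s => f s - g s) s = ⊤ := by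
    intro s
    by_contra hs
    exact hm.meromorphicOrderAt_ne_top_of_isPreconnected isPreconnected_univ
      (Set.mem_univ s) (Set.mem_univ 0) hs htop
  funext s
  have h1 : f =ᶠ[𝓝[≠] s] g := by
    filter_upwards [meromorphicOrderAt_eq_top_iff.1 (hall s)] with z hz
    exact sub_eq_zero.1 hz
  exact ((MeromorphicNFAt.eventuallyEq_nhdsNE_iff_eventuallyEq_nhds
    (hf.meromorphic (Set.mem_univ s)) (hg.meromorphic (Set.mem_univ s))).1 h1).eq_of_nhds

lemma rho_eq {δ : Param N} (hδ : δ ∈ goodDomain N) {ψ : ℝ} {f : ℂ → ℂ} (hf : IsRho ψ δ f) :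
    rho ψ δ = f :=
  (Classical.epsilon_spec (p := IsRho ψ δ) ⟨f, hf⟩).unique hδ hf

/-! ### The Hankel integral -/

lemma M_mem_goodDomain {δ : Param N} (hδ : δ ∈ goodDomain N) {β : ℂ} (hβ : β ≠ 0) :
    M β δ ∈ goodDomain N := fun ℓ h => hδ ℓ ((mul_eq_zero.1 h).resolve_left hβ)

lemma PoleFree.of_M {δ : Param N} {β : ℂ} (hβ : ‖β‖ = 1) {r : ℝ} (h : PoleFree (M β δ) r) :
    PoleFree δ r := by
  have hβ0 : β ≠ 0 := by rintro rfl; simp at hβ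
  refine ⟨h.1, fun u ⟨h0, ℓ, hu⟩ => ?_⟩
  have hmem : β⁻¹ * u ∈ poles (M β δ) := by
    refine ⟨mul_ne_zero (inv_ne_zero hβ0) h0, ℓ, ?_⟩
    simp only [M]
    rwa [show -(β⁻¹ * u) * (β * δ.a ℓ) = -u * δ.a ℓ by field_simp]
  simpa [hβ] using h.2 _ hmem

lemma exp_add_two_pi (y : ℝ) :
    Complex.exp ((y + 2 * Real.pi : ℝ) * Complex.I) = Complex.exp (y * Complex.I) := by
  rw [show ((y + 2 * Real.pi : ℝ) : ℂ) * Complex.I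
    = y * Complex.I + 2 * Real.pi * Complex.I by push_cast; ring]
  exact Complex.exp_periodic _

lemma Regular.add_two_pi {δ : Param N} {y : ℝ} (h : Regular δ y) :
    Regular δ (y + 2 * Real.pi) := by
  simpa only [Regular, growth, exp_add_two_pi] using h

/-- The thin sector between the two starting rays contributes 0, and so does its translate by a full
turn. Then only the radius is left to change, inside a pole-free disc. -/
lemma sectorIntegral_hankel_congr {δ : Param N} (hδ : δ ∈ goodDomain N) {η ω ω' r r' : ℝ}
    (hreg : ∀ y ∈ Set.Ioo (-η) 0, Regular δ y) (hω : ω ∈ Set.Ioo (-η) 0)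
    (hω' : ω' ∈ Set.Ioo (-η) 0) (hr : PoleFree δ r) (hr' : PoleFree δ r') (s : ℂ) :
    sectorIntegral δ s r ω (ω + 2 * Real.pi) = sectorIntegral δ s r' ω' (ω' + 2 * Real.pi) := by
  wlog hle : ω ≤ ω' generalizing ω ω' r r'
  · exact (this hω' hω hr' hr (le_of_not_ge hle)).symm
  have hzero : sectorIntegral δ s r ω ω' = 0 :=
    sectorIntegral_eq_zero hδ hle (fun y hy => hreg y ⟨hω.1.trans_le hy.1, hy.2.trans_lt hω'.2⟩)
      hr.1 s
  have h1 := sectorIntegral_add hr.circleFree s ω ω' (ω' + 2 * Real.pi)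
  have h2 := sectorIntegral_add hr.circleFree s ω (ω + 2 * Real.pi) (ω' + 2 * Real.pi)
  rw [sectorIntegral_shift_two_pi, hzero, mul_zero, add_zero] at h2
  rw [hzero, zero_add] at h1
  rw [h2, ← h1]
  exact sectorIntegral_congr_radius hδ (by linarith [Real.pi_pos]) (hreg _ hω')
    (hreg _ hω').add_two_pi hr hr' s

/-- Moving the Hankel contour by the symmetry `u ↦ e^{iψ} u`. -/
lemma hankel_functional_equation {δ : Param N} {ψ : ℝ} {k : ℂ}
    (hF : ∀ u, F δ (Complex.exp (ψ * Complex.I) * u) = k * F δ u) {r : ℝ} (hr : CircleFree δ r)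
    (ω : ℝ) (s : ℂ) :
    (k * Complex.exp (s * (ψ * Complex.I)) - 1) * sectorIntegral δ s r ω (ω + 2 * Real.pi)
      = (e s - 1) * sectorIntegral δ s r ω (ω + ψ) := by
  have h1 := sectorIntegral_shift hF s r ω (ω + 2 * Real.pi)
  have h2 := sectorIntegral_shift_two_pi δ s r ω (ω + ψ)
  -- The sector from ω to ω + ψ + 2π is cut at ω + ψ here and at ω + 2π in the next line.
  have h3 := sectorIntegral_add hr s ω (ω + ψ) (ω + ψ + 2 * Real.pi)
  have h4 := sectorIntegral_add hr s ω (ω + 2 * Real.pi) (ω + ψ + 2 * Real.pi)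
  rw [show ω + 2 * Real.pi + ψ = ω + ψ + 2 * Real.pi by ring] at h1
  linear_combination -h1 + h2 + h3 - h4

lemma e_intCast (k : ℤ) : e k = 1 := e_eq_one_iff.2 ⟨k, rfl⟩

lemma logIntegrand_add_two_pi (δ : Param N) (k : ℤ) (z : ℂ) :
    logIntegrand δ k (z + 2 * Real.pi * Complex.I) = logIntegrand δ k z := by
  rw [logIntegrand, logIntegrand, Complex.exp_periodic, mul_add, Complex.exp_add (k * z),
    Complex.exp_int_mul_two_pi_mul_I, mul_one]

/-- For an integer exponent the integrand is single-valued, so the two rays cancel. -/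
lemma sectorIntegral_intCast (δ : Param N) (k : ℤ) (r ω : ℝ) :
    sectorIntegral δ k r ω (ω + 2 * Real.pi) = arcIntegral δ k r ω (ω + 2 * Real.pi) := by
  have h : rayIntegral δ k r (ω + 2 * Real.pi) = rayIntegral δ k r ω := by
    rw [rayIntegral_shift (k := 1)]
    · push_cast
      rw [Complex.exp_int_mul_two_pi_mul_I, one_mul, one_mul]
    · intro u
      push_cast
      rw [Complex.exp_two_pi_mul_I, one_mul, one_mul]
  rw [sectorIntegral, h]
  ring

lemma arcIntegral_intCast_congr {δ : Param N} {r r' : ℝ} (hr : PoleFree δ r) (hr' : 0 < r')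
    (hle : r' ≤ r) (k : ℤ) (ω : ℝ) :
    arcIntegral δ k r' ω (ω + 2 * Real.pi) = arcIntegral δ k r ω (ω + 2 * Real.pi) := by
  have h := rectIntegral_eq_zero (f := logIntegrand δ k) (Real.log_le_log hr' hle)
    (show ω ≤ ω + 2 * Real.pi by linarith [Real.pi_pos]) fun z _ hz _ _ => by
      refine differentiableAt_logIntegrand _ fun hp => ?_
      have := hr.2 _ hp
      rw [Complex.norm_exp] at this
      exact absurd ((Real.le_log_iff_exp_le hr.1).1 hz) (not_le.2 this)
  have hper : ∀ x : ℝ, logIntegrand δ k (x + (ω + 2 * Real.pi : ℝ) * Complex.I)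
      = logIntegrand δ k (x + ω * Complex.I) := fun x => by
    rw [← logIntegrand_add_two_pi δ k (x + ω * Complex.I)]
    congr 1
    push_cast
    ring
  simp only [rectIntegral, hper, sub_self, zero_add] at h
  exact (sub_eq_zero.1 h).symm

/-- F has a pole of order at most N at 0, so F(u) u^{k-1} is bounded near 0 for k > N and the
integral over a shrinking circle tends to 0. It is independent of the circle. -/
lemma hankel_eq_zero_of_lt {δ : Param N} (hδ : δ ∈ goodDomain N) {r : ℝ} (hr : PoleFree δ r)
    {k : ℤ} (hk : (N : ℤ) + 1 ≤ k) (ω : ℝ) :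
    sectorIntegral δ k r ω (ω + 2 * Real.pi) = 0 := by
  rw [sectorIntegral_intCast]
  obtain ⟨l, hl⟩ := exists_tendsto_pow_mul_F hδ
  have hbound : ∀ᶠ u in 𝓝[≠] (0 : ℂ), ‖u ^ N * F δ u‖ < ‖l‖ + 1 :=
    hl.norm.eventually (gt_mem_nhds (lt_add_one _))
  rw [eventually_nhdsWithin_iff] at hbound
  obtain ⟨ε, hε, hball⟩ := Metric.eventually_nhds_iff_ball.1 hbound
  have hlim : Tendsto (fun r' : ℝ => (‖l‖ + 1) * |2 * Real.pi| * r') (𝓝[>] 0) (𝓝 0) := by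
    have : Continuous fun r' : ℝ => (‖l‖ + 1) * |2 * Real.pi| * r' := by fun_prop
    simpa using (this.tendsto 0).mono_left nhdsWithin_le_nhds
  have hlim2 : Tendsto (fun r' : ℝ => arcIntegral δ k r' ω (ω + 2 * Real.pi)) (𝓝[>] 0) (𝓝 0) := by
    refine squeeze_zero_norm' ?_ hlim
    filter_upwards [self_mem_nhdsWithin, nhdsWithin_le_nhds (gt_mem_nhds hε),
      nhdsWithin_le_nhds (gt_mem_nhds one_pos)] with r' h0 h1 h2
    have h0' : 0 < r' := h0
    rw [arcIntegral, norm_mul, Complex.norm_I, one_mul]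
    refine (intervalIntegral.norm_integral_le_of_norm_le_const (C := (‖l‖ + 1) * r')
      fun y _ => ?_).trans (le_of_eq (by rw [add_sub_cancel_left]; ring))
    have hn : ‖Complex.exp (Real.log r' + y * Complex.I)‖ = r' := by
      rw [norm_exp_add, Real.exp_log h0']
    have hb := hball (Complex.exp (Real.log r' + y * Complex.I))
      (by rwa [mem_ball_zero_iff, hn]) (Complex.exp_ne_zero _)
    rw [norm_mul, norm_pow, hn] at hb
    rw [logIntegrand, norm_mul, Complex.exp_int_mul, norm_zpow, hn]
    have hpow : r' ^ k ≤ r' ^ N * r' := by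
      have : r' ^ k ≤ r' ^ ((N : ℤ) + 1) := zpow_le_zpow_right_of_le_one₀ h0' h2.le hk
      rwa [zpow_add₀ h0'.ne', zpow_natCast, zpow_one] at this
    calc ‖F δ (Complex.exp (Real.log r' + y * Complex.I))‖ * r' ^ k
        ≤ ‖F δ (Complex.exp (Real.log r' + y * Complex.I))‖ * (r' ^ N * r') := by gcongr
      _ = (r' ^ N * ‖F δ (Complex.exp (Real.log r' + y * Complex.I))‖) * r' := by ring
      _ ≤ (‖l‖ + 1) * r' := by gcongr
  refine tendsto_nhds_unique (tendsto_const_nhds.congr' ?_) hlim2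
  filter_upwards [self_mem_nhdsWithin, nhdsWithin_le_nhds (gt_mem_nhds hr.1)] with r' h0 h1
  exact (arcIntegral_intCast_congr hr h0 h1.le k ω).symm

/-! ### Local behaviour at the integers -/

lemma analyticAt_dslope {g : ℂ → ℂ} {z : ℂ} (hg : AnalyticAt ℂ g z) :
    AnalyticAt ℂ (dslope g z) z := by
  obtain ⟨p, hp⟩ := hg
  exact ⟨_, hp.has_fpower_series_dslope_fslope⟩

lemma hasDerivAt_e (s : ℂ) : HasDerivAt e (2 * Real.pi * Complex.I * e s) s := by
  have h := ((hasDerivAt_id s).const_mul (2 * Real.pi * Complex.I)).cexp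
  refine h.congr_deriv ?_
  simp only [e, id]
  ring

lemma differentiable_e : Differentiable ℂ e := fun s => (hasDerivAt_e s).differentiableAt

lemma eventually_e_ne_one (s : ℂ) : ∀ᶠ z in 𝓝[≠] s, e z ≠ 1 := by
  have ha : AnalyticAt ℂ (fun z => e z - 1) s :=
    (differentiable_e.sub_const 1).analyticAt s
  rcases ha.eventually_eq_zero_or_eventually_ne_zero with h | h
  · exfalso
    have hd : HasDerivAt (fun z => e z - 1) (2 * Real.pi * Complex.I * e s) s :=
      (hasDerivAt_e s).sub_const 1
    have h0 := hd.unique ((hasDerivAt_const s (0 : ℂ)).congr_of_eventuallyEq h)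
    exact mul_ne_zero Complex.two_pi_I_ne_zero (e_ne_zero s) h0
  · filter_upwards [h] with z hz h1
    exact hz (by rw [h1, sub_self])

lemma Gamma_ne_zero_of_e_ne_one {s : ℂ} (h : e s ≠ 1) : Complex.Gamma s ≠ 0 :=
  Complex.Gamma_ne_zero fun m hm => h (e_eq_one_iff.2 ⟨-m, by push_cast; exact hm⟩)

/-- The quotient `H(s) / (Γ(s) (e(s) - 1))`. -/
def gammaQuot (H : ℂ → ℂ) (s : ℂ) : ℂ := (Complex.Gamma s)⁻¹ * H s / (e s - 1)

lemma inv_Gamma_eq_zero (n : ℕ) : (Complex.Gamma (-(n : ℂ)))⁻¹ = 0 := by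
  rw [Complex.Gamma_neg_nat_eq_zero, inv_zero]

/-- Dividing g(z) = g(s) + (z - s) g₁(z) by e(z) - 1 = (z - s) d(z), with d(s) = 2πi, isolates the
simple pole. -/
lemma gammaQuot_eventuallyEq {g : ℂ → ℂ} {s : ℂ} (hs : e s = 1) :
    ∀ᶠ z in 𝓝[≠] s, g z / (e z - 1)
      = g s / ((z - s) * dslope (fun z => e z - 1) s z)
        + dslope g s z / dslope (fun z => e z - 1) s z := by
  filter_upwards [eventually_e_ne_one s, self_mem_nhdsWithin] with z hz hne
  have h0 : z - s ≠ 0 := sub_ne_zero.2 hne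
  have h1 := sub_smul_dslope (fun z => e z - 1) s z
  have h2 := sub_smul_dslope g s z
  simp only [smul_eq_mul, hs, sub_self, sub_zero] at h1 h2
  have h3 : e z - 1 ≠ 0 := sub_ne_zero.2 hz
  have h4 : dslope (fun z => e z - 1) s z ≠ 0 := by
    intro h4
    rw [h4, mul_zero] at h1
    exact h3 h1.symm
  rw [← h1, show g z = (z - s) * dslope g s z + g s by rw [h2]; ring]
  field_simp
  ring

lemma dslope_e_sub_one {s : ℂ} (hs : e s = 1) :
    dslope (fun z => e z - 1) s s = 2 * Real.pi * Complex.I := by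
  rw [dslope_same, ((hasDerivAt_e s).sub_const 1).deriv, hs, mul_one]

lemma analyticAt_dslope_e (s : ℂ) : AnalyticAt ℂ (dslope (fun z => e z - 1) s) s :=
  analyticAt_dslope ((differentiable_e.sub_const 1).analyticAt s)

lemma differentiable_inv_Gamma : Differentiable ℂ fun s => (Complex.Gamma s)⁻¹ :=
  Complex.differentiable_one_div_Gamma

/-- `gammaQuot H` extends holomorphically to `s` under the stated vanishing condition. -/
lemma exists_analyticAt_gammaQuot {H : ℂ → ℂ} (hH : Differentiable ℂ H) {s : ℂ}
    (hs : e s = 1 → (Complex.Gamma s)⁻¹ * H s = 0) :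
    ∃ f : ℂ → ℂ, AnalyticAt ℂ f s ∧ gammaQuot H =ᶠ[𝓝[≠] s] f := by
  have hN : Differentiable ℂ fun s => (Complex.Gamma s)⁻¹ * H s := differentiable_inv_Gamma.mul hH
  by_cases h : e s = 1
  · refine ⟨fun z => dslope (fun s => (Complex.Gamma s)⁻¹ * H s) s z
      / dslope (fun z => e z - 1) s z,
      (analyticAt_dslope (hN.analyticAt s)).div (analyticAt_dslope_e s) ?_, ?_⟩
    · rw [dslope_e_sub_one h]
      exact Complex.two_pi_I_ne_zero
    · filter_upwards [gammaQuot_eventuallyEq (g := fun s => (Complex.Gamma s)⁻¹ * H s) h] with z hz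
      rw [gammaQuot, hz, hs h, zero_div, zero_add]
  · refine ⟨gammaQuot H, ?_, EventuallyEq.rfl⟩
    exact (hN.analyticAt s).div ((differentiable_e.sub_const 1).analyticAt s) (sub_ne_zero.2 h)

lemma meromorphicAt_gammaQuot {H : ℂ → ℂ} (hH : Differentiable ℂ H) (s : ℂ) :
    MeromorphicAt (gammaQuot H) s :=
  ((differentiable_inv_Gamma.mul hH).analyticAt s).meromorphicAt.div
    ((differentiable_e.sub_const 1).analyticAt s).meromorphicAt

lemma hasResidue_gammaQuot {H : ℂ → ℂ} (hH : Differentiable ℂ H) {s : ℂ} (hs : e s = 1) :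
    HasResidue (gammaQuot H) s ((Complex.Gamma s)⁻¹ * H s / (2 * Real.pi * Complex.I)) := by
  have hN : Differentiable ℂ fun s => (Complex.Gamma s)⁻¹ * H s := differentiable_inv_Gamma.mul hH
  have hd := analyticAt_dslope_e s
  have hd0 : dslope (fun z => e z - 1) s s ≠ 0 := by
    rw [dslope_e_sub_one hs]
    exact Complex.two_pi_I_ne_zero
  set q : ℂ → ℂ := fun z => ((Complex.Gamma s)⁻¹ * H s) / dslope (fun z => e z - 1) s z with hq
  have hqa : AnalyticAt ℂ q s := analyticAt_const.div hd hd0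
  refine ⟨0, fun z => dslope q s z + dslope (fun s => (Complex.Gamma s)⁻¹ * H s) s z
      / dslope (fun z => e z - 1) s z, fun _ _ => differentiableAt_const _,
    (analyticAt_dslope hqa).add ((analyticAt_dslope (hN.analyticAt s)).div hd hd0), ?_⟩
  filter_upwards [gammaQuot_eventuallyEq (g := fun s => (Complex.Gamma s)⁻¹ * H s) hs,
    self_mem_nhdsWithin] with z hz hne
  have h0 : z - s ≠ 0 := sub_ne_zero.2 hne
  have h2 := sub_smul_dslope q s z
  rw [smul_eq_mul] at h2
  have h3 : dslope q s z = (z - s)⁻¹ * (q z - q s) := by rw [← h2, inv_mul_cancel_left₀ h0]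
  have hqs : q s = (Complex.Gamma s)⁻¹ * H s / (2 * Real.pi * Complex.I) := by
    simp only [hq, dslope_e_sub_one hs]
  rw [gammaQuot, hz, h3, ← hqs, deriv_zero]
  simp only [hq, Pi.zero_apply]
  rw [div_mul_eq_div_div_swap]
  ring

lemma hasResidue_of_analyticAt {f : ℂ → ℂ} {s : ℂ} (hf : AnalyticAt ℂ f s) : HasResidue f s 0 :=
  ⟨0, f, fun _ _ => differentiableAt_const _, hf, by simp⟩

lemma HasResidue.congr {f g : ℂ → ℂ} {s c : ℂ} (hf : HasResidue f s c) (h : g =ᶠ[𝓝[≠] s] f) :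
    HasResidue g s c :=
  hf.add_analytic ⟨0, analyticAt_const, by
    filter_upwards [h] with z hz
    simp [hz]⟩

/-- Induction through 1/Γ(s) = s/Γ(s + 1); in the product rule the term with 1/Γ(s + 1)
undifferentiated vanishes at the new point. -/
lemma hasDerivAt_inv_Gamma_neg (n : ℕ) :
    HasDerivAt (fun s => (Complex.Gamma s)⁻¹) ((-1) ^ n * n.factorial) (-(n : ℂ)) := by
  induction n with
  | zero =>
    have h : (fun s => (Complex.Gamma s)⁻¹) = fun s => s * (Complex.Gamma (s + 1))⁻¹ :=
      funext Complex.one_div_Gamma_eq_self_mul_one_div_Gamma_add_one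
    have h1 : HasDerivAt (fun s => (Complex.Gamma (s + 1))⁻¹)
        (deriv (fun s => (Complex.Gamma s)⁻¹) (0 + 1)) 0 :=
      (differentiable_inv_Gamma (0 + 1)).hasDerivAt.comp_add_const 0 1
    rw [h]
    have h2 := (hasDerivAt_id (0 : ℂ)).mul h1
    simp only [Nat.cast_zero, neg_zero]
    refine h2.congr_deriv ?_
    simp [Complex.Gamma_one]
  | succ n ih =>
    have h : (fun s => (Complex.Gamma s)⁻¹) = fun s => s * (Complex.Gamma (s + 1))⁻¹ :=
      funext Complex.one_div_Gamma_eq_self_mul_one_div_Gamma_add_one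
    have hn : -((n + 1 : ℕ) : ℂ) + 1 = -(n : ℂ) := by push_cast; ring
    have h1 : HasDerivAt (fun s => (Complex.Gamma (s + 1))⁻¹) ((-1) ^ n * n.factorial)
        (-((n + 1 : ℕ) : ℂ)) := by
      refine HasDerivAt.comp_add_const (f := fun s => (Complex.Gamma s)⁻¹) _ 1 ?_
      rw [hn]
      exact ih
    rw [h]
    refine ((hasDerivAt_id (-((n + 1 : ℕ) : ℂ))).mul h1).congr_deriv ?_
    simp only [id, hn, inv_Gamma_eq_zero, mul_zero, zero_add]
    rw [pow_succ, Nat.factorial_succ]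
    push_cast
    ring

lemma tendsto_sub_mul_Gamma (n : ℕ) :
    Tendsto (fun z => (z - -(n : ℂ)) * Complex.Gamma z) (𝓝[≠] (-(n : ℂ)))
      (𝓝 ((-1) ^ n / n.factorial)) := by
  have h := (hasDerivAt_iff_tendsto_slope.1 (hasDerivAt_inv_Gamma_neg n)).inv₀
    (mul_ne_zero (pow_ne_zero _ (by norm_num)) (by exact_mod_cast n.factorial_ne_zero))
  have hval : ((-1 : ℂ) ^ n * n.factorial)⁻¹ = (-1) ^ n / n.factorial := by
    rw [mul_inv, ← inv_pow, inv_neg, inv_one, div_eq_mul_inv]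
  rw [hval] at h
  refine h.congr fun z => ?_
  rw [slope_def_field, inv_Gamma_eq_zero, sub_zero, inv_div, div_inv_eq_mul]

section Values

variable {H K L : ℂ → ℂ} {c b : ℂ}

/-- The relation between `L = H / (Γ (e - 1))` and `K`, off the exceptional points. -/
lemma eventually_eq_gamma_mul (hfe : ∀ s, (c * Complex.exp (s * b) - 1) * H s = (e s - 1) * K s)
    (hL : ∀ s, e s ≠ 1 → L s = gammaQuot H s) (s : ℂ) :
    ∀ᶠ z in 𝓝[≠] s, K z = Complex.Gamma z * (c * Complex.exp (z * b) - 1) * L z := by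
  filter_upwards [eventually_e_ne_one s] with z hz
  have h1 := Gamma_ne_zero_of_e_ne_one hz
  have h2 : e z - 1 ≠ 0 := sub_ne_zero.2 hz
  rw [hL z hz, gammaQuot]
  field_simp
  linear_combination -hfe z

lemma hasDerivAt_mul_exp (c b s : ℂ) :
    HasDerivAt (fun s => c * Complex.exp (s * b) - 1) (c * Complex.exp (s * b) * b) s := by
  have h := ((((hasDerivAt_id s).mul_const b).cexp).const_mul c).sub_const 1
  refine h.congr_deriv ?_
  simp only [id, one_mul]
  ring

lemma tendsto_slope_mul_exp {s : ℂ} (h1 : c * Complex.exp (s * b) = 1) :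
    Tendsto (fun z => (c * Complex.exp (z * b) - 1) / (z - s)) (𝓝[≠] s) (𝓝 b) := by
  have h := hasDerivAt_iff_tendsto_slope.1 (hasDerivAt_mul_exp c b s)
  rw [h1, one_mul] at h
  refine h.congr fun z => ?_
  rw [slope_def_field, h1, sub_self, sub_zero]

lemma continuous_mul_exp (c b : ℂ) : Continuous fun s => c * Complex.exp (s * b) - 1 := by
  fun_prop

/-- The simple pole of Γ meets the zero of c exp(sb) - 1, whose derivative there is b. -/
lemma value_nonpos_of_eq_one {n : ℕ} (hK : Continuous K)
    (heq : ∀ᶠ z in 𝓝[≠] (-(n : ℂ)), K z = Complex.Gamma z * (c * Complex.exp (z * b) - 1) * L z)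
    (hL : ContinuousAt L (-(n : ℂ))) (h1 : c * Complex.exp (-(n : ℂ) * b) = 1) :
    K (-(n : ℂ)) = (-1) ^ n / n.factorial * b * L (-(n : ℂ)) := by
  have h := ((tendsto_sub_mul_Gamma n).mul (tendsto_slope_mul_exp h1)).mul
    (hL.tendsto.mono_left nhdsWithin_le_nhds)
  refine tendsto_nhds_unique ((hK.tendsto _).mono_left nhdsWithin_le_nhds) (h.congr' ?_)
  filter_upwards [heq, self_mem_nhdsWithin] with z hz hne
  have h0 : z - -(n : ℂ) ≠ 0 := sub_ne_zero.2 hne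
  rw [hz]
  field_simp

lemma value_nonpos_of_ne_one {n : ℕ} (hK : Continuous K)
    (heq : ∀ᶠ z in 𝓝[≠] (-(n : ℂ)), K z = Complex.Gamma z * (c * Complex.exp (z * b) - 1) * L z)
    (hL : DifferentiableAt ℂ L (-(n : ℂ))) (h1 : c * Complex.exp (-(n : ℂ) * b) ≠ 1) :
    L (-(n : ℂ)) = 0 ∧ K (-(n : ℂ)) = (-1) ^ n / n.factorial
      * (c * Complex.exp (-(n : ℂ) * b) - 1) * deriv L (-(n : ℂ)) := by
  have hKt := (hK.tendsto (-(n : ℂ))).mono_left (nhdsWithin_le_nhds (s := {-(n : ℂ)}ᶜ))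
  have hJt := ((continuous_mul_exp c b).tendsto (-(n : ℂ))).mono_left
    (nhdsWithin_le_nhds (s := {-(n : ℂ)}ᶜ))
  have hLt := hL.continuousAt.tendsto.mono_left (nhdsWithin_le_nhds (s := {-(n : ℂ)}ᶜ))
  -- In K/Γ = (c exp(sb) - 1) L the left side vanishes at -n, while the factor in front of L does
  -- not.
  have hzero : L (-(n : ℂ)) = 0 := by
    have hG := (differentiable_inv_Gamma.continuous.tendsto (-(n : ℂ))).mono_left
      (nhdsWithin_le_nhds (s := {-(n : ℂ)}ᶜ))
    have e1 := hG.mul hKt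
    have e2 := hJt.mul hLt
    have h3 := tendsto_nhds_unique (e2.congr' ?_) e1
    · rw [inv_Gamma_eq_zero, zero_mul] at h3
      exact (mul_eq_zero.1 h3).resolve_left (sub_ne_zero.2 h1)
    · filter_upwards [heq, eventually_e_ne_one (-(n : ℂ))] with z hz hz1
      have := Gamma_ne_zero_of_e_ne_one hz1
      rw [hz]
      field_simp
  refine ⟨hzero, ?_⟩
  have h := ((tendsto_sub_mul_Gamma n).mul hJt).mul
    (hasDerivAt_iff_tendsto_slope.1 hL.hasDerivAt)
  refine tendsto_nhds_unique hKt (h.congr' ?_)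
  filter_upwards [heq, self_mem_nhdsWithin] with z hz hne
  have h0 : z - -(n : ℂ) ≠ 0 := sub_ne_zero.2 hne
  rw [hz, slope_def_field, hzero, sub_zero]
  field_simp

/-- Both factors in the functional equation vanish at s; dividing by z - s compares their
derivatives b and 2πi. -/
lemma value_of_eq_one (hK : Continuous K) (hH : Continuous H)
    (hfe : ∀ s, (c * Complex.exp (s * b) - 1) * H s = (e s - 1) * K s) {s : ℂ} (hs : e s = 1)
    (h1 : c * Complex.exp (s * b) = 1) : 2 * Real.pi * Complex.I * K s = b * H s := by
  have hKt := (hK.tendsto s).mono_left (nhdsWithin_le_nhds (s := {s}ᶜ))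
  have hHt := (hH.tendsto s).mono_left (nhdsWithin_le_nhds (s := {s}ᶜ))
  have he := hasDerivAt_iff_tendsto_slope.1 (hasDerivAt_e s)
  rw [hs, mul_one] at he
  refine tendsto_nhds_unique (he.mul hKt) (((tendsto_slope_mul_exp h1).mul hHt).congr fun z => ?_)
  rw [slope_def_field, hs, div_mul_eq_mul_div, div_mul_eq_mul_div, hfe]

lemma hasDerivAt_of_eq_one {s : ℂ}
    (heq : ∀ᶠ z in 𝓝 s, K z = Complex.Gamma z * (c * Complex.exp (z * b) - 1) * L z)
    (hL : DifferentiableAt ℂ L s) (hG : DifferentiableAt ℂ Complex.Gamma s)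
    (h1 : c * Complex.exp (s * b) = 1) :
    HasDerivAt K (Complex.Gamma s * b * L s) s := by
  have h := (hG.hasDerivAt.mul (hasDerivAt_mul_exp c b s)).mul hL.hasDerivAt
  refine (h.congr_of_eventuallyEq heq).congr_deriv ?_
  simp only [Pi.mul_apply, h1, sub_self]
  ring

lemma eventually_nhds_of_nhdsNE {f g : ℂ → ℂ} {s : ℂ} (hf : ContinuousAt f s)
    (hg : ContinuousAt g s) (h : ∀ᶠ z in 𝓝[≠] s, f z = g z) : ∀ᶠ z in 𝓝 s, f z = g z := by
  have h0 : f s = g s := tendsto_nhds_unique (hf.tendsto.mono_left nhdsWithin_le_nhds)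
    ((hg.tendsto.mono_left nhdsWithin_le_nhds).congr' (EventuallyEq.symm h))
  rw [eventually_nhdsWithin_iff] at h
  filter_upwards [h] with z hz
  by_cases hzs : z = s
  · rw [hzs, h0]
  · exact hz hzs

end Values

/-! ### The function `ℒ_N` -/

lemma norm_exp_I_mul_ofReal (ω : ℝ) : ‖Complex.exp (Complex.I * ω)‖ = 1 := by
  rw [mul_comm, Complex.norm_exp_ofReal_mul_I]

section LN

variable {ε : Param N → ℝ} {δ : Param N} {η r₀ ω₀ : ℝ}

/-- Whatever radius `ε` selects for the rotated triple, ω enters only through the exponential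
factor. -/
lemma hankelQuot_eq (hε : Admissible ε) (hδ : δ ∈ goodDomain N)
    (hreg : ∀ y ∈ Set.Ioo (-η) 0, Regular δ y) (hω₀ : ω₀ ∈ Set.Ioo (-η) 0) (hr₀ : PoleFree δ r₀)
    {ω : ℝ} (hω : ω ∈ Set.Ioo (-η) 0) (s : ℂ) :
    hankelQuot (ε (M (Complex.exp (Complex.I * ω)) δ)) (M (Complex.exp (Complex.I * ω)) δ) s
      = Complex.exp (-(s * (ω * Complex.I)))
        * gammaQuot (fun s => sectorIntegral δ s r₀ ω₀ (ω₀ + 2 * Real.pi)) s := by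
  have hp : PoleFree δ (ε (M (Complex.exp (Complex.I * ω)) δ)) :=
    (hε.poleFree (M_mem_goodDomain hδ (Complex.exp_ne_zero _))).of_M (norm_exp_I_mul_ofReal ω)
  rw [hankelQuot, hankel_eq hp.1, sectorIntegral_hankel_congr hδ hreg hω hω₀ hp hr₀, gammaQuot,
    one_div, mul_inv, div_eq_mul_inv]
  ring

/-- All limits in the definition of `ℒ_N(s, δ)` exist where the quotient extends holomorphically. -/
lemma LN_spec (hε : Admissible ε) (hδ : δ ∈ goodDomain N)
    (hreg : ∀ y ∈ Set.Ioo (-η) 0, Regular δ y) (hω₀ : ω₀ ∈ Set.Ioo (-η) 0) (hr₀ : PoleFree δ r₀)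
    {s : ℂ} {f : ℂ → ℂ} (hf : AnalyticAt ℂ f s)
    (heq : gammaQuot (fun s => sectorIntegral δ s r₀ ω₀ (ω₀ + 2 * Real.pi)) =ᶠ[𝓝[≠] s] f) :
    (∀ᶠ ω : ℝ in 𝓝[<] 0, Tendsto
      (hankelQuot (ε (M (Complex.exp (Complex.I * ω)) δ)) (M (Complex.exp (Complex.I * ω)) δ))
      (𝓝[≠] s) (𝓝 (Leps ε s (M (Complex.exp (Complex.I * ω)) δ)))) ∧
    Tendsto (fun ω : ℝ => Leps ε s (M (Complex.exp (Complex.I * ω)) δ))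
      (𝓝[<] 0) (𝓝 (LN ε δ s)) ∧ LN ε δ s = f s := by
  have hη : 0 < η := by linarith [hω₀.1, hω₀.2]
  have hmem : ∀ᶠ ω : ℝ in 𝓝[<] 0, ω ∈ Set.Ioo (-η) 0 := Ioo_mem_nhdsLT (by linarith)
  have hlim : ∀ ω ∈ Set.Ioo (-η) 0, Tendsto
      (hankelQuot (ε (M (Complex.exp (Complex.I * ω)) δ)) (M (Complex.exp (Complex.I * ω)) δ))
      (𝓝[≠] s) (𝓝 (Complex.exp (-(s * (ω * Complex.I))) * f s)) := by
    intro ω hω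
    have hc : ContinuousAt (fun z => Complex.exp (-(z * (ω * Complex.I))) * f z) s :=
      ContinuousAt.mul (by fun_prop) hf.continuousAt
    refine (hc.tendsto.mono_left nhdsWithin_le_nhds).congr' ?_
    filter_upwards [heq] with z hz
    rw [hankelQuot_eq hε hδ hreg hω₀ hr₀ hω, hz]
  have hLeps : ∀ ω ∈ Set.Ioo (-η) 0, Leps ε s (M (Complex.exp (Complex.I * ω)) δ)
      = Complex.exp (-(s * (ω * Complex.I))) * f s := fun ω hω => (hlim ω hω).limUnder_eq
  have hT : Tendsto (fun ω : ℝ => Leps ε s (M (Complex.exp (Complex.I * ω)) δ))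
      (𝓝[<] 0) (𝓝 (f s)) := by
    have hc : Continuous fun ω : ℝ => Complex.exp (-(s * (ω * Complex.I))) * f s := by fun_prop
    have h0 := hc.tendsto 0
    simp only [Complex.ofReal_zero, zero_mul, mul_zero, neg_zero, Complex.exp_zero, one_mul] at h0
    refine (h0.mono_left nhdsWithin_le_nhds).congr' ?_
    filter_upwards [hmem] with ω hω
    exact (hLeps ω hω).symm
  have hLN : LN ε δ s = f s := hT.limUnder_eq
  refine ⟨?_, hLN ▸ hT, hLN⟩
  filter_upwards [hmem] with ω hω
  rw [hLeps ω hω]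
  exact hlim ω hω

end LN

lemma cpow_eq_exp {α : ℂ} (hα : α ≠ 0) (s : ℂ) : α ^ s = Complex.exp (s * Complex.log α) := by
  rw [Complex.cpow_def_of_ne_zero hα, mul_comm]

lemma inv_J (Λ : Finset (Fin N)) (σ : Equiv.Perm (Fin N)) {α : ℂ} (hα : α ≠ 0) (θ : Fin N → ℝ)
    (s : ℂ) : (J Λ σ α θ s)⁻¹
      = ((-1) ^ Λ.card * e (∑ ℓ ∈ Λ.image (σ⁻¹ : Equiv.Perm (Fin N)), (θ ℓ : ℂ)))⁻¹
        * Complex.exp (s * Complex.log α) := by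
  rw [J, mul_inv, Complex.cpow_neg, inv_inv, cpow_eq_exp hα]

lemma log_eq_of_norm_eq_one {α : ℂ} (h : ‖α‖ = 1) : Complex.log α = α.arg * Complex.I := by
  rw [Complex.log, h, Real.log_one, Complex.ofReal_zero, zero_add]

end Barnes

end

/-! ### The symmetry relation between ρ and ℒ_N and its values at integers -/

theorem corollary2 (N : ℕ) (hN : 0 < N) (ε : Barnes.Param N → ℝ) (hε : Barnes.Admissible ε)
    (Λ : Finset (Fin N)) (σ : Equiv.Perm (Fin N)) (α : ℂ) (hα : α ≠ 0)
    (δ : Barnes.Param N) (hδ : δ ∈ Barnes.DtildeCstar N)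
    (hfix : Barnes.T Λ (Barnes.R σ (Barnes.M α δ)) = δ) :
    -- the limits that define `ℒ_N` exist, and `ℒ_N` is meromorphic, holomorphic off `P_N`
    (∀ s ∉ Barnes.P N,
      (∀ᶠ ω : ℝ in 𝓝[<] 0,
        Tendsto
          (Barnes.hankelQuot (ε (Barnes.M (Complex.exp (Complex.I * ω)) δ))
            (Barnes.M (Complex.exp (Complex.I * ω)) δ))
          (𝓝[≠] s) (𝓝 (Barnes.Leps ε s (Barnes.M (Complex.exp (Complex.I * ω)) δ)))) ∧
      Tendsto (fun ω : ℝ => Barnes.Leps ε s (Barnes.M (Complex.exp (Complex.I * ω)) δ))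
        (𝓝[<] 0) (𝓝 (Barnes.LN ε δ s))) ∧
    MeromorphicOn (Barnes.LN ε δ) Set.univ ∧
    (∀ s ∉ Barnes.P N, AnalyticAt ℂ (Barnes.LN ε δ) s) ∧
    -- `ρ_N^ψ` exists, and it is holomorphic off `P_N`
    Barnes.IsRho α.arg δ (Barnes.rho α.arg δ) ∧
    (∀ s ∉ Barnes.P N, AnalyticAt ℂ (Barnes.rho α.arg δ) s) ∧
    -- the formula on `ℂ ∖ P_N`; at the poles of `Γ` its right-hand side is read as a limit
    (∀ s ∉ Barnes.P N, (∀ n : ℕ, s ≠ -(n : ℂ)) →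
      Barnes.rho α.arg δ s =
        Complex.Gamma s * ((Barnes.J Λ σ α δ.θ s)⁻¹ - 1) * Barnes.LN ε δ s) ∧
    (∀ s ∉ Barnes.P N,
      Tendsto
        (fun z => Complex.Gamma z * ((Barnes.J Λ σ α δ.θ z)⁻¹ - 1) * Barnes.LN ε δ z)
        (𝓝[≠] s) (𝓝 (Barnes.rho α.arg δ s))) ∧
    -- the values at integers
    (∀ k : ℤ,
      (k ≤ 0 → Barnes.J Λ σ α δ.θ k = 1 →
        Barnes.rho α.arg δ k =
          (-1) ^ k / ((-k).toNat.factorial : ℂ) * Complex.log α * Barnes.LN ε δ k) ∧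
      (k ≤ 0 → Barnes.J Λ σ α δ.θ k ≠ 1 →
        Barnes.LN ε δ k = 0 ∧
        Barnes.rho α.arg δ k =
          (-1) ^ k / ((-k).toNat.factorial : ℂ) * ((Barnes.J Λ σ α δ.θ k)⁻¹ - 1)
            * deriv (Barnes.LN ε δ) k) ∧
      (1 ≤ k → k ≤ N → Barnes.J Λ σ α δ.θ k = 1 →
        AnalyticAt ℂ (Barnes.rho α.arg δ) k ∧
        Barnes.rho α.arg δ k =
          ((k - 1).toNat.factorial : ℂ) * Complex.log α
            * Barnes.residue (Barnes.LN ε δ) k) ∧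
      (1 ≤ k → k ≤ N → Barnes.J Λ σ α δ.θ k ≠ 1 →
        Barnes.residue (Barnes.rho α.arg δ) k =
          ((k - 1).toNat.factorial : ℂ) * ((Barnes.J Λ σ α δ.θ k)⁻¹ - 1)
            * Barnes.residue (Barnes.LN ε δ) k) ∧
      ((N : ℤ) + 1 ≤ k → Barnes.J Λ σ α δ.θ k = 1 →
        Barnes.rho α.arg δ k = 0 ∧
        deriv (Barnes.rho α.arg δ) k =
          ((k - 1).toNat.factorial : ℂ) * Complex.log α * Barnes.LN ε δ k) ∧
      ((N : ℤ) + 1 ≤ k → Barnes.J Λ σ α δ.θ k ≠ 1 →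
        Barnes.rho α.arg δ k =
          ((k - 1).toNat.factorial : ℂ) * ((Barnes.J Λ σ α δ.θ k)⁻¹ - 1)
            * Barnes.LN ε δ k)) := by
  -- With this constant, J(s)⁻¹ = c exp(s log α), and c is also the factor by which u ↦ αu acts on
  -- F.
  set c : ℂ := ((-1) ^ Λ.card
    * Barnes.e (∑ ℓ ∈ Λ.image (σ⁻¹ : Equiv.Perm (Fin N)), (δ.θ ℓ : ℂ)))⁻¹ with hc
  have hc0 : (-1 : ℂ) ^ Λ.card
      * Barnes.e (∑ ℓ ∈ Λ.image (σ⁻¹ : Equiv.Perm (Fin N)), (δ.θ ℓ : ℂ)) ≠ 0 :=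
    mul_ne_zero (pow_ne_zero _ (by norm_num)) (Barnes.e_ne_zero _)
  have hnorm := Barnes.norm_eq_one_of_fixed hδ hfix
  have hlog := Barnes.log_eq_of_norm_eq_one hnorm
  have hαexp : Complex.exp (α.arg * Complex.I) = α := by rw [← hlog, Complex.exp_log hα]
  have hF : ∀ u, Barnes.F δ (Complex.exp (α.arg * Complex.I) * u) = c * Barnes.F δ u := by
    intro u
    rw [hαexp, Barnes.F_comp_mul hfix u, hc, inv_mul_cancel_left₀ hc0]
  obtain ⟨η, hη⟩ := Barnes.exists_smallAngle hδ (Complex.neg_pi_lt_arg α)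
  obtain ⟨ω, hω⟩ : (Set.Ioo (-η) 0).Nonempty := Set.nonempty_Ioo.2 (by linarith [hη.pos])
  set r := ε δ with hr
  have hpf : Barnes.PoleFree δ r := hε.poleFree hδ.1
  have hreg := hη.regular_zero
  set H : ℂ → ℂ := fun s => Barnes.sectorIntegral δ s r ω (ω + 2 * Real.pi) with hHdef
  set K : ℂ → ℂ := fun s => Barnes.sectorIntegral δ s r ω (ω + α.arg) with hKdef
  have hH : Differentiable ℂ H := Barnes.differentiable_sectorIntegral hδ.1 hpf.circleFree
    (hreg ω hω) (hreg ω hω).add_two_pi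
  have hK : Differentiable ℂ K := Barnes.differentiable_sectorIntegral hδ.1 hpf.circleFree
    (hreg ω hω) (hη.regular_add hω)
  have hfe : ∀ s, (c * Complex.exp (s * Complex.log α) - 1) * H s = (Barnes.e s - 1) * K s := by
    intro s
    rw [hlog]
    exact Barnes.hankel_functional_equation hF hpf.circleFree ω s
  have hIsRho : Barnes.IsRho α.arg δ K :=
    Barnes.isRho_sectorIntegral hδ (Complex.arg_le_pi α) hη hω hpf
  have hrho : Barnes.rho α.arg δ = K := Barnes.rho_eq hδ.1 hIsRho
  have hJ : ∀ s, (Barnes.J Λ σ α δ.θ s)⁻¹ = c * Complex.exp (s * Complex.log α) :=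
    fun s => Barnes.inv_J Λ σ hα δ.θ s
  have hJ1 : ∀ s, Barnes.J Λ σ α δ.θ s = 1 ↔ c * Complex.exp (s * Complex.log α) = 1 := fun s => by
    rw [← hJ, inv_eq_one]
  -- At the integers outside P_N the numerator of the quotient cancels the zero of e - 1: through
  -- 1/Γ for k ≤ 0 and through the Hankel integral for k > N.
  have hvanish : ∀ s ∉ Barnes.P N, Barnes.e s = 1 → (Complex.Gamma s)⁻¹ * H s = 0 := by
    intro s hs he
    obtain ⟨k, rfl⟩ := Barnes.e_eq_one_iff.1 he
    rcases le_or_gt k 0 with hk | hk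
    · obtain ⟨n, rfl⟩ : ∃ n : ℕ, k = -(n : ℤ) := ⟨(-k).toNat, by omega⟩
      push_cast
      rw [Barnes.inv_Gamma_eq_zero, zero_mul]
    · have hkN : (N : ℤ) + 1 ≤ k := by
        by_contra hcon
        refine hs ⟨k.toNat, by omega, by omega, ?_⟩
        rw [← Int.cast_natCast, Int.toNat_of_nonneg hk.le]
      rw [show H k = 0 from Barnes.hankel_eq_zero_of_lt hδ.1 hpf hkN ω, mul_zero]
  have hspec : ∀ s ∉ Barnes.P N, ∃ f : ℂ → ℂ, AnalyticAt ℂ f s ∧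
      Barnes.gammaQuot H =ᶠ[𝓝[≠] s] f := fun s hs =>
    Barnes.exists_analyticAt_gammaQuot hH (hvanish s hs)
  have hLN : ∀ s, Barnes.e s ≠ 1 → Barnes.LN ε δ s = Barnes.gammaQuot H s := by
    intro s hs
    have ha : AnalyticAt ℂ (Barnes.gammaQuot H) s :=
      ((Barnes.differentiable_inv_Gamma.mul hH).analyticAt s).div
        ((Barnes.differentiable_e.sub_const 1).analyticAt s) (sub_ne_zero.2 hs)
    exact (Barnes.LN_spec hε hδ.1 hreg hω hpf ha EventuallyEq.rfl).2.2
  have hLNe : ∀ s, Barnes.LN ε δ =ᶠ[𝓝[≠] s] Barnes.gammaQuot H := fun s => by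
    filter_upwards [Barnes.eventually_e_ne_one s] with z hz using hLN z hz
  have hLNa : ∀ s ∉ Barnes.P N, AnalyticAt ℂ (Barnes.LN ε δ) s := by
    intro s hs
    obtain ⟨f, hf, heq⟩ := hspec s hs
    have h0 := (Barnes.LN_spec hε hδ.1 hreg hω hpf hf heq).2.2
    refine hf.congr ?_
    have h1 := ((hLNe s).trans heq).symm
    rw [EventuallyEq, eventually_nhdsWithin_iff] at h1
    filter_upwards [h1] with z hz
    by_cases hzs : z = s
    · rw [hzs, h0]
    · exact hz hzs
  have hKeq := Barnes.eventually_eq_gamma_mul hfe hLN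
  have hGd : ∀ s : ℂ, (∀ n : ℕ, s ≠ -(n : ℂ)) → DifferentiableAt ℂ Complex.Gamma s :=
    fun s hs => Complex.differentiableAt_Gamma s hs
  have hKnhds : ∀ s ∉ Barnes.P N, (∀ n : ℕ, s ≠ -(n : ℂ)) → ∀ᶠ z in 𝓝 s,
      K z = Complex.Gamma z * (c * Complex.exp (z * Complex.log α) - 1) * Barnes.LN ε δ z := by
    intro s hs hn
    refine Barnes.eventually_nhds_of_nhdsNE hK.continuous.continuousAt ?_ (hKeq s)
    exact ((hGd s hn).continuousAt.mul (Barnes.continuous_mul_exp _ _).continuousAt).mul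
      (hLNa s hs).continuousAt
  have hGpos : ∀ k : ℤ, 1 ≤ k → Complex.Gamma k = ((k - 1).toNat.factorial : ℂ) := by
    intro k hk
    rw [← Complex.Gamma_nat_eq_factorial]
    congr 1
    rw [← Int.cast_natCast, Int.toNat_of_nonneg (by omega)]
    push_cast
    ring
  have hne_neg : ∀ k : ℤ, 1 ≤ k → ∀ n : ℕ, (k : ℂ) ≠ -(n : ℂ) := by
    intro k hk n h
    have : k = -(n : ℤ) := by exact_mod_cast h
    omega
  have hnotP : ∀ k : ℤ, k ≤ 0 ∨ (N : ℤ) + 1 ≤ k → (k : ℂ) ∉ Barnes.P N := by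
    rintro k hk ⟨m, hm1, hm2, hm⟩
    have : k = (m : ℤ) := by exact_mod_cast hm
    omega
  have hneg : ∀ k : ℤ, k ≤ 0 → (k : ℂ) = -((-k).toNat : ℂ) := by
    intro k hk
    rw [← Int.cast_natCast, Int.toNat_of_nonneg (by omega)]
    push_cast
    ring
  have hpow : ∀ k : ℤ, k ≤ 0 → (-1 : ℂ) ^ k = (-1) ^ (-k).toNat := by
    intro k hk
    rw [← zpow_natCast, Int.toNat_of_nonneg (by omega), zpow_neg, ← inv_zpow, inv_neg, inv_one]
  simp only [hrho, hJ, ne_eq, hJ1]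
  refine ⟨fun s hs => ?_, fun s _ => ?_, hLNa, hIsRho, fun s _ => hK.analyticAt s,
    fun s hs hn => (hKnhds s hs hn).self_of_nhds, fun s hs => ?_, fun k => ⟨?_, ?_, ?_, ?_, ?_, ?_⟩⟩
  · obtain ⟨f, hf, heq⟩ := hspec s hs
    have h := Barnes.LN_spec hε hδ.1 hreg hω hpf hf heq
    exact ⟨h.1, h.2.1⟩
  · exact (Barnes.meromorphicAt_gammaQuot hH s).congr (hLNe s).symm
  · exact ((hK.continuous.tendsto s).mono_left nhdsWithin_le_nhds).congr' (hKeq s)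
  · intro hk h1
    have hL := (hLNa k (hnotP k (Or.inl hk))).continuousAt
    rw [hpow k hk]
    rw [hneg k hk] at h1 hL ⊢
    exact Barnes.value_nonpos_of_eq_one hK.continuous (hKeq _) hL h1
  · intro hk h1
    have hL := (hLNa k (hnotP k (Or.inl hk))).differentiableAt
    rw [hpow k hk]
    rw [hneg k hk] at h1 hL ⊢
    exact Barnes.value_nonpos_of_ne_one hK.continuous (hKeq _) hL h1
  · intro hk _ h1
    refine ⟨hK.analyticAt k, ?_⟩
    have hres := ((Barnes.hasResidue_gammaQuot hH (Barnes.e_intCast k)).congr (hLNe k)).residue_eq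
    have hval := Barnes.value_of_eq_one hK.continuous hH.continuous hfe (Barnes.e_intCast k) h1
    have hG0 := Complex.Gamma_ne_zero (hne_neg k hk)
    have h2 := Complex.two_pi_I_ne_zero
    rw [hres, ← hGpos k hk]
    field_simp
    linear_combination hval
  · intro hk _ h1
    have hres := ((Barnes.hasResidue_gammaQuot hH (Barnes.e_intCast k)).congr (hLNe k)).residue_eq
    -- The right side of the functional equation vanishes at k and J(k)⁻¹ ≠ 1. So ℒ_N has residue 0,
    -- and since ρ is entire both sides of the claim are 0.
    have hH0 : H k = 0 := by
      have := hfe k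
      rw [Barnes.e_intCast, sub_self, zero_mul] at this
      exact (mul_eq_zero.1 this).resolve_left (sub_ne_zero.2 h1)
    rw [(Barnes.hasResidue_of_analyticAt (hK.analyticAt k)).residue_eq, hres, hH0]
    simp
  · intro hk h1
    have hk1 : 1 ≤ k := by omega
    have hev := hKnhds k (hnotP k (Or.inr hk)) (hne_neg k hk1)
    have hd := Barnes.hasDerivAt_of_eq_one hev (hLNa k (hnotP k (Or.inr hk))).differentiableAt
      (hGd k (hne_neg k hk1)) h1
    rw [hd.deriv, hGpos k hk1]
    refine ⟨?_, rfl⟩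
    rw [hev.self_of_nhds, h1, sub_self, mul_zero, zero_mul]
  · intro hk _
    have hk1 : 1 ≤ k := by omega
    rw [(hKnhds k (hnotP k (Or.inr hk)) (hne_neg k hk1)).self_of_nhds, hGpos k hk1]
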